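/- Let $\hat{\mathbb C}$ be the Riemann sphere. An annulus (doubly connected domain) is a nonempty connected open set $A\subset\hat{\mathbb C}$ whose complement has exactly two connected components; its modulus is $\operatorname{mod} A=\frac1{2\pi}\log\frac Rr\in(0,\infty]$ if $A$ is conformally isomorphic to the round annulus $\{z\in\mathbb C: r<|z|<R\}$, $0\le r<R\le\infty$ (so $\operatorname{mod}A=\infty$ if $r=0$ or $R=\infty$). For every $i\in\mathbb N$ let $A_i\subset\hat{\mathbb C}$ be an annulus, and let $B_i$ and $C_i$ be the two connected components of $\hat{\mathbb C}\setminus A_i$. Suppose that $B_i\to B$ and $C_i\to C$ as $i\to\infty$ in the Hausdorff metric on nonempty compact subsets of $\hat{\mathbb C}$ (with respect to the chordal metric), and that each of $B$ and $C$ contains at least two points. If there exists a doubly connected connected component $A$ of $\hat{\mathbb C}\setminus(B\cup C)$, then $\operatorname{mod}A_i\to\operatorname{mod}A$; otherwise $\operatorname{mod}A_i\to0$. -/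

import Mathlib

open Filter Topology
open scoped ENNReal

noncomputable section

/-- The Riemann sphere `ℂ ∪ {∞}`, with the topology of the one-point compactification. -/
abbrev RiemannSphere : Type := OnePoint ℂ

namespace RiemannSphere

/-- Inverse stereographic projection onto the unit sphere of Euclidean three-space,
with `∞` sent to the north pole. -/
def toUnitSphere : RiemannSphere → EuclideanSpace ℝ (Fin 3)
  | OnePoint.infty => !₂[0, 0, 1]
  | OnePoint.some z =>
      !₂[2 * z.re / (1 + ‖z‖ ^ 2), 2 * z.im / (1 + ‖z‖ ^ 2), (‖z‖ ^ 2 - 1) / (1 + ‖z‖ ^ 2)]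

/-- The Hausdorff distance of two subsets of the Riemann sphere with respect to the chordal
metric, i.e. the Euclidean distance of the corresponding points of the unit sphere. -/
def chordalHausdorffDist (K L : Set RiemannSphere) : ℝ :=
  Metric.hausdorffDist (toUnitSphere '' K) (toUnitSphere '' L)

/-- The affine coordinate `z` (used only away from `∞`). -/
def affineCoord : RiemannSphere → ℂ
  | OnePoint.infty => 0
  | OnePoint.some z => z

/-- The coordinate `1 / z` at `∞` (used only away from `0`). -/
def inftyCoord : RiemannSphere → ℂ
  | OnePoint.infty => 0
  | OnePoint.some z => z⁻¹

/-- Holomorphic maps from an open set `U ⊆ ℂ` to the Riemann sphere: continuous, and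
holomorphic when read in the coordinates `z` and `1 / z` of the target. -/
def HolomorphicOn (f : ℂ → RiemannSphere) (U : Set ℂ) : Prop :=
  ContinuousOn f U ∧ ∀ z ∈ U,
    (f z ≠ OnePoint.infty → DifferentiableAt ℂ (fun w => affineCoord (f w)) z) ∧
    (f z ≠ ((0 : ℂ) : RiemannSphere) → DifferentiableAt ℂ (fun w => inftyCoord (f w)) z)

/-- `f` maps the open set `U ⊆ ℂ` conformally (biholomorphically) onto `A`. -/
def IsConformalIso (f : ℂ → RiemannSphere) (U : Set ℂ) (A : Set RiemannSphere) : Prop :=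
  HolomorphicOn f U ∧ Set.BijOn f U A

/-- The connected components of a subset `S` of a topological space. -/
def components {X : Type*} [TopologicalSpace X] (S : Set X) : Set (Set X) :=
  {K | ∃ x ∈ S, K = connectedComponentIn S x}

/-- A doubly connected domain (annulus) in the Riemann sphere: a domain whose complement
has exactly two connected components. -/
def IsDoublyConnected (A : Set RiemannSphere) : Prop :=
  IsOpen A ∧ IsConnected A ∧ (components Aᶜ).ncard = 2

/-- The round annulus `r < |z| < R`, where `r = 0` and `R = ∞` are allowed. -/
def roundAnnulus (r R : ℝ≥0∞) : Set ℂ := {z | r < ‖z‖ₑ ∧ ‖z‖ₑ < R}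

/-- The number `log (R / r) / (2 π)`, equal to `∞` if `r = 0` or `R = ∞`. -/
def roundModulus (r R : ℝ≥0∞) : ℝ≥0∞ :=
  (ENNReal.log (R / r)).toENNReal / ENNReal.ofReal (2 * Real.pi)

/-- The (conformal) modulus of an annulus `A`: the number `log (R / r) / (2 π)` for any round
annulus `r < |z| < R` that is conformally isomorphic to `A`. This number does not depend on
the chosen round annulus, so the set below is a singleton and its supremum is that number. -/
def modulus (A : Set RiemannSphere) : ℝ≥0∞ :=
  sSup {m | ∃ r R : ℝ≥0∞, r < R ∧ (∃ f, IsConformalIso f (roundAnnulus r R) A) ∧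
    m = roundModulus r R}

end RiemannSphere

end

namespace AnnulusModulus
open Set Metric Complex

/-! Everything rests on one monotonicity principle, `roundModulus_le_of_not_hasLogOn`: a holomorphic
map between round annuli that winds nontrivially cannot decrease the modulus. Lift the map to the
covering strip and apply Cauchy's theorem to a rectangle one period high: the two horizontal sides
differ by a nonzero integral multiple of `2πi` times the width, while the real parts on the vertical
sides are bounded by the logarithms of the radii of the target.

Suppose a doubly connected component `A` of the complement of `B ∪ C` exists. Lower bound
(`eventually_lt_modulus`): a compact essential subannulus of `A` of almost full modulus avoids `B`
and `C`, hence avoids `B_i` and `C_i` for large `i`; it therefore lies in `A_i`, is still essential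
there, and monotonicity applies. Upper bound (`eventually_modulus_lt`): if `mod A_i ≥ M > m > mod A`
for infinitely many `i`, the standard annulus of modulus `m` embeds in each such `A_i` and separates
`B_i` from `C_i`. A Harnack inequality for zero-free univalent functions makes these embeddings a
normal family; the limit along an ultrafilter is not constant because `B` has two points. By Hurwitz
the limit omits `B ∪ C`, and it winds about the points of `B` but not about those of `C`, the pole
of the chart lying in `C`. A map winding in this way must land in `A`, so `m ≤ mod A`, a
contradiction.

The same limit map settles the other alternative. Two disjoint continua are always separated by a
doubly connected component of their complement (`exists_isDoublyConnected_of_disjoint`, through the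
unicoherence of the sphere), so without `A` the sets `B` and `C` share a point. The limit map would
both wind and not wind about it; hence no positive `m` stays below the moduli infinitely often.

Winding is expressed throughout by the absence of a continuous logarithm of `f - x` (`HasLogOn`).
That the `A_i` and `A` are conformally round comes from `IsRing.exists_uniformization`: a component
of the preimage of a ring under `u ↦ x + exp u` is a simply connected proper domain, Riemann's
theorem maps it to the disc, its deck group is generated by a fixed-point-free disc automorphism,
and such an automorphism is conjugate to the translation by `2πi` of a strip or a half plane, whose
quotient is a round annulus. Monotonicity shows that the modulus does not depend on the
uniformization (`modulus_eq_roundModulus`). -/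

theorem eq_of_locally_eq {X α : Type*} [TopologicalSpace X] {S : Set X} (hS : IsPreconnected S)
    {f : X → α} (hf : ∀ x ∈ S, ∀ᶠ y in 𝓝[S] x, f y = f x) {x y : X} (hx : x ∈ S) (hy : y ∈ S) :
    f x = f y := by
  have : PreconnectedSpace S := Subtype.preconnectedSpace hS
  have h : IsLocallyConstant (fun z : S => f z) := by
    rw [IsLocallyConstant.iff_eventually_eq]
    intro z
    have := hf z z.2
    rw [nhdsWithin_eq_map_subtype_coe z.2] at this
    exact this
  exact h.apply_eq_of_preconnectedSpace ⟨x, hx⟩ ⟨y, hy⟩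

/-- A preconnected set that meets a relatively clopen piece of itself lies in that piece. -/
theorem subset_of_relatively_clopen {X : Type*} [TopologicalSpace X] {S O F : Set X}
    (hS : IsPreconnected S) (hO : IsOpen O) (hF : IsClosed F) (h : S ∩ O = S ∩ F)
    (hne : (S ∩ O).Nonempty) : S ⊆ F := by
  obtain ⟨x, hx⟩ := hne
  intro y hy
  -- Membership in `F` is a `Prop`-valued function, locally constant on `S`. Properties are
  -- propagated along connected sets in this way several times below.
  have key : (x ∈ F) = (y ∈ F) := by
    refine eq_of_locally_eq (f := fun z => (z ∈ F : Prop)) hS ?_ hx.1 hy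
    intro z hz
    by_cases hzF : z ∈ F
    · have hzO : z ∈ O := (h.symm.subset ⟨hz, hzF⟩).2
      filter_upwards [self_mem_nhdsWithin, mem_nhdsWithin_of_mem_nhds (hO.mem_nhds hzO)] with w hw hwO
      have : w ∈ F := (h.subset ⟨hw, hwO⟩).2
      simp [this, hzF]
    · filter_upwards [mem_nhdsWithin_of_mem_nhds (hF.isOpen_compl.mem_nhds hzF)] with w hw
      have : w ∉ F := hw
      simp [this, hzF]
  rw [← key]
  exact (h.subset hx).2

/-! ### Continuous logarithms -/

/-- `u` has a continuous logarithm on `S`. -/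
def HasLogOn {X : Type*} [TopologicalSpace X] (u : X → ℂ) (S : Set X) : Prop :=
  ∃ L : X → ℂ, ContinuousOn L S ∧ ∀ z ∈ S, exp (L z) = u z

namespace HasLogOn

variable {X Y : Type*} [TopologicalSpace X] [TopologicalSpace Y] {u v : X → ℂ} {S T : Set X}

theorem mono (h : HasLogOn u S) (hT : T ⊆ S) : HasLogOn u T :=
  let ⟨L, hL, e⟩ := h; ⟨L, hL.mono hT, fun z hz => e z (hT hz)⟩

theorem congr (h : HasLogOn u S) (hv : ∀ z ∈ S, u z = v z) : HasLogOn v S :=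
  let ⟨L, hL, e⟩ := h; ⟨L, hL, fun z hz => (e z hz).trans (hv z hz)⟩

theorem mul (h : HasLogOn u S) (h' : HasLogOn v S) : HasLogOn (fun z => u z * v z) S :=
  let ⟨L, hL, e⟩ := h
  let ⟨M, hM, e'⟩ := h'
  ⟨fun z => L z + M z, hL.add hM, fun z hz => by rw [exp_add, e z hz, e' z hz]⟩

theorem inv (h : HasLogOn u S) : HasLogOn (fun z => (u z)⁻¹) S :=
  let ⟨L, hL, e⟩ := h
  ⟨fun z => - L z, hL.neg, fun z hz => by rw [exp_neg, e z hz]⟩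

theorem div (h : HasLogOn u S) (h' : HasLogOn v S) : HasLogOn (fun z => u z / v z) S :=
  (h.mul h'.inv).congr fun _ _ => (div_eq_mul_inv _ _).symm

theorem const {c : ℂ} (hc : c ≠ 0) (S : Set X) : HasLogOn (fun _ => c) S :=
  ⟨fun _ => log c, continuousOn_const, fun _ _ => exp_log hc⟩

theorem comp {f : Y → X} {S' : Set Y} (h : HasLogOn u S) (hf : ContinuousOn f S')
    (hm : MapsTo f S' S) : HasLogOn (fun y => u (f y)) S' :=
  let ⟨L, hL, e⟩ := h
  ⟨fun y => L (f y), hL.comp hf hm, fun _ hy => e _ (hm hy)⟩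

/-- The unit disc about `1` lies in the slit plane, so the principal branch serves. With `div_iff`
this gives stability of winding under small relative perturbations. -/
theorem of_norm_sub_one_lt (hu : ContinuousOn u S) (h : ∀ z ∈ S, ‖u z - 1‖ < 1) : HasLogOn u S := by
  have hs : ∀ z ∈ S, u z ∈ slitPlane := fun z hz =>
    ball_one_subset_slitPlane (by simpa [dist_eq_norm] using h z hz)
  exact ⟨fun z => log (u z), hu.clog hs, fun z hz => exp_log (slitPlane_ne_zero (hs z hz))⟩

theorem ne_zero (h : HasLogOn u S) {z : X} (hz : z ∈ S) : u z ≠ 0 :=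
  let ⟨_, _, e⟩ := h
  e z hz ▸ exp_ne_zero _

theorem div_iff (h : HasLogOn (fun z => u z / v z) S) (hv : ∀ z ∈ S, v z ≠ 0) :
    HasLogOn u S ↔ HasLogOn v S := by
  have hu : ∀ z ∈ S, u z ≠ 0 := fun z hz h0 => by have := h.ne_zero hz; simp [h0] at this
  constructor
  · intro h'
    refine (h'.div h).congr fun z hz => ?_
    have := hu z hz; have := hv z hz
    field_simp
  · intro h'
    refine (h.mul h').congr fun z hz => ?_
    have := hv z hz
    field_simp

end HasLogOn

theorem isSimplyConnected_of_convex {S : Set ℂ} (hS : Convex ℝ S) (hne : S.Nonempty) :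
    IsSimplyConnected S := by
  have := hS.contractibleSpace hne
  exact (inferInstance : SimplyConnectedSpace S)

theorem HasLogOn.of_convex {u : ℂ → ℂ} {S : Set ℂ} (hS : Convex ℝ S) (hSo : IsOpen S)
    (hu : ContinuousOn u S) (h0 : ∀ z ∈ S, u z ≠ 0) : HasLogOn u S := by
  rcases S.eq_empty_or_nonempty with rfl | hne
  · exact ⟨fun _ => 0, continuousOn_empty _, by simp⟩
  obtain ⟨f, hf, e⟩ := exists_continuousOn_eqOn_exp_comp (isSimplyConnected_of_convex hS hne) hSo hu
    (by rintro ⟨z, hz, h⟩; exact h0 z hz h)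
  exact ⟨f, hf, fun z hz => e hz⟩

/-- The pointwise integer equals the imaginary part of `L - M` divided by `2π`, so it is continuous,
hence constant on a preconnected set. -/
theorem exists_eq_add_of_exp_eq {X : Type*} [TopologicalSpace X] {S : Set X} (hS : IsPreconnected S)
    {L M : X → ℂ} (hL : ContinuousOn L S) (hM : ContinuousOn M S)
    (h : ∀ z ∈ S, exp (L z) = exp (M z)) :
    ∃ k : ℤ, ∀ z ∈ S, L z = M z + k * (2 * Real.pi * I) := by
  rcases S.eq_empty_or_nonempty with rfl | ⟨x₀, hx₀⟩
  · exact ⟨0, by simp⟩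
  choose! k hk using fun z hz => exp_eq_exp_iff_exists_int.1 (h z hz)
  refine ⟨k x₀, fun z hz => ?_⟩
  have hkc : ContinuousOn (fun z => (k z : ℝ)) S := by
    have : ContinuousOn (fun z => (L z - M z).im / (2 * Real.pi)) S :=
      (continuous_im.comp_continuousOn (hL.sub hM)).div_const _
    refine this.congr fun w hw => ?_
    have := Real.pi_pos
    simp only [hk w hw]
    simp
  have hkc' : ContinuousOn k S := Int.isClosedEmbedding_coe_real.isInducing.continuousOn_iff.2 hkc
  rw [hS.constant hkc' hx₀ hz, hk z hz]

theorem not_hasLogOn_sphere {R : ℝ} (hR : 0 < R) : ¬ HasLogOn (fun z : ℂ => z) (sphere 0 R) := by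
  rintro ⟨L, hL, e⟩
  have hmem : ∀ t : ℝ, (R : ℂ) * exp (t * I) ∈ sphere (0 : ℂ) R := by
    intro t
    simp [Complex.norm_exp_ofReal_mul_I, abs_of_pos hR]
  have h1 : ContinuousOn (fun t : ℝ => L (R * exp (t * I))) univ :=
    hL.comp (by fun_prop) (fun t _ => hmem t)
  -- The logarithm `log R + it` of `R exp (it)` grows by `2πi` over one turn, whereas `L (R exp
  -- (it))` returns to its value.
  obtain ⟨k, hk⟩ := exists_eq_add_of_exp_eq isPreconnected_univ h1
    (M := fun t : ℝ => (Real.log R : ℂ) + t * I) (by fun_prop) (by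
      intro t _
      rw [e _ (hmem t), exp_add, ← ofReal_exp, Real.exp_log hR])
  have h0 := hk 0 trivial
  have h2 := hk (2 * Real.pi) trivial
  have hper : exp (((2 * Real.pi : ℝ) : ℂ) * I) = exp (((0 : ℝ) : ℂ) * I) := by
    push_cast
    rw [exp_two_pi_mul_I]; simp
  simp only [hper] at h2
  rw [h0] at h2
  have : (2 * Real.pi : ℂ) * I = 0 := by
    push_cast at h2
    linear_combination -h2
  simp [Real.pi_ne_zero] at this

/-- Continuous logarithms of holomorphic functions are holomorphic. -/
theorem hasDerivAt_log_of_exp_eq {u L : ℂ → ℂ} {U : Set ℂ} (hU : IsOpen U) (hL : ContinuousOn L U)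
    (e : ∀ z ∈ U, exp (L z) = u z) {z : ℂ} (hz : z ∈ U) {u' : ℂ} (hu : HasDerivAt u u' z) :
    HasDerivAt L (u' / u z) z := by
  have h0 : u z ≠ 0 := e z hz ▸ exp_ne_zero _
  -- Near `z` the function `L` coincides with this branch: continuity keeps the imaginary part of `L
  -- w - L z` below `1 < π`.
  have h1 : HasDerivAt (fun w => log (u w / u z) + L z) (u' / u z) z := by
    have := ((hu.div_const (u z)).clog (by simp [h0])).add_const (L z)
    simpa [h0] using this
  refine h1.congr_of_eventuallyEq ?_
  have hLz : ContinuousAt L z := hL.continuousAt (hU.mem_nhds hz)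
  have h2 : ∀ᶠ w in 𝓝 z, ‖L w - L z‖ < 1 := by
    have := Metric.continuousAt_iff'.1 hLz 1 one_pos
    simpa [dist_eq_norm] using this
  filter_upwards [h2, hU.mem_nhds hz] with w hw hwU
  have him : |(L w - L z).im| < 1 := (abs_im_le_norm _).trans_lt hw
  have hpi := Real.pi_gt_three
  rw [abs_lt] at him
  rw [← e w hwU, ← e z hz, ← exp_sub, log_exp (by linarith) (by linarith)]
  ring

/-- Moving `x` by less than its distance to `H` multiplies `w - x` by a factor within distance `1`
of `1`, which has a logarithm. So the existence of a logarithm of `(w - a) / (w - x)` is locally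
constant in `x ∈ K`, and it holds at `x = a`. -/
theorem HasLogOn.sub_div_sub {H K : Set ℂ} (hH : IsCompact H) (hK : IsPreconnected K)
    (hd : Disjoint H K) {a b : ℂ} (ha : a ∈ K) (hb : b ∈ K) :
    HasLogOn (fun w => (w - a) / (w - b)) H := by
  have hne : ∀ x ∈ K, ∀ w ∈ H, w - x ≠ 0 := fun x hx w hw h =>
    disjoint_left.1 hd hw (by rwa [sub_eq_zero.1 h])
  have key : (HasLogOn (fun w => (w - a) / (w - a)) H : Prop) =
      HasLogOn (fun w => (w - a) / (w - b)) H := by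
    refine eq_of_locally_eq (f := fun x => (HasLogOn (fun w => (w - a) / (w - x)) H : Prop)) hK ?_
      ha hb
    intro x hx
    have hxH : x ∈ Hᶜ := disjoint_right.1 hd hx
    obtain ⟨δ, hδ, hball⟩ := Metric.isOpen_iff.1 hH.isClosed.isOpen_compl x hxH
    filter_upwards [self_mem_nhdsWithin, mem_nhdsWithin_of_mem_nhds (ball_mem_nhds x hδ)]
      with y hyK hy
    have hlog : HasLogOn (fun w => (w - y) / (w - x)) H := by
      refine .of_norm_sub_one_lt ?_ ?_
      · exact ContinuousOn.div (by fun_prop) (by fun_prop) (fun w hw => hne x hx w hw)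
      · intro w hw
        have h1 := hne x hx w hw
        have h2 : δ ≤ ‖w - x‖ := by
          by_contra hlt
          exact hball (by simpa [dist_eq_norm] using hlt) hw
        rw [div_sub_one h1, norm_div, div_lt_one (by positivity)]
        have : w - y - (w - x) = -(y - x) := by ring
        rw [this, norm_neg]
        exact (by simpa [dist_eq_norm] using hy : ‖y - x‖ < δ).trans_le h2
    apply propext
    constructor
    · intro h
      refine (h.mul hlog).congr fun w hw => ?_
      have := hne x hx w hw; have := hne y hyK w hw
      field_simp
    · intro h
      refine (h.div hlog).congr fun w hw => ?_
      have := hne x hx w hw; have := hne y hyK w hw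
      field_simp
  rw [← key]
  exact (HasLogOn.const one_ne_zero H).congr fun w hw => (div_self (hne a ha w hw)).symm

/-! ### Logarithms and sets connected through infinity -/

/-- `C ∪ {∞}` is connected: `C` has no nonempty compact relatively open subset. -/
def NoCompactPiece (C : Set ℂ) : Prop :=
  ∀ Q O : Set ℂ, IsCompact Q → IsOpen O → C ∩ O = Q → Q = ∅

/-- For `x` beyond a disc containing `H` the function `w - x` has a logarithm on `H`. Let `X` be the
set of `x ∈ C` for which `(w - a) / (w - x)` has one; it is relatively open and closed in `C` and
contains `a`. If `w - a` had no logarithm, `X` could not reach such distant points and would be a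
nonempty compact piece of `C`. -/
theorem HasLogOn.sub_of_noCompactPiece {H C : Set ℂ} (hH : IsCompact H) (hC : IsClosed C)
    (hp : NoCompactPiece C) (hd : Disjoint H C) {a : ℂ} (ha : a ∈ C) :
    HasLogOn (fun w => w - a) H := by
  have hne : ∀ x ∈ C, ∀ w ∈ H, w - x ≠ 0 := fun x hx w hw h =>
    disjoint_left.1 hd hw (by rwa [sub_eq_zero.1 h])
  obtain ⟨R, hR⟩ := hH.isBounded.subset_closedBall 0
  by_contra hno
  set X := {x ∈ C | HasLogOn (fun w => (w - a) / (w - x)) H} with hX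
  have haX : a ∈ X := ⟨ha, (HasLogOn.const one_ne_zero H).congr fun w hw =>
    (div_self (hne a ha w hw)).symm⟩
  have hstep : ∀ x ∈ C, ∃ δ > 0, ∀ y ∈ C, dist y x < δ → (x ∈ X ↔ y ∈ X) := by
    intro x hx
    obtain ⟨δ, hδ, hball⟩ := Metric.isOpen_iff.1 hH.isClosed.isOpen_compl x (disjoint_right.1 hd hx)
    refine ⟨δ, hδ, fun y hy hyx => ?_⟩
    have h1 : HasLogOn (fun w => (w - x) / (w - y)) H :=
      HasLogOn.sub_div_sub hH (convex_ball x δ).isPreconnected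
        (disjoint_right.2 fun z hz => hball hz) (mem_ball_self hδ) hyx
    constructor
    · rintro ⟨-, h⟩
      refine ⟨hy, (h.mul h1).congr fun w hw => ?_⟩
      have := hne x hx w hw; have := hne y hy w hw
      field_simp
    · rintro ⟨-, h⟩
      refine ⟨hx, (h.div h1).congr fun w hw => ?_⟩
      have := hne x hx w hw; have := hne y hy w hw
      field_simp
  choose! δ hδ hδX using hstep
  have hXb : X ⊆ closedBall 0 R := by
    rintro x ⟨hx, hlog⟩
    by_contra hxR
    apply hno
    have hxR' : R < ‖x‖ := by simpa using hxR
    have h0 : 0 ∉ ball x ‖x‖ := by simp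
    have hlx : HasLogOn (fun w => w - x) H := by
      have : HasLogOn (fun w => (w - x) / (0 - x)) H := by
        rcases H.eq_empty_or_nonempty with rfl | ⟨w0, hw0⟩
        · exact ⟨fun _ => 0, continuousOn_empty _, by simp⟩
        have hRn : 0 ≤ R := (norm_nonneg w0).trans (by simpa using hR hw0)
        have hx0 : x ≠ 0 := by rintro rfl; simp at hxR'; linarith
        refine .of_norm_sub_one_lt (by fun_prop) fun w hw => ?_
        have hwR : ‖w‖ ≤ R := by simpa using hR hw
        have : (w - x) / (0 - x) - 1 = - (w / x) := by field_simp; ring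
        rw [this, norm_neg, norm_div, div_lt_one (by positivity)]
        linarith
      rcases H.eq_empty_or_nonempty with rfl | ⟨w0, hw0⟩
      · exact ⟨fun _ => 0, continuousOn_empty _, by simp⟩
      have hRn : 0 ≤ R := (norm_nonneg w0).trans (by simpa using hR hw0)
      have hx0 : 0 - x ≠ 0 := by
        intro h; have : x = 0 := by simpa using h
        rw [this] at hxR'; simp at hxR'; linarith
      refine (this.mul (HasLogOn.const hx0 H)).congr fun w hw => ?_
      field_simp
    refine (hlog.mul hlx).congr fun w hw => ?_
    have := hne x hx w hw
    field_simp
  have hXcl : IsClosed X := by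
    refine isClosed_of_closure_subset fun x hx => ?_
    have hxC : x ∈ C := hC.closure_subset_iff.2 (fun _ h => h.1) hx
    obtain ⟨y, hyX, hy⟩ := Metric.mem_closure_iff.1 hx (δ x) (hδ x hxC)
    exact (hδX x hxC y hyX.1 (by rwa [dist_comm])).2 hyX
  have := hp X (⋃ x ∈ X, ball x (δ x)) ((isCompact_closedBall 0 R).of_isClosed_subset hXcl hXb)
    (isOpen_biUnion fun _ _ => isOpen_ball) (by
      ext y
      simp only [mem_inter_iff, mem_iUnion, exists_prop]
      constructor
      · rintro ⟨hyC, x, hxX, hy⟩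
        exact (hδX x hxX.1 y hyC hy).1 hxX
      · intro hy
        exact ⟨hy.1, y, hy, mem_ball_self (hδ y hy.1)⟩)
  rw [this] at haX
  exact haX

/-- A nonvanishing continuous function with logarithms on compact subsets has a logarithm. -/
theorem HasLogOn.of_compacts {U : Set ℂ} (hU : IsOpen U) (hUc : IsConnected U) {u : ℂ → ℂ}
    (h : ∀ H ⊆ U, IsCompact H → HasLogOn u H) : HasLogOn u U := by
  obtain ⟨p, hp⟩ := hUc.nonempty
  have hpath : IsPathConnected U := hU.isConnected_iff_isPathConnected.1 hUc
  have hup : u p ≠ 0 := (h {p} (by simpa using hp) isCompact_singleton).ne_zero (mem_singleton p)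
  -- the compact connected sets through `p`
  have hex : ∀ z ∈ U, ∃ V, IsOpen V ∧ IsPreconnected V ∧ p ∈ V ∧ z ∈ V ∧ V ⊆ U ∧
      HasLogOn u V := by
    intro z hz
    obtain ⟨γ, hγ⟩ := hpath.joinedIn p hp z hz
    have hγc : IsCompact (range γ) := isCompact_range γ.continuous
    have hγU : range γ ⊆ U := by rintro _ ⟨t, rfl⟩; exact hγ t
    obtain ⟨δ, hδ, hδU⟩ := hγc.exists_cthickening_subset_open hU hγU
    refine ⟨thickening δ (range γ), isOpen_thickening, ?_, ?_, ?_,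
      (thickening_subset_cthickening _ _).trans hδU,
      (h _ hδU hγc.cthickening).mono (thickening_subset_cthickening _ _)⟩
    · rw [thickening_eq_biUnion_ball]
      have hc : IsPreconnected (range γ) := isPreconnected_range γ.continuous
      refine isPreconnected_of_forall p fun y hy => ?_
      obtain ⟨x, hx, hyx⟩ := mem_iUnion₂.1 hy
      refine ⟨range γ ∪ ball x δ, ?_, Or.inl ⟨0, by simp⟩, Or.inr hyx, ?_⟩
      · refine union_subset (fun w hw => ?_) (fun w hw => ?_)
        · exact mem_biUnion hw (mem_ball_self hδ)
        · exact mem_biUnion hx hw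
      · exact hc.union x hx (mem_ball_self hδ) (convex_ball x δ).isPreconnected
    · exact self_subset_thickening hδ _ ⟨0, by simp⟩
    · exact self_subset_thickening hδ _ ⟨1, by simp⟩
  have hex' : ∀ z ∈ U, ∃ V : Set ℂ, ∃ L : ℂ → ℂ, IsOpen V ∧ IsPreconnected V ∧ p ∈ V ∧ z ∈ V ∧
      V ⊆ U ∧ ContinuousOn L V ∧ (∀ w ∈ V, exp (L w) = u w) ∧ L p = log (u p) := by
    intro z hz
    obtain ⟨V, h1, h2, h3, h4, h5, L, hL, e⟩ := hex z hz
    refine ⟨V, fun w => L w + (log (u p) - L p), h1, h2, h3, h4, h5, hL.add continuousOn_const, ?_,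
      by ring⟩
    intro w hw
    rw [exp_add, exp_sub, e w hw, exp_log hup, e p h3, div_self hup, mul_one]
  choose! V L hVo hVc hpV hzV hVU hL e hLp using hex'
  -- consistency needs agreement on a chain; use all compact sets at once
  have hagree : ∀ z ∈ U, ∀ z' ∈ U, ∀ w ∈ V z ∩ V z', L z w = L z' w := by
    intro z hz z' hz' w hw
    obtain ⟨γ, hγ⟩ := (((hVo z hz).isConnected_iff_isPathConnected.1
      ⟨⟨p, hpV z hz⟩, hVc z hz⟩).joinedIn p (hpV z hz) w hw.1)
    obtain ⟨γ', hγ'⟩ := (((hVo z' hz').isConnected_iff_isPathConnected.1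
      ⟨⟨p, hpV z' hz'⟩, hVc z' hz'⟩).joinedIn p (hpV z' hz') w hw.2)
    have hr : range γ ⊆ V z := by rintro _ ⟨t, rfl⟩; exact hγ t
    have hr' : range γ' ⊆ V z' := by rintro _ ⟨t, rfl⟩; exact hγ' t
    -- A single logarithm on the union of both paths compares the two branches: each differs from
    -- `M` by a constant along its path, and the constants agree because both branches are
    -- normalized at `p`.
    obtain ⟨M, hM, eM⟩ := h (range γ ∪ range γ')
      (union_subset (hr.trans (hVU z hz)) (hr'.trans (hVU z' hz')))
      ((isCompact_range γ.continuous).union (isCompact_range γ'.continuous))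
    obtain ⟨k, hk⟩ := exists_eq_add_of_exp_eq (isPreconnected_range γ.continuous)
      ((hL z hz).mono hr) (hM.mono subset_union_left)
      (fun x hx => by rw [e z hz x (hr hx), eM x (Or.inl hx)])
    obtain ⟨k', hk'⟩ := exists_eq_add_of_exp_eq (isPreconnected_range γ'.continuous)
      ((hL z' hz').mono hr') (hM.mono subset_union_right)
      (fun x hx => by rw [e z' hz' x (hr' hx), eM x (Or.inr hx)])
    have hp0 : p ∈ range γ := ⟨0, by simp⟩
    have hp0' : p ∈ range γ' := ⟨0, by simp⟩
    have hw1 : w ∈ range γ := ⟨1, by simp⟩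
    have hw1' : w ∈ range γ' := ⟨1, by simp⟩
    have e1 := hk p hp0
    have e2 := hk' p hp0'
    rw [hLp z hz] at e1
    rw [hLp z' hz'] at e2
    rw [hk w hw1, hk' w hw1']
    linear_combination e2 - e1
  refine ⟨fun z => L z z, ?_, fun z hz => e z hz z (hzV z hz)⟩
  intro z hz
  have h1 : ContinuousAt (L z) z := (hL z hz).continuousAt ((hVo z hz).mem_nhds (hzV z hz))
  refine (h1.congr ?_).continuousWithinAt
  filter_upwards [(hVo z hz).mem_nhds (hzV z hz)] with w hw
  exact hagree z hz w (hVU z hz hw) w ⟨hw, hzV w (hVU z hz hw)⟩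

theorem HasLogOn.sub_of_noCompactPiece_compl {U : Set ℂ} (hU : IsOpen U) (hUc : IsConnected U)
    (hp : NoCompactPiece Uᶜ) {a : ℂ} (ha : a ∉ U) : HasLogOn (fun w => w - a) U :=
  .of_compacts hU hUc fun _ hHU hH => .sub_of_noCompactPiece hH hU.isClosed_compl hp
    (disjoint_compl_right_iff_subset.2 hHU) ha

/-! ### Injective holomorphic functions -/

theorem nhds_le_map_of_injOn {f : ℂ → ℂ} {U : Set ℂ} (hU : IsOpen U) (hf : DifferentiableOn ℂ f U)
    (hi : InjOn f U) {z : ℂ} (hz : z ∈ U) : 𝓝 (f z) ≤ map f (𝓝 z) := by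
  rcases (hf.analyticAt (hU.mem_nhds hz)).eventually_constant_or_nhds_le_map_nhds with h | h
  · exfalso
    have h1 : ∀ᶠ w in 𝓝[≠] z, w ∈ U ∧ f w = f z ∧ w ≠ z := by
      filter_upwards [nhdsWithin_le_nhds h, nhdsWithin_le_nhds (hU.mem_nhds hz),
        self_mem_nhdsWithin] with w h1 h2 h3 using ⟨h2, h1, h3⟩
    obtain ⟨w, hw, hfw, hne⟩ := h1.exists
    exact hne (hi hw hz hfw)
  · exact h

theorem isOpen_image_of_injOn {f : ℂ → ℂ} {U V : Set ℂ} (hU : IsOpen U)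
    (hf : DifferentiableOn ℂ f U) (hi : InjOn f U) (hV : IsOpen V) (hVU : V ⊆ U) :
    IsOpen (f '' V) := by
  rw [isOpen_iff_mem_nhds]
  rintro _ ⟨z, hz, rfl⟩
  exact nhds_le_map_of_injOn hU hf hi (hVU hz) (image_mem_map (hV.mem_nhds hz))

/-- The inverse of an injective holomorphic function is holomorphic. -/
theorem differentiableOn_inverse {f g : ℂ → ℂ} {U : Set ℂ} (hU : IsOpen U)
    (hf : DifferentiableOn ℂ f U) (hg : ∀ z ∈ U, g (f z) = z) : DifferentiableOn ℂ g (f '' U) := by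
  have hi : InjOn f U := fun x hx y hy h => by rw [← hg x hx, ← hg y hy, h]
  have hopen : IsOpen (f '' U) := isOpen_image_of_injOn hU hf hi hU subset_rfl
  have hcont : ∀ z ∈ U, ContinuousAt g (f z) := by
    intro z hz N hN
    rw [hg z hz] at hN
    have h1 : f '' (N ∩ U) ∈ 𝓝 (f z) :=
      nhds_le_map_of_injOn hU hf hi hz (image_mem_map (inter_mem hN (hU.mem_nhds hz)))
    refine mem_map.2 (mem_of_superset h1 ?_)
    rintro _ ⟨w, hw, rfl⟩
    rw [mem_preimage, hg w hw.2]
    exact hw.1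
  have hdiff : ∀ z ∈ U, deriv f z ≠ 0 → DifferentiableAt ℂ g (f z) := by
    intro z hz hd
    have hs : HasStrictDerivAt f (deriv f z) (g (f z)) := by
      rw [hg z hz]
      exact (hf.analyticAt (hU.mem_nhds hz)).hasStrictDerivAt
    refine (HasStrictDerivAt.of_local_left_inverse (hcont z hz) hs hd ?_).hasDerivAt.differentiableAt
    filter_upwards [hopen.mem_nhds (mem_image_of_mem f hz)]
    rintro _ ⟨w, hw, rfl⟩
    rw [hg w hw]
  rintro _ ⟨z, hz, rfl⟩
  have han : AnalyticAt ℂ f z := hf.analyticAt (hU.mem_nhds hz)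
  -- Critical points of `f` are isolated, since `f` is not locally constant. The continuous inverse
  -- is thus holomorphic off an isolated point of the image, and the singularity is removable;
  -- nonvanishing of the derivative need not be known beforehand.
  have hev : ∀ᶠ w in 𝓝[≠] z, deriv f w ≠ 0 := by
    rcases han.deriv.eventually_eq_zero_or_eventually_ne_zero with h | h
    · exfalso
      obtain ⟨r, hr, hball⟩ := Metric.eventually_nhds_iff_ball.1
        (h.and (hU.eventually_mem hz))
      have hc : ∀ w ∈ ball z r, f w = f z := by
        intro w hw
        refine (convex_ball z r).is_const_of_fderivWithin_eq_zero (𝕜 := ℂ)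
          (hf.mono fun x hx => (hball x hx).2) ?_ hw (mem_ball_self hr)
        intro x hx
        rw [fderivWithin_of_isOpen isOpen_ball hx]
        ext
        simpa using (hball x hx).1
      have : ∀ᶠ w in 𝓝[≠] z, w ∈ ball z r ∧ w ≠ z := by
        filter_upwards [nhdsWithin_le_nhds (ball_mem_nhds z hr), self_mem_nhdsWithin] with w h1 h2
          using ⟨h1, h2⟩
      obtain ⟨w, hw, hne⟩ := this.exists
      exact hne (hi (hball w hw).2 hz (hc w hw))
    · exact h
  refine (Complex.analyticAt_of_differentiable_on_punctured_nhds_of_continuousAt ?_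
    (hcont z hz)).differentiableAt.differentiableWithinAt
  rw [eventually_nhdsWithin_iff] at hev ⊢
  have h1 := nhds_le_map_of_injOn hU hf hi hz (image_mem_map (hev.and (hU.eventually_mem hz)))
  filter_upwards [h1]
  rintro _ ⟨w, ⟨hw, hwU⟩, rfl⟩ hne
  exact hdiff w hwU (hw fun h => hne (by rw [h]; rfl))

/-! ### Normal families -/

/-- **Montel's theorem** along an ultrafilter. -/
theorem exists_tendstoLocallyUniformlyOn {ι : Type*} (𝒰 : Ultrafilter ι) {U : Set ℂ} (hU : IsOpen U)
    {F : ι → ℂ → ℂ} (hF : ∀ z ∈ U, ∃ r > 0, ∃ M, ∀ᶠ i in (𝒰 : Filter ι),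
      DifferentiableOn ℂ (F i) (ball z r) ∧ ∀ w ∈ ball z r, ‖F i w‖ ≤ M) :
    ∃ f, TendstoLocallyUniformlyOn F f 𝒰 U ∧ DifferentiableOn ℂ f U := by
  -- Along an ultrafilter, pointwise bounds already give pointwise limits by compactness of discs,
  -- so no subsequence is extracted; equicontinuity makes the convergence locally uniform.
  have hlim : ∀ z ∈ U, ∃ l, Tendsto (fun i => F i z) 𝒰 (𝓝 l) := by
    intro z hz
    obtain ⟨r, hr, M, hM⟩ := hF z hz
    obtain ⟨l, -, hl⟩ := (isCompact_closedBall (0 : ℂ) M).ultrafilter_le_nhds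
      (𝒰.map (fun i => F i z)) (by
        rw [Ultrafilter.coe_map, le_principal_iff, mem_map]
        filter_upwards [hM] with i hi
        simpa using hi.2 z (mem_ball_self hr))
    exact ⟨l, hl⟩
  choose! f hf using hlim
  have hunif : TendstoLocallyUniformlyOn F f 𝒰 U := by
    rw [Metric.tendstoLocallyUniformlyOn_iff]
    intro ε hε z hz
    obtain ⟨r, hr, M, hM⟩ := hF z hz
    obtain ⟨r', hr', hr'U⟩ := Metric.isOpen_iff.1 hU z hz
    -- Schwarz lemma gives equicontinuity at `z`
    have hlip : ∀ᶠ i in (𝒰 : Filter ι), ∀ w ∈ ball z r, dist (F i w) (F i z) ≤ 2 * M / r * dist w z := by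
      filter_upwards [hM] with i hi w hw
      refine dist_le_div_mul_dist_of_mapsTo_ball hi.1 (fun x hx => ?_) hw
      rw [mem_closedBall, dist_eq_norm]
      calc _ ≤ ‖F i x‖ + ‖F i z‖ := norm_sub_le _ _
        _ ≤ 2 * M := by linarith [hi.2 x hx, hi.2 z (mem_ball_self hr)]
    have hlip' : ∀ w ∈ ball z r ∩ U, dist (f w) (f z) ≤ 2 * M / r * dist w z := by
      intro w hw
      refine le_of_tendsto ((hf w hw.2).dist (hf z hz)) ?_
      filter_upwards [hlip] with i hi using hi w hw.1
    have hM0 : 0 ≤ M := by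
      obtain ⟨i, hi⟩ := hM.exists
      exact (norm_nonneg _).trans (hi.2 z (mem_ball_self hr))
    set δ := min (min r r') (ε * r / (3 * (2 * M + 1))) with hδ
    have hδ0 : 0 < δ := by positivity
    have hsmall : ∀ w ∈ ball z δ, 2 * M / r * dist w z ≤ ε / 3 := by
      intro w hw
      have hw' : dist w z ≤ ε * r / (3 * (2 * M + 1)) := (mem_ball.1 hw).le.trans (min_le_right _ _)
      calc 2 * M / r * dist w z ≤ 2 * M / r * (ε * r / (3 * (2 * M + 1))) := by gcongr
        _ = ε / 3 * (2 * M / (2 * M + 1)) := by field_simp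
        _ ≤ ε / 3 * 1 := by
          gcongr
          rw [div_le_one (by positivity)]; linarith
        _ = ε / 3 := mul_one _
    refine ⟨ball z δ, mem_nhdsWithin_of_mem_nhds (ball_mem_nhds z hδ0), ?_⟩
    have h3 := (Metric.tendsto_nhds.1 (hf z hz)) (ε / 3) (by positivity)
    filter_upwards [hlip, h3] with i hi h3i w hw
    have hwr : w ∈ ball z r := ball_subset_ball ((min_le_left _ _).trans (min_le_left _ _)) hw
    have hwU : w ∈ U := hr'U (ball_subset_ball ((min_le_left _ _).trans (min_le_right _ _)) hw)
    have a1 := (hi w hwr).trans (hsmall w hw)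
    have a2 := (hlip' w ⟨hwr, hwU⟩).trans (hsmall w hw)
    rw [dist_comm] at h3i a1
    calc dist (f w) (F i w) ≤ dist (f w) (f z) + dist (f z) (F i z) + dist (F i z) (F i w) :=
          dist_triangle4 _ _ _ _
      _ < ε := by linarith
  refine ⟨f, hunif, fun z hz => ?_⟩
  obtain ⟨r, hr, M, hM⟩ := hF z hz
  obtain ⟨r', hr', hr'U⟩ := Metric.isOpen_iff.1 hU z hz
  have h1 : DifferentiableOn ℂ f (ball z (min r r')) :=
    (hunif.mono ((ball_subset_ball (min_le_right _ _)).trans hr'U)).differentiableOn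
      (hM.mono fun i hi => hi.1.mono (ball_subset_ball (min_le_left _ _))) isOpen_ball
  exact (h1.differentiableAt (isOpen_ball.mem_nhds
    (mem_ball_self (lt_min hr hr')))).differentiableWithinAt

/-- **Hurwitz's theorem** on zeros of limits of zero-free functions. -/
theorem ne_zero_of_tendstoLocallyUniformlyOn {ι : Type*} {l : Filter ι} [l.NeBot] {U : Set ℂ}
    (hU : IsOpen U) (hUc : IsPreconnected U) {F : ι → ℂ → ℂ} {f : ℂ → ℂ}
    (h : TendstoLocallyUniformlyOn F f l U) (hF : ∀ᶠ i in l, DifferentiableOn ℂ (F i) U)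
    (h0 : ∀ᶠ i in l, ∀ z ∈ U, F i z ≠ 0) {z₁ : ℂ} (hz₁ : z₁ ∈ U) (hf₁ : f z₁ ≠ 0) :
    ∀ z ∈ U, f z ≠ 0 := by
  intro z₀ hz₀ hfz
  have hf : DifferentiableOn ℂ f U := h.differentiableOn hF hU
  have han : AnalyticOnNhd ℂ f U := hf.analyticOnNhd hU
  have hev : ∀ᶠ w in 𝓝[≠] z₀, f w ≠ 0 := by
    rcases (han z₀ hz₀).eventually_eq_zero_or_eventually_ne_zero with h | h
    · exact absurd (han.eqOn_zero_of_preconnected_of_eventuallyEq_zero hUc hz₀ h hz₁) hf₁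
    · exact h
  rw [eventually_nhdsWithin_iff] at hev
  obtain ⟨r, hr, hball⟩ := Metric.nhds_basis_closedBall.mem_iff.1
    (Filter.inter_mem hev (hU.mem_nhds hz₀))
  have hs : (sphere z₀ r).Nonempty := NormedSpace.sphere_nonempty.2 hr.le
  have hsub : closedBall z₀ r ⊆ U := fun w hw => (hball hw).2
  obtain ⟨w₀, hw₀, hmin⟩ := (isCompact_sphere z₀ r).exists_isMinOn hs
    ((hf.continuousOn.mono (sphere_subset_closedBall.trans hsub)).norm)
  set m := ‖f w₀‖
  have hm : 0 < m := norm_pos_iff.2 ((hball (sphere_subset_closedBall hw₀)).1 (by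
    rintro rfl; simp at hw₀; exact hr.ne hw₀))
  have hunif := (tendstoLocallyUniformlyOn_iff_forall_isCompact hU).1 h _ hsub
    (isCompact_closedBall z₀ r)
  rw [Metric.tendstoUniformlyOn_iff] at hunif
  obtain ⟨i, hi1, hi2, hi3⟩ := ((hunif (m / 3) (by positivity)).and (hF.and h0)).exists
  -- Maximum principle for `1 / F i`: on the circle `‖F i‖ ≥ 2m/3`, so the same holds at the centre,
  -- whereas `f z₀ = 0` forces `‖F i z₀‖ < m/3`.
  have hb : ‖(F i z₀)⁻¹‖ ≤ 3 / (2 * m) := by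
    refine Complex.norm_le_of_forall_mem_frontier_norm_le (U := ball z₀ r)
      (f := fun z => (F i z)⁻¹) isBounded_ball ?_ ?_ (subset_closure (mem_ball_self hr))
    · refine DifferentiableOn.diffContOnCl ?_
      rw [closure_ball z₀ hr.ne']
      exact (hi2.mono hsub).inv fun z hz => hi3 z (hsub hz)
    · intro z hz
      rw [frontier_ball z₀ hr.ne'] at hz
      have h1 : m ≤ ‖f z‖ := hmin hz
      have h2 := hi1 z (sphere_subset_closedBall hz)
      rw [dist_eq_norm] at h2
      have h3 : ‖f z‖ - ‖F i z‖ ≤ ‖f z - F i z‖ := norm_sub_norm_le _ _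
      have h4 : 2 * m / 3 ≤ ‖F i z‖ := by linarith
      rw [norm_inv, inv_le_comm₀ (by linarith) (by positivity), inv_div]
      exact h4
  have h2 := hi1 z₀ (mem_closedBall_self hr.le)
  rw [hfz, dist_zero_left] at h2
  have h5 : 0 < ‖F i z₀‖ := norm_pos_iff.2 (hi3 z₀ hz₀)
  rw [norm_inv, inv_le_comm₀ h5 (by positivity), inv_div] at hb
  linarith

/-! ### A Harnack inequality for zero-free univalent functions -/

/-- A holomorphic function whose derivative at `a` is at least half of its bound on
`ball a r` covers a disc of radius comparable to `r * ‖k' a‖`. -/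
theorem closedBall_subset_image {k : ℂ → ℂ} {a : ℂ} {r : ℝ} (hr : 0 < r)
    (hk : DifferentiableOn ℂ k (ball a r))
    (hb : ∀ z ∈ ball a r, ‖deriv k z‖ ≤ 2 * ‖deriv k a‖) :
    ball (k a) (‖deriv k a‖ * r / 32) ⊆ k '' ball a r := by
  rcases eq_or_ne (deriv k a) 0 with h0 | h0
  · rw [h0]
    simp
  set N := ‖deriv k a‖ with hN
  have hN0 : 0 < N := norm_pos_iff.2 h0
  have hdk : DifferentiableOn ℂ (deriv k) (ball a r) := hk.deriv isOpen_ball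
  have h1 : ∀ z ∈ ball a r, ‖deriv k z - deriv k a‖ ≤ 3 * N / r * dist z a := by
    intro z hz
    rw [← dist_eq_norm]
    refine dist_le_div_mul_dist_of_mapsTo_ball hdk (fun x hx => ?_) hz
    rw [mem_closedBall, dist_eq_norm]
    exact (norm_sub_le _ _).trans (by linarith [hb x hx])
  -- At this radius `k'` varies by at most `3N/8 ≤ N/2`, so `k` stays at distance at least `Nρ/2`
  -- from `k a` on the circle. The covering theorem loses another factor `2`, and `Nρ/4 = Nr/32`.
  set ρ := r / 8 with hρ
  have hρ0 : 0 < ρ := by positivity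
  have hsub : closedBall a ρ ⊆ ball a r := closedBall_subset_ball (by rw [hρ]; linarith)
  have h2 : ∀ z ∈ closedBall a ρ, ‖deriv k z - deriv k a‖ ≤ N / 2 := by
    intro z hz
    refine (h1 z (hsub hz)).trans ?_
    calc 3 * N / r * dist z a ≤ 3 * N / r * ρ := by gcongr; exact hz
      _ = 3 * N / 8 := by rw [hρ]; field_simp
      _ ≤ N / 2 := by linarith
  -- lower bound on the sphere
  have h3 : ∀ z ∈ closedBall a ρ, ‖(k z - deriv k a * z) - (k a - deriv k a * a)‖ ≤ N / 2 * ‖z - a‖ := by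
    intro z hz
    refine (convex_closedBall a ρ).norm_image_sub_le_of_norm_hasDerivWithin_le
      (f := fun z => k z - deriv k a * z) (f' := fun z => deriv k z - deriv k a) ?_ h2
      (mem_closedBall_self hρ0.le) hz
    intro x hx
    have := (hk.differentiableAt (isOpen_ball.mem_nhds (hsub hx))).hasDerivAt
    have h := this.sub ((hasDerivAt_id x).const_mul (deriv k a))
    rw [mul_one] at h
    exact h.hasDerivWithinAt
  have hdc : DiffContOnCl ℂ k (ball a ρ) := by
    refine DifferentiableOn.diffContOnCl ?_
    rw [closure_ball a hρ0.ne']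
    exact hk.mono hsub
  have h4 : ∀ z ∈ sphere a ρ, N * ρ / 2 ≤ ‖k z - k a‖ := by
    intro z hz
    have hz' : ‖z - a‖ = ρ := by simpa [dist_eq_norm] using hz
    have h5 := h3 z (sphere_subset_closedBall hz)
    rw [hz'] at h5
    have h6 : ‖deriv k a * (z - a)‖ = N * ρ := by rw [norm_mul, hz']
    have h7 : deriv k a * (z - a) =
      (k z - k a) - ((k z - deriv k a * z) - (k a - deriv k a * a)) := by ring
    rw [h7] at h6
    have := norm_sub_le (k z - k a) ((k z - deriv k a * z) - (k a - deriv k a * a))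
    linarith
  have hne : ∃ᶠ z in 𝓝 a, k z ≠ k a := by
    have h := ((hk.differentiableAt (isOpen_ball.mem_nhds (mem_ball_self hr))).hasDerivAt).eventually_ne
      (c := k a) h0
    exact h.frequently.filter_mono nhdsWithin_le_nhds
  have h8 := hdc.ball_subset_image_closedBall hρ0 h4 hne
  have h9 : N * ρ / 2 / 2 = N * r / 32 := by rw [hρ]; ring
  rw [h9] at h8
  exact h8.trans (image_mono hsub)

/-- Zero-free injective holomorphic functions have bounded logarithmic derivative. -/
theorem norm_deriv_mul_le_of_injOn {f : ℂ → ℂ} {z₀ : ℂ} {R : ℝ} (hR : 0 < R)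
    (hf : DifferentiableOn ℂ f (ball z₀ R)) (hi : InjOn f (ball z₀ R))
    (h0 : ∀ z ∈ ball z₀ R, f z ≠ 0) : ‖deriv f z₀‖ * R ≤ 448 * ‖f z₀‖ := by
  obtain ⟨k, hkc, e⟩ := HasLogOn.of_convex (convex_ball z₀ R) isOpen_ball hf.continuousOn h0
  have hkd : ∀ z ∈ ball z₀ R, HasDerivAt k (deriv f z / f z) z := fun z hz =>
    hasDerivAt_log_of_exp_eq isOpen_ball hkc e hz
      (hf.differentiableAt (isOpen_ball.mem_nhds hz)).hasDerivAt
  have hk : DifferentiableOn ℂ k (ball z₀ R) := fun z hz =>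
    (hkd z hz).differentiableAt.differentiableWithinAt
  have hdk : ContinuousOn (deriv k) (ball z₀ R) := (hk.deriv isOpen_ball).continuousOn
  have hmain : ∀ ρ, 0 < ρ → ρ < R → ρ * ‖deriv k z₀‖ ≤ 448 := by
    intro ρ hρ hρR
    have hsub : closedBall z₀ ρ ⊆ ball z₀ R := closedBall_subset_ball hρR
    -- Landau's device: maximizing the derivative weighted by the distance to the boundary yields a
    -- point `a` around which `‖k'‖ ≤ 2 ‖k' a‖` on a disc of half the remaining radius.
    obtain ⟨a, ha, hmax⟩ := (isCompact_closedBall z₀ ρ).exists_isMaxOn ⟨z₀, mem_closedBall_self hρ.le⟩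
      (f := fun z => (ρ - dist z z₀) * ‖deriv k z‖)
      (ContinuousOn.mul (by fun_prop) (hdk.mono hsub).norm)
    have hmax' : ∀ z ∈ closedBall z₀ ρ, (ρ - dist z z₀) * ‖deriv k z‖ ≤
      (ρ - dist a z₀) * ‖deriv k a‖ := fun z hz => hmax hz
    have h1 := hmax' z₀ (mem_closedBall_self hρ.le)
    rw [dist_self, sub_zero] at h1
    refine h1.trans ?_
    rcases eq_or_lt_of_le (mem_closedBall.1 ha) with hb | hb
    · rw [hb]; simp
    set r := (ρ - dist a z₀) / 2 with hr
    have hr0 : 0 < r := by rw [hr]; linarith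
    have hball : ball a r ⊆ closedBall z₀ ρ := by
      intro z hz
      rw [mem_closedBall]
      have := dist_triangle z a z₀
      have := mem_ball.1 hz
      linarith
    have hcov := closedBall_subset_image hr0 (hk.mono (hball.trans hsub)) (by
      intro z hz
      have h2 := hmax' z (hball hz)
      have h3 : r ≤ ρ - dist z z₀ := by
        have := dist_triangle z a z₀
        have := mem_ball.1 hz
        linarith
      have h4 : r * ‖deriv k z‖ ≤ r * (2 * ‖deriv k a‖) := by
        calc _ ≤ (ρ - dist z z₀) * ‖deriv k z‖ := by gcongr
          _ ≤ (ρ - dist a z₀) * ‖deriv k a‖ := h2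
          _ = _ := by rw [hr]; ring
      exact le_of_mul_le_mul_left h4 hr0)
    by_contra hcon
    rw [not_le] at hcon
    -- The constant is `448 = 2 · 32 · 7`, with `7 > 2π`: the logarithm `k` would take the value `k
    -- a + 2πi`, so `f = exp k` would not be injective.
    have hbig : 7 < ‖deriv k a‖ * r / 32 := by
      have : ρ - dist a z₀ = 2 * r := by rw [hr]; ring
      rw [this] at hcon
      linarith
    have hmem : k a + 2 * Real.pi * I ∈ ball (k a) (‖deriv k a‖ * r / 32) := by
      rw [mem_ball, dist_eq_norm]
      have : k a + 2 * Real.pi * I - k a = ((2 * Real.pi : ℝ) : ℂ) * I := by push_cast; ring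
      rw [this, norm_mul, norm_I, mul_one, norm_real, Real.norm_of_nonneg (by positivity)]
      have := Real.pi_lt_d2
      linarith
    obtain ⟨b, hb, hkb⟩ := hcov hmem
    have haR := hsub (hball (mem_ball_self hr0))
    have hbR := hsub (hball hb)
    have hfab : f b = f a := by
      rw [← e b hbR, ← e a haR, hkb, exp_add, exp_two_pi_mul_I, mul_one]
    rw [hi hbR haR hfab] at hkb
    have : (2 * Real.pi : ℂ) * I = 0 := by linear_combination -hkb
    simp [Real.pi_ne_zero] at this
  have hz0 := mem_ball_self (x := z₀) hR
  have hle : R * ‖deriv k z₀‖ ≤ 448 := by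
    refine le_of_tendsto (f := fun ρ => ρ * ‖deriv k z₀‖) (x := 𝓝[<] R) (Tendsto.mono_left
      (Continuous.tendsto (by fun_prop) R) nhdsWithin_le_nhds) ?_
    filter_upwards [Ioo_mem_nhdsLT hR] with ρ hρ using hmain ρ hρ.1 hρ.2
  rw [(hkd z₀ hz0).deriv, norm_div] at hle
  have hf0 : 0 < ‖f z₀‖ := norm_pos_iff.2 (h0 z₀ hz0)
  field_simp at hle
  linarith

/-- A Harnack inequality for zero-free injective holomorphic functions. -/
theorem norm_le_of_injOn_ball {f : ℂ → ℂ} {z₀ : ℂ} {R : ℝ} (hR : 0 < R)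
    (hf : DifferentiableOn ℂ f (ball z₀ R)) (hi : InjOn f (ball z₀ R))
    (h0 : ∀ z ∈ ball z₀ R, f z ≠ 0) {z : ℂ} (hz : z ∈ ball z₀ (R / 2)) :
    ‖f z‖ ≤ Real.exp 448 * ‖f z₀‖ ∧ ‖f z₀‖ ≤ Real.exp 448 * ‖f z‖ := by
  obtain ⟨k, hkc, e⟩ := HasLogOn.of_convex (convex_ball z₀ R) isOpen_ball hf.continuousOn h0
  have hkd : ∀ z ∈ ball z₀ R, HasDerivAt k (deriv f z / f z) z := fun z hz =>
    hasDerivAt_log_of_exp_eq isOpen_ball hkc e hz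
      (hf.differentiableAt (isOpen_ball.mem_nhds hz)).hasDerivAt
  have hsub : ball z₀ (R / 2) ⊆ ball z₀ R := ball_subset_ball (by linarith)
  -- The derivative bound is used on discs of radius `R/2`; integrating over a segment of length at
  -- most `R/2` changes `k` by at most `448`.
  have hb : ∀ w ∈ ball z₀ (R / 2), ‖deriv f w / f w‖ ≤ 896 / R := by
    intro w hw
    have hw' : ball w (R / 2) ⊆ ball z₀ R := by
      refine ball_subset_ball' ?_
      have := mem_ball.1 hw
      linarith
    have := norm_deriv_mul_le_of_injOn (by positivity) (hf.mono hw') (hi.mono hw')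
      (fun z hz => h0 z (hw' hz))
    have hfw : 0 < ‖f w‖ := norm_pos_iff.2 (h0 w (hsub hw))
    rw [norm_div, div_le_div_iff₀ hfw hR]
    linarith
  have hd := (convex_ball z₀ (R / 2)).norm_image_sub_le_of_norm_hasDerivWithin_le
    (fun w hw => (hkd w (hsub hw)).hasDerivWithinAt) hb (mem_ball_self (by positivity)) hz
  have hd' : ‖k z - k z₀‖ ≤ 448 := by
    refine hd.trans ?_
    rw [← dist_eq_norm z z₀]
    calc 896 / R * dist z z₀ ≤ 896 / R * (R / 2) := by gcongr; exact (mem_ball.1 hz).le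
      _ = 448 := by field_simp; norm_num
  have hre : |(k z - k z₀).re| ≤ 448 := (abs_re_le_norm _).trans hd'
  rw [abs_le, sub_re] at hre
  rw [← e z (hsub hz), ← e z₀ (mem_ball_self hR), norm_exp, norm_exp, ← Real.exp_add,
    ← Real.exp_add, Real.exp_le_exp, Real.exp_le_exp]
  constructor <;> linarith

/-- Being comparable with the value at `z₀`, uniformly over all admissible `f`, is locally constant
in the point by the local inequality, so it spreads over a connected domain. The independence of `C`
and `r` from `f` is what provides normality later. -/
theorem exists_harnack_constant {U : Set ℂ} (hU : IsOpen U) (hUc : IsPreconnected U) {z₀ z : ℂ}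
    (hz₀ : z₀ ∈ U) (hz : z ∈ U) : ∃ r > 0, ∃ C > 0, ∀ f : ℂ → ℂ, DifferentiableOn ℂ f U → InjOn f U →
      (∀ w ∈ U, f w ≠ 0) → ∀ w ∈ ball z r, ‖f w‖ ≤ C * ‖f z₀‖ ∧ ‖f z₀‖ ≤ C * ‖f w‖ := by
  have hloc : ∀ x ∈ U, ∃ r > 0, ball x r ⊆ U ∧ ∀ f : ℂ → ℂ, DifferentiableOn ℂ f U → InjOn f U →
      (∀ w ∈ U, f w ≠ 0) → ∀ w ∈ ball x r, ‖f w‖ ≤ Real.exp 448 * ‖f x‖ ∧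
        ‖f x‖ ≤ Real.exp 448 * ‖f w‖ := by
    intro x hx
    obtain ⟨R, hR, hRU⟩ := Metric.isOpen_iff.1 hU x hx
    exact ⟨R / 2, by positivity, (ball_subset_ball (by linarith)).trans hRU,
      fun f hf hi h0 w hw => norm_le_of_injOn_ball hR (hf.mono hRU) (hi.mono hRU)
        (fun z hz => h0 z (hRU hz)) hw⟩
  have hP : ∃ C > 0, ∀ f : ℂ → ℂ, DifferentiableOn ℂ f U → InjOn f U →
      (∀ w ∈ U, f w ≠ 0) → ‖f z‖ ≤ C * ‖f z₀‖ ∧ ‖f z₀‖ ≤ C * ‖f z‖ := by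
    have := eq_of_locally_eq (f := fun x => (∃ C > 0, ∀ f : ℂ → ℂ, DifferentiableOn ℂ f U →
      InjOn f U → (∀ w ∈ U, f w ≠ 0) → ‖f x‖ ≤ C * ‖f z₀‖ ∧ ‖f z₀‖ ≤ C * ‖f x‖ : Prop)) hUc ?_ hz₀ hz
    · rw [← this]
      exact ⟨1, one_pos, fun f _ _ _ => by simp⟩
    intro x hx
    obtain ⟨r, hr, -, h⟩ := hloc x hx
    filter_upwards [mem_nhdsWithin_of_mem_nhds (ball_mem_nhds x hr)] with y hy
    apply propext
    constructor
    all_goals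
      rintro ⟨C, hC, hCf⟩
      refine ⟨Real.exp 448 * C, by positivity, fun f hf hi h0 => ?_⟩
      obtain ⟨h1, h2⟩ := hCf f hf hi h0
      obtain ⟨h3, h4⟩ := h f hf hi h0 y hy
      constructor
    · calc _ ≤ _ := h4
        _ ≤ Real.exp 448 * (C * ‖f z₀‖) := by gcongr
        _ = _ := by ring
    · calc _ ≤ _ := h2
        _ ≤ C * (Real.exp 448 * ‖f x‖) := by gcongr
        _ = _ := by ring
    · calc _ ≤ _ := h3
        _ ≤ Real.exp 448 * (C * ‖f z₀‖) := by gcongr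
        _ = _ := by ring
    · calc _ ≤ _ := h2
        _ ≤ C * (Real.exp 448 * ‖f y‖) := by gcongr
        _ = _ := by ring
  obtain ⟨C, hC, hCf⟩ := hP
  obtain ⟨r, hr, -, h⟩ := hloc z hz
  refine ⟨r, hr, Real.exp 448 * C, by positivity, fun f hf hi h0 w hw => ?_⟩
  obtain ⟨h1, h2⟩ := hCf f hf hi h0
  obtain ⟨h3, h4⟩ := h f hf hi h0 w hw
  constructor
  · calc _ ≤ _ := h3
      _ ≤ Real.exp 448 * (C * ‖f z₀‖) := by gcongr
      _ = _ := by ring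
  · calc _ ≤ _ := h2
      _ ≤ C * (Real.exp 448 * ‖f w‖) := by gcongr
      _ = _ := by ring

/-! ### Biholomorphic maps and invariance of `NoCompactPiece` -/

/-- `f` and `g` are mutually inverse holomorphic maps between `U` and `V`. -/
structure IsBiholo (f g : ℂ → ℂ) (U V : Set ℂ) : Prop where
  diff : DifferentiableOn ℂ f U
  diff_inv : DifferentiableOn ℂ g V
  mapsTo : MapsTo f U V
  mapsTo_inv : MapsTo g V U
  left_inv : ∀ z ∈ U, g (f z) = z
  right_inv : ∀ w ∈ V, f (g w) = w

namespace IsBiholo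

variable {f g f' g' : ℂ → ℂ} {U V W : Set ℂ}

theorem symm (h : IsBiholo f g U V) : IsBiholo g f V U :=
  ⟨h.diff_inv, h.diff, h.mapsTo_inv, h.mapsTo, h.right_inv, h.left_inv⟩

theorem trans (h : IsBiholo f g U V) (h' : IsBiholo f' g' V W) :
    IsBiholo (f' ∘ f) (g ∘ g') U W where
  diff := h'.diff.comp h.diff h.mapsTo
  diff_inv := h.diff_inv.comp h'.diff_inv h'.mapsTo_inv
  mapsTo := h'.mapsTo.comp h.mapsTo
  mapsTo_inv := h.mapsTo_inv.comp h'.mapsTo_inv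
  left_inv z hz := by simp [h'.left_inv _ (h.mapsTo hz), h.left_inv z hz]
  right_inv z hz := by simp [h.right_inv _ (h'.mapsTo_inv hz), h'.right_inv z hz]

theorem injOn (h : IsBiholo f g U V) : InjOn f U := fun x hx y hy e => by
  rw [← h.left_inv x hx, ← h.left_inv y hy, e]

theorem of_injOn (hU : IsOpen U) (hf : DifferentiableOn ℂ f U) (hi : InjOn f U) :
    IsBiholo f (Function.invFunOn f U) U (f '' U) where
  diff := hf
  diff_inv := differentiableOn_inverse hU hf fun _ hz => hi.leftInvOn_invFunOn hz
  mapsTo := mapsTo_image f U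
  mapsTo_inv := fun _ hw => Function.invFunOn_mem hw
  left_inv := fun _ hz => hi.leftInvOn_invFunOn hz
  right_inv := fun _ hw => Function.invFunOn_eq hw

end IsBiholo

theorem deriv_ne_zero_of_injOn {f : ℂ → ℂ} {U : Set ℂ} (hU : IsOpen U)
    (hf : DifferentiableOn ℂ f U) (hi : InjOn f U) {z : ℂ} (hz : z ∈ U) : deriv f z ≠ 0 := by
  have h := IsBiholo.of_injOn hU hf hi
  intro h0
  have h1 := (hf.differentiableAt (hU.mem_nhds hz)).hasDerivAt
  have h2 := (h.diff_inv.differentiableAt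
    ((isOpen_image_of_injOn hU hf hi hU subset_rfl).mem_nhds (mem_image_of_mem f hz))).hasDerivAt
  have h3 := h2.comp z h1
  rw [h0, mul_zero] at h3
  have h4 : HasDerivAt (Function.invFunOn f U ∘ f) 1 z := by
    refine (hasDerivAt_id z).congr_of_eventuallyEq ?_
    filter_upwards [hU.mem_nhds hz] with w hw using h.left_inv w hw
  exact zero_ne_one (h3.unique h4)

theorem NoCompactPiece.image_homeomorph {C : Set ℂ} (h : NoCompactPiece C) (e : ℂ ≃ₜ ℂ) :
    NoCompactPiece (e '' C) := by
  intro Q O hQ hO hCO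
  have := h (e ⁻¹' Q) (e ⁻¹' O) (e.isCompact_preimage.2 hQ) (hO.preimage e.continuous) (by
    rw [← hCO, preimage_inter, preimage_image_eq _ e.injective])
  rw [← image_preimage_eq Q e.surjective, this, image_empty]

/-- Connectedness of the complement in the sphere is preserved by Möbius maps. In the plane, the
convention `0⁻¹ = 0` makes `f` a bijection with `f x₀ = 0`, while `0` is really the image of
infinity. A compact piece `Q` avoiding `0` is pulled back directly; one containing `0` corresponds
to a neighbourhood of infinity, and its complementary piece is used instead. -/
theorem NoCompactPiece.image_inv_sub {U : Set ℂ} (hU : IsOpen U) (h : NoCompactPiece Uᶜ) {x₀ : ℂ}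
    (hx₀ : x₀ ∉ U) : NoCompactPiece ((fun z => (z - x₀)⁻¹) '' U)ᶜ := by
  set f : ℂ → ℂ := fun z => (z - x₀)⁻¹ with hf
  have hfg : ∀ y, f (x₀ + y⁻¹) = y := fun y => by simp [hf]
  have hgf : ∀ z, x₀ + (f z)⁻¹ = z := fun z => by simp [hf]
  have hfi : Function.Injective f :=
    Function.LeftInverse.injective (g := fun y => x₀ + y⁻¹) hgf
  have hf0 : ∀ z, f z = 0 ↔ z = x₀ := fun z => by simp [hf, sub_eq_zero]
  have hmem : ∀ z, f z ∈ f '' U ↔ z ∈ U := fun z => hfi.mem_set_image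
  have hcont : ContinuousOn f {x₀}ᶜ := by
    refine ContinuousOn.inv₀ (by fun_prop) fun z hz => sub_ne_zero.2 hz
  intro Q O hQ hO hQO
  have hOo : IsOpen ({x₀}ᶜ ∩ f ⁻¹' O) := hcont.isOpen_inter_preimage isOpen_compl_singleton hO
  by_cases h0 : (0 : ℂ) ∈ Q
  · exfalso
    have h0O : (0 : ℂ) ∈ O := by rw [← hQO] at h0; exact h0.2
    obtain ⟨ε, hε, hball⟩ := Metric.isOpen_iff.1 hO 0 h0O
    obtain ⟨M, hM⟩ := hQ.isBounded.subset_closedBall 0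
    -- The part of `Uᶜ` left over by `Q`: bounded because `O` is a neighbourhood of `0`, relatively
    -- open because `Q` is compact, and nonempty because it contains `x₀`.
    set Q' := Uᶜ ∩ ({x₀}ᶜ ∩ f ⁻¹' O)ᶜ with hQ'
    have hQ'c : IsCompact Q' := by
      refine (isCompact_closedBall x₀ ε⁻¹).of_isClosed_subset
        (hU.isClosed_compl.inter hOo.isClosed_compl) ?_
      rintro z ⟨-, hz⟩
      rw [mem_closedBall]
      by_contra hcon
      rw [not_le, dist_eq_norm] at hcon
      have hpos : 0 < ‖z - x₀‖ := (by positivity : 0 < ε⁻¹).trans hcon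
      refine hz ⟨fun h => ?_, hball ?_⟩
      · rw [h, sub_self, norm_zero] at hpos; exact hpos.false
      · rw [mem_ball_zero_iff, hf, norm_inv]
        exact inv_lt_of_inv_lt₀ hε hcon
    have hO2 : IsOpen ({x₀} ∪ ({x₀}ᶜ ∩ f ⁻¹' Qᶜ)) := by
      have h1 : IsOpen ({x₀}ᶜ ∩ f ⁻¹' Qᶜ) :=
        hcont.isOpen_inter_preimage isOpen_compl_singleton hQ.isClosed.isOpen_compl
      rw [isOpen_iff_mem_nhds]
      rintro z (hz | hz)
      · rw [mem_singleton_iff.1 hz]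
        have hM1 : 0 < (|M| + 1)⁻¹ := by positivity
        refine mem_of_superset (ball_mem_nhds x₀ hM1) fun w hw => ?_
        by_cases hwx : w = x₀
        · exact Or.inl hwx
        · refine Or.inr ⟨hwx, fun hwQ => ?_⟩
          have h2 : ‖f w‖ ≤ M := by simpa using hM hwQ
          rw [mem_ball, dist_eq_norm] at hw
          have h3 : 0 < ‖w - x₀‖ := norm_pos_iff.2 (sub_ne_zero.2 hwx)
          rw [hf, norm_inv] at h2
          have h4 := (lt_inv_comm₀ h3 (by positivity)).1 hw
          have := le_abs_self M
          linarith
      · exact mem_of_superset (h1.mem_nhds hz) subset_union_right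
    have := h Q' _ hQ'c hO2 (by
      ext z
      constructor
      · rintro ⟨hzU, hz⟩
        refine ⟨hzU, ?_⟩
        rintro ⟨hzx, hzO⟩
        rcases hz with hz | hz
        · exact hzx hz
        · apply hz.2
          rw [← hQO]
          exact ⟨fun hh => hzU ((hmem z).1 hh), hzO⟩
      · rintro ⟨hzU, hz⟩
        refine ⟨hzU, ?_⟩
        by_cases hzx : z = x₀
        · exact Or.inl hzx
        · refine Or.inr ⟨hzx, fun hzQ => hz ⟨hzx, ?_⟩⟩
          rw [← hQO] at hzQ
          exact hzQ.2)
    have hx : x₀ ∈ Q' := ⟨hx₀, fun hh => hh.1 rfl⟩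
    rw [this] at hx
    exact hx
  · have hgc : ContinuousOn (fun y : ℂ => x₀ + y⁻¹) Q :=
      continuousOn_const.add (continuousOn_id.inv₀ fun y hy h => h0 (h ▸ hy))
    have := h ((fun y => x₀ + y⁻¹) '' Q) _ (hQ.image_of_continuousOn hgc) hOo (by
      ext z
      constructor
      · rintro ⟨hzU, hzx, hzO⟩
        exact ⟨f z, by rw [← hQO]; exact ⟨fun hh => hzU ((hmem z).1 hh), hzO⟩, hgf z⟩
      · rintro ⟨y, hy, rfl⟩
        have hy0 : y ≠ 0 := fun h => h0 (h ▸ hy)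
        have hy' := hy
        rw [← hQO] at hy'
        refine ⟨fun hyU => hy'.1 ?_, ?_, ?_⟩
        · rw [← hfg y]; exact mem_image_of_mem f hyU
        · simp [hy0]
        · rw [mem_preimage, hfg]; exact hy'.2)
    exact image_eq_empty.1 this

theorem NoCompactPiece.image_mobius {U : Set ℂ} (hU : IsOpen U) (h : NoCompactPiece Uᶜ) {x₀ A B : ℂ}
    (hx₀ : x₀ ∉ U) (hB : B ≠ 0) : NoCompactPiece ((fun z => A + B * (z - x₀)⁻¹) '' U)ᶜ := by
  have h1 := (h.image_inv_sub hU hx₀).image_homeomorph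
    ((Homeomorph.mulLeft₀ B hB).trans (Homeomorph.addLeft A))
  rw [image_compl_eq (Homeomorph.bijective _), image_image] at h1
  exact h1

theorem eq_empty_of_isCompact_of_isOpen {Q : Set ℂ} (hc : IsCompact Q) (ho : IsOpen Q) : Q = ∅ := by
  rcases isClopen_iff.1 ⟨hc.isClosed, ho⟩ with h | h
  · exact h
  · rw [h] at hc
    exact absurd hc (noncompact_univ ℂ)

/-- The preimage of `U` under squaring splits into `s '' U` and its negative `N`. Squaring is open,
so the part of a compact piece `Q` outside `N` is carried to a compact piece of `Uᶜ` and must be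
empty. Then `Q` is relatively clopen in the connected open set `N`, and `Q = N` would be compact and
open in the plane. -/
theorem NoCompactPiece.image_sqrt {U : Set ℂ} (hUc : IsConnected U)
    (h : NoCompactPiece Uᶜ) (h0 : (0 : ℂ) ∉ U) {s : ℂ → ℂ} (hs : ContinuousOn s U)
    (hsq : ∀ z ∈ U, s z ^ 2 = z) (hSo : IsOpen (s '' U)) : NoCompactPiece (s '' U)ᶜ := by
  intro Q O hQ hO hQO
  set N : Set ℂ := Neg.neg '' (s '' U) with hN
  have hNo : IsOpen N := (Homeomorph.neg ℂ).isOpenMap _ hSo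
  have hNc : IsConnected N := (hUc.image s hs).image _ continuous_neg.continuousOn
  have hNS : ∀ x ∈ N, x ∉ s '' U := by
    rintro _ ⟨_, ⟨z, hz, rfl⟩, rfl⟩ ⟨w, hw, hwz⟩
    have h1 : w = z := by rw [← hsq w hw, ← hsq z hz, hwz, neg_sq]
    rw [h1] at hwz
    have h2 : s z = 0 := by linear_combination hwz / 2
    apply h0
    have := hsq z hz
    rw [h2] at this
    rw [← this] at hz
    simpa using hz
  have hpre : ∀ x, x ^ 2 ∈ U → x ∈ s '' U ∨ x ∈ N := by
    intro x hx
    rcases sq_eq_sq_iff_eq_or_eq_neg.1 (hsq _ hx) with h1 | h1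
    · exact Or.inl ⟨_, hx, h1⟩
    · exact Or.inr ⟨s (x ^ 2), mem_image_of_mem s hx, by rw [h1, neg_neg]⟩
  have h1 := h ((fun x => x ^ 2) '' (Q ∩ Nᶜ)) ((fun x => x ^ 2) '' O)
    ((hQ.inter_right hNo.isClosed_compl).image (by fun_prop))
    ((isOpenQuotientMap_pow 2).isOpenMap _ hO) (by
      ext y
      constructor
      · rintro ⟨hyU, x, hx, rfl⟩
        refine ⟨x, ⟨?_, ?_⟩, rfl⟩
        · rw [← hQO]
          refine ⟨?_, hx⟩
          rintro ⟨z, hz, rfl⟩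
          exact hyU (by simpa only [hsq z hz] using hz)
        · rintro ⟨_, ⟨z, hz, rfl⟩, rfl⟩
          exact hyU (by simpa only [neg_sq, hsq z hz] using hz)
      · rintro ⟨x, ⟨hxQ, hxN⟩, rfl⟩
        rw [← hQO] at hxQ
        exact ⟨fun hx => (hpre x hx).elim hxQ.1 hxN, x, hxQ.2, rfl⟩)
  have hQN : Q ⊆ N := by
    intro x hx
    by_contra hxN
    have : x ∈ Q ∩ Nᶜ := ⟨hx, hxN⟩
    rw [image_eq_empty.1 h1] at this
    exact this
  by_contra hne
  obtain ⟨x, hx⟩ := nonempty_iff_ne_empty.2 hne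
  have hNO : N ∩ O = N ∩ Q := by
    ext y
    constructor
    · rintro ⟨hy, hyO⟩
      exact ⟨hy, by rw [← hQO]; exact ⟨hNS y hy, hyO⟩⟩
    · rintro ⟨hy, hyQ⟩
      rw [← hQO] at hyQ
      exact ⟨hy, hyQ.2⟩
  have hsub := subset_of_relatively_clopen hNc.isPreconnected hO hQ.isClosed hNO
    ⟨x, by rw [hNO]; exact ⟨hQN hx, hx⟩⟩
  have hEq : Q = N := hQN.antisymm hsub
  exact hne (eq_empty_of_isCompact_of_isOpen hQ (hEq ▸ hNo))

/-- A square root branch on a domain with `NoCompactPiece` complement. -/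
theorem exists_sqrt {U : Set ℂ} (hU : IsOpen U) (hUc : IsConnected U) (h : NoCompactPiece Uᶜ)
    (h0 : (0 : ℂ) ∉ U) : ∃ s : ℂ → ℂ, DifferentiableOn ℂ s U ∧ (∀ z ∈ U, s z ^ 2 = z) ∧
      NoCompactPiece (s '' U)ᶜ := by
  obtain ⟨L, hL, e⟩ := HasLogOn.sub_of_noCompactPiece_compl hU hUc h h0
  have hLd : DifferentiableOn ℂ L U := fun z hz =>
    (hasDerivAt_log_of_exp_eq hU hL e hz ((hasDerivAt_id z).sub_const
      0)).differentiableAt.differentiableWithinAt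
  have hs : DifferentiableOn ℂ (fun z => exp (L z / 2)) U := (hLd.div_const 2).cexp
  have hsq : ∀ z ∈ U, exp (L z / 2) ^ 2 = z := by
    intro z hz
    rw [← exp_nat_mul]
    have := e z hz
    simp only [sub_zero] at this
    refine Eq.trans ?_ this
    congr 1
    push_cast; ring
  refine ⟨_, hs, hsq, h.image_sqrt hUc h0 hs.continuousOn hsq
    (isOpen_image_of_injOn hU hs (fun x hx y hy hxy => ?_) hU subset_rfl)⟩
  rw [← hsq x hx, ← hsq y hy]
  exact congrArg (· ^ 2) hxy

end AnnulusModulus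

namespace AnnulusModulus
open Set Metric Complex ComplexConjugate

/-! ### The Riemann mapping theorem -/

/-- The disc automorphism moving `a` to `0`. -/
noncomputable def discMobius (a z : ℂ) : ℂ := (z - a) / (1 - conj a * z)

theorem one_sub_conj_mul_ne_zero {a z : ℂ} (ha : ‖a‖ < 1) (hz : ‖z‖ ≤ 1) : 1 - conj a * z ≠ 0 := by
  intro h
  have h1 : conj a * z = 1 := by linear_combination -h
  have h2 : ‖a‖ * ‖z‖ = 1 := by rw [← norm_conj a, ← norm_mul, h1, norm_one]
  nlinarith [norm_nonneg a, norm_nonneg z]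

theorem norm_discMobius_lt_one {a z : ℂ} (ha : ‖a‖ < 1) (hz : ‖z‖ < 1) : ‖discMobius a z‖ < 1 := by
  have hne := one_sub_conj_mul_ne_zero ha hz.le
  rw [discMobius, norm_div, div_lt_one (norm_pos_iff.2 hne)]
  rw [← sq_lt_sq₀ (norm_nonneg _) (norm_nonneg _), ← normSq_eq_norm_sq, ← normSq_eq_norm_sq]
  have ha' : normSq a < 1 := by rw [normSq_eq_norm_sq]; nlinarith [norm_nonneg a]
  have hz' : normSq z < 1 := by rw [normSq_eq_norm_sq]; nlinarith [norm_nonneg z]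
  have key : normSq (1 - conj a * z) - normSq (z - a) = (1 - normSq a) * (1 - normSq z) := by
    simp [normSq_apply]; ring
  nlinarith [mul_pos (sub_pos.2 ha') (sub_pos.2 hz')]

theorem hasDerivAt_discMobius {a z : ℂ} (h : 1 - conj a * z ≠ 0) :
    HasDerivAt (discMobius a) ((1 - conj a * a) / (1 - conj a * z) ^ 2) z := by
  have h1 := ((hasDerivAt_id z).sub_const a).div
    (((hasDerivAt_id z).const_mul (conj a)).const_sub 1) h
  refine h1.congr_deriv ?_
  congr 1
  simp
  ring

theorem injOn_discMobius {a : ℂ} (ha : ‖a‖ < 1) : InjOn (discMobius a) (closedBall 0 1) := by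
  intro x hx y hy h
  have h1 := one_sub_conj_mul_ne_zero ha (by simpa using hx)
  have h2 := one_sub_conj_mul_ne_zero ha (by simpa using hy)
  rw [discMobius, discMobius, div_eq_div_iff h1 h2] at h
  have h3 : (1 - conj a * a) * (x - y) = 0 := by linear_combination h
  have h4 := one_sub_conj_mul_ne_zero ha ha.le
  simpa [h4, sub_eq_zero] using h3

/-- Injective holomorphic maps of `U` into the unit disc with `NoCompactPiece` complement. -/
structure IsDiscEmbedding (f : ℂ → ℂ) (U : Set ℂ) : Prop where
  diff : DifferentiableOn ℂ f U
  inj : InjOn f U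
  mapsTo : MapsTo f U (ball 0 1)
  ncp : NoCompactPiece (f '' U)ᶜ

namespace IsDiscEmbedding

variable {f : ℂ → ℂ} {U : Set ℂ}

theorem mobius_comp (hU : IsOpen U) (h : IsDiscEmbedding f U) {a : ℂ} (ha : ‖a‖ < 1) :
    IsDiscEmbedding (fun z => discMobius a (f z)) U where
  diff := fun z hz => by
    have hz1 : ‖f z‖ < 1 := by simpa using h.mapsTo hz
    exact ((hasDerivAt_discMobius
      (one_sub_conj_mul_ne_zero ha hz1.le)).differentiableAt.comp_differentiableWithinAt z (h.diff z hz))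
  inj := fun x hx y hy e => h.inj hx hy (injOn_discMobius ha
    (ball_subset_closedBall (h.mapsTo hx)) (ball_subset_closedBall (h.mapsTo hy)) e)
  mapsTo := fun z hz => by
    have hz1 : ‖f z‖ < 1 := by simpa using h.mapsTo hz
    simpa using norm_discMobius_lt_one ha hz1
  ncp := by
    rcases eq_or_ne a 0 with rfl | ha0
    · simpa [discMobius] using h.ncp
    have hca : conj a ≠ 0 := by simpa using ha0
    have hW : IsOpen (f '' U) := isOpen_image_of_injOn hU h.diff h.inj hU subset_rfl
    have hx₀ : (conj a)⁻¹ ∉ f '' U := by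
      rintro ⟨z, hz, hz'⟩
      have hz1 : ‖f z‖ < 1 := by simpa using h.mapsTo hz
      have := one_sub_conj_mul_ne_zero ha hz1.le
      rw [hz'] at this
      simp [hca] at this
    -- Partial fractions: `discMobius a w = -ā⁻¹ + ā⁻¹ (a - ā⁻¹) (w - ā⁻¹)⁻¹`, which has the shape
    -- required by `image_mobius`.
    have hB : (conj a)⁻¹ * (a - (conj a)⁻¹) ≠ 0 := by
      refine mul_ne_zero (inv_ne_zero hca) fun h0 => ?_
      have := one_sub_conj_mul_ne_zero ha ha.le
      rw [sub_eq_zero] at h0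
      nth_rw 2 [h0] at this
      simp [hca] at this
    have := h.ncp.image_mobius hW hx₀ hB (A := -(conj a)⁻¹)
    rw [image_image] at this
    convert this using 2
    refine image_congr fun z hz => ?_
    have hz1 : ‖f z‖ < 1 := by simpa using h.mapsTo hz
    have h1 := one_sub_conj_mul_ne_zero ha hz1.le
    have h2 : f z - (conj a)⁻¹ ≠ 0 := fun h0 => hx₀ ⟨z, hz, sub_eq_zero.1 h0⟩
    have h3 : f z - (conj a)⁻¹ = -(1 - conj a * f z) / conj a := by field_simp; ring
    have h5 : 1 - f z * conj a ≠ 0 := by rwa [mul_comm]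
    rw [discMobius, h3]
    field_simp
    ring

theorem sqrt_comp (hU : IsOpen U) (hUc : IsConnected U) (h : IsDiscEmbedding f U)
    (h0 : ∀ z ∈ U, f z ≠ 0) :
    ∃ k : ℂ → ℂ, IsDiscEmbedding k U ∧ ∀ z ∈ U, k z ^ 2 = f z := by
  have hW : IsOpen (f '' U) := isOpen_image_of_injOn hU h.diff h.inj hU subset_rfl
  obtain ⟨s, hs, hsq, hncp⟩ := exists_sqrt hW (hUc.image f h.diff.continuousOn) h.ncp
    (by rintro ⟨z, hz, e⟩; exact h0 z hz e)
  have hsq' : ∀ z ∈ U, s (f z) ^ 2 = f z := fun z hz => hsq _ (mem_image_of_mem f hz)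
  refine ⟨fun z => s (f z), ⟨hs.comp h.diff (mapsTo_image f U), ?_, ?_, ?_⟩, hsq'⟩
  · intro x hx y hy e
    refine h.inj hx hy ?_
    rw [← hsq' x hx, ← hsq' y hy]
    exact congrArg (· ^ 2) e
  · intro z hz
    have hz1 : ‖f z‖ < 1 := by simpa using h.mapsTo hz
    rw [← hsq' z hz, norm_pow] at hz1
    rw [mem_ball_zero_iff]
    by_contra hcon
    exact absurd hz1 (not_lt.2 (one_le_pow₀ (not_lt.1 hcon)))
  · rwa [image_image] at hncp

/-- Koebe's square root step. -/
theorem exists_koebe_step (hU : IsOpen U) (hUc : IsConnected U) {p : ℂ} (hp : p ∈ U)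
    (h : IsDiscEmbedding f U) (hfp : f p = 0) {a : ℂ} (ha : a ∉ f '' U) {r : ℝ} (hr : r < 1)
    (har : ‖a‖ ≤ r) : ∃ g : ℂ → ℂ, IsDiscEmbedding g U ∧ g p = 0 ∧
      ‖deriv f p‖ * ((1 + r) / (2 * √r)) ≤ ‖deriv g p‖ := by
  have ha1 : ‖a‖ < 1 := har.trans_lt hr
  have ha0 : a ≠ 0 := by rintro rfl; exact ha ⟨p, hp, hfp⟩
  have hapos : 0 < ‖a‖ := norm_pos_iff.2 ha0
  have hm := h.mobius_comp hU ha1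
  -- The omitted value `a` is moved to `0`, where a square root can be taken; a second automorphism
  -- then brings the base point back to `0`.
  obtain ⟨k, hk, hksq⟩ := hm.sqrt_comp hU hUc (by
    intro z hz h0
    have hz1 : ‖f z‖ < 1 := by simpa using h.mapsTo hz
    have h1 := one_sub_conj_mul_ne_zero ha1 hz1.le
    rw [discMobius, div_eq_zero_iff] at h0
    rcases h0 with h0 | h0
    · exact ha ⟨z, hz, sub_eq_zero.1 h0⟩
    · exact h1 h0)
  have hkp : k p ^ 2 = -a := by rw [hksq p hp, hfp]; simp [discMobius]
  have hkn : ‖k p‖ ^ 2 = ‖a‖ := by rw [← norm_pow, hkp, norm_neg]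
  have hk1 : ‖k p‖ < 1 := by simpa using hk.mapsTo hp
  have hk0 : 0 < ‖k p‖ := by
    by_contra hcon
    have h0 : ‖k p‖ = 0 := le_antisymm (not_lt.1 hcon) (norm_nonneg _)
    rw [h0] at hkn; norm_num at hkn; exact hapos.ne hkn
  refine ⟨_, hk.mobius_comp hU hk1, by simp [discMobius], ?_⟩
  have hUp := hU.mem_nhds hp
  have hfd := (h.diff.differentiableAt hUp).hasDerivAt
  have hkd := (hk.diff.differentiableAt hUp).hasDerivAt
  have hMd : HasDerivAt (fun z => discMobius a (f z)) ((1 - conj a * a) * deriv f p) p := by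
    have h1 := hasDerivAt_discMobius (a := a) (z := f p) (by rw [hfp]; simp)
    refine (h1.comp p hfd).congr_deriv ?_
    simp [hfp]
  have hk2 : HasDerivAt (fun z => discMobius a (f z)) (2 * k p * deriv k p) p := by
    have h1 := hkd.pow 2
    refine (h1.congr_deriv (by simp)).congr_of_eventuallyEq ?_
    filter_upwards [hUp] with z hz using (hksq z hz).symm
  have heq : 2 * k p * deriv k p = (1 - conj a * a) * deriv f p := hk2.unique hMd
  have hg : deriv (fun z => discMobius (k p) (k z)) p =
      (1 - conj (k p) * k p)⁻¹ * deriv k p := by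
    have hne := one_sub_conj_mul_ne_zero hk1 hk1.le
    have h1 := (hasDerivAt_discMobius (a := k p) (z := k p) hne).comp p hkd
    have h2 : (1 - conj (k p) * k p) / (1 - conj (k p) * k p) ^ 2 = (1 - conj (k p) * k p)⁻¹ := by
      field_simp
    rw [← h2]
    exact h1.deriv
  have hn : ∀ w : ℂ, ‖w‖ < 1 → ‖1 - conj w * w‖ = 1 - ‖w‖ ^ 2 := by
    intro w hw
    rw [mul_comm, mul_conj, normSq_eq_norm_sq, ← ofReal_one, ← ofReal_sub, norm_real,
      Real.norm_of_nonneg]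
    nlinarith [norm_nonneg w]
  have e1 : 2 * ‖k p‖ * ‖deriv k p‖ = (1 - ‖a‖ ^ 2) * ‖deriv f p‖ := by
    rw [← hn a ha1, ← norm_mul, ← heq, norm_mul, norm_mul]; simp
  rw [hg, norm_mul, norm_inv, hn _ hk1, hkn]
  set t := ‖k p‖ with ht
  set D := ‖deriv f p‖
  have hD : 0 ≤ D := norm_nonneg _
  have hr0 : 0 < r := hapos.trans_le har
  have hsr : √r ^ 2 = r := Real.sq_sqrt hr0.le
  have hsr0 : 0 < √r := Real.sqrt_pos.2 hr0
  have hsr1 : √r < 1 := by nlinarith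
  have htr : t ≤ √r := Real.le_sqrt_of_sq_le (hkn.le.trans har)
  have e2 : ‖deriv k p‖ = (1 - ‖a‖ ^ 2) * D / (2 * t) := by field_simp; linarith
  -- With `t ^ 2 = ‖a‖` the gain is `(1 + t²) / (2t)`, a decreasing function of `t` on `(0, 1]`;
  -- since `t ≤ √r` it is at least the gain at `√r`.
  have e3 : (1 - ‖a‖)⁻¹ * ‖deriv k p‖ = D * ((1 + t ^ 2) / (2 * t)) := by
    have : 1 - ‖a‖ ≠ 0 := by linarith
    rw [e2, hkn]
    field_simp
    ring
  rw [e3]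
  refine mul_le_mul_of_nonneg_left ?_ hD
  rw [div_le_div_iff₀ (by positivity) (by positivity)]
  have h5 : 0 ≤ (√r - t) * (1 - t * √r) := by
    refine mul_nonneg (by linarith) ?_
    nlinarith
  nlinarith

theorem norm_deriv_le {p : ℂ} (h : IsDiscEmbedding f U) (hfp : f p = 0)
    {δ : ℝ} (hδ : 0 < δ) (hb : ball p δ ⊆ U) : ‖deriv f p‖ ≤ 1 / δ := by
  refine Complex.norm_deriv_le_div_of_mapsTo_ball (h.diff.mono hb) (fun z hz => ?_) hδ
  rw [hfp]
  exact ball_subset_closedBall (h.mapsTo (hb hz))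

end IsDiscEmbedding

theorem tendstoLocallyUniformlyOn_of_tendsto {ι : Type*} {l : Filter ι} {c : ι → ℂ} {c₀ : ℂ}
    (h : Tendsto c l (𝓝 c₀)) (U : Set ℂ) :
    TendstoLocallyUniformlyOn (fun i (_ : ℂ) => c i) (fun _ => c₀) l U := by
  rw [Metric.tendstoLocallyUniformlyOn_iff]
  intro ε hε z _
  refine ⟨univ, univ_mem, ?_⟩
  filter_upwards [Metric.tendsto_nhds.1 h ε hε] with i hi y _
  rwa [dist_comm]

/-- The Riemann mapping theorem for subdomains of the disc. -/
theorem exists_biholo_of_subset_ball {U : Set ℂ} (hU : IsOpen U) (hUc : IsConnected U)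
    (hp : NoCompactPiece Uᶜ) (hUb : U ⊆ ball 0 1) : ∃ f g, IsBiholo f g U (ball 0 1) := by
  obtain ⟨p, hpU⟩ := hUc.nonempty
  set S : Set ℝ := {x | ∃ f, IsDiscEmbedding f U ∧ f p = 0 ∧ x = ‖deriv f p‖} with hS
  have hid : IsDiscEmbedding (fun z => z) U := ⟨differentiableOn_id, injOn_id U, hUb, by simpa using hp⟩
  have hp1 : ‖p‖ < 1 := by simpa using hUb hpU
  obtain ⟨f₀, hf₀, hf₀p⟩ : ∃ f, IsDiscEmbedding f U ∧ f p = 0 :=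
    ⟨_, hid.mobius_comp hU hp1, by simp [discMobius]⟩
  obtain ⟨δ, hδ, hδU⟩ := Metric.isOpen_iff.1 hU p hpU
  have hSb : BddAbove S := ⟨1 / δ, by rintro _ ⟨f, hf, hfp, rfl⟩; exact hf.norm_deriv_le hfp hδ hδU⟩
  have hSne : S.Nonempty := ⟨_, f₀, hf₀, hf₀p, rfl⟩
  set M := sSup S with hM
  have hMpos : 0 < M := (norm_pos_iff.2 (deriv_ne_zero_of_injOn hU hf₀.diff hf₀.inj hpU)).trans_le
    (le_csSup hSb ⟨f₀, hf₀, hf₀p, rfl⟩)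
  have hseq : ∀ n : ℕ, ∃ f, IsDiscEmbedding f U ∧ f p = 0 ∧ M - 1 / (n + 1) < ‖deriv f p‖ := by
    intro n
    obtain ⟨_, ⟨f, hf, hfp, rfl⟩, hlt⟩ := exists_lt_of_lt_csSup hSne
      (show M - 1 / ((n : ℝ) + 1) < sSup S by
        have : (0 : ℝ) < 1 / (n + 1) := by positivity
        linarith)
    exact ⟨f, hf, hfp, hlt⟩
  choose F hF hFp hFd using hseq
  have hlim : Tendsto (fun n : ℕ => M - 1 / ((n : ℝ) + 1)) atTop (𝓝 M) := by
    simpa using (tendsto_const_nhds (x := M)).sub tendsto_one_div_add_atTop_nhds_zero_nat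
  -- Were a point of the disc of radius `r` omitted, the square root step would multiply the
  -- derivative by a fixed factor greater than `1` and exceed the supremum `M`.
  have hcover : ∀ r < 1, ∀ᶠ n in atTop, ball 0 r ⊆ F n '' U := by
    intro r hr
    rcases le_or_gt r 0 with hr0 | hr0
    · simp [ball_eq_empty.2 hr0]
    have hsr : √r ^ 2 = r := Real.sq_sqrt hr0.le
    have hsr0 : 0 < √r := Real.sqrt_pos.2 hr0
    have hc : 1 < (1 + r) / (2 * √r) := by
      rw [lt_div_iff₀ (by positivity)]
      have : √r ≠ 1 := fun h => by rw [h] at hsr; linarith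
      nlinarith [sq_pos_of_ne_zero (sub_ne_zero.2 this)]
    have h1 : M / ((1 + r) / (2 * √r)) < M := div_lt_self hMpos hc
    filter_upwards [hlim.eventually (lt_mem_nhds h1)] with n hn a ha
    by_contra hcon
    obtain ⟨g, hg, hgp, hgd⟩ := (hF n).exists_koebe_step hU hUc hpU (hFp n) hcon hr
      (by simpa using (mem_ball_zero_iff.1 ha).le)
    have h2 : ‖deriv g p‖ ≤ M := le_csSup hSb ⟨g, hg, hgp, rfl⟩
    have h3 := hn.trans (hFd n)
    rw [div_lt_iff₀ (by linarith)] at h3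
    linarith
  set 𝒰 : Ultrafilter ℕ := hyperfilter ℕ
  have h𝒰 : (𝒰 : Filter ℕ) ≤ atTop := Nat.hyperfilter_le_atTop
  have hball1 : ∀ n, ∀ z ∈ U, ‖F n z‖ ≤ 1 := fun n z hz =>
    (mem_ball_zero_iff.1 ((hF n).mapsTo hz)).le
  obtain ⟨f, hFf, hfd⟩ := exists_tendstoLocallyUniformlyOn 𝒰 hU (F := F) (by
    intro z hz
    obtain ⟨r, hr, hrU⟩ := Metric.isOpen_iff.1 hU z hz
    exact ⟨r, hr, 1, .of_forall fun n => ⟨(hF n).diff.mono hrU, fun w hw => hball1 n w (hrU hw)⟩⟩)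
  set G : ℕ → ℂ → ℂ := fun n => Function.invFunOn (F n) U with hG
  have hFG : ∀ n, IsBiholo (F n) (G n) U (F n '' U) := fun n =>
    IsBiholo.of_injOn hU (hF n).diff (hF n).inj
  -- The inverses are eventually defined on every smaller disc and bounded by `1`, so they converge
  -- too. The limits invert each other, which gives bijectivity without a separate argument for `f`.
  obtain ⟨g, hGg, hgd⟩ := exists_tendstoLocallyUniformlyOn 𝒰 (isOpen_ball : IsOpen (ball (0 : ℂ) 1))
      (F := G) (by
    intro z hz
    have hz1 : ‖z‖ < 1 := by simpa using hz
    refine ⟨(1 - ‖z‖) / 2, by linarith, 1, ?_⟩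
    filter_upwards [h𝒰 (hcover ((1 + ‖z‖) / 2) (by linarith))] with n hn
    have hsub : ball z ((1 - ‖z‖) / 2) ⊆ F n '' U :=
      (ball_subset_ball' (by rw [dist_zero_right]; linarith)).trans hn
    exact ⟨(hFG n).diff_inv.mono hsub, fun w hw =>
      (mem_ball_zero_iff.1 (hUb ((hFG n).mapsTo_inv (hsub hw)))).le⟩)
  have hfp : f p = 0 := by
    have := hFf.tendsto_at hpU
    simp only [hFp] at this
    exact tendsto_nhds_unique this tendsto_const_nhds
  have hfball : MapsTo f U (ball 0 1) := by
    have hle : ∀ z ∈ U, f z ∈ closedBall (0 : ℂ) 1 := fun z hz =>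
      isClosed_closedBall.mem_of_tendsto (hFf.tendsto_at hz)
        (.of_forall fun n => ball_subset_closedBall ((hF n).mapsTo hz))
    rcases (hfd.analyticOnNhd hU).is_constant_or_isOpen hUc.isPreconnected with ⟨w, hw⟩ | ho
    · intro z hz
      rw [hw z hz, ← hw p hpU, hfp]
      simp
    · intro z hz
      have h1 : f '' U ⊆ interior (closedBall 0 1) :=
        interior_maximal (by rintro _ ⟨x, hx, rfl⟩; exact hle x hx) (ho U subset_rfl hU)
      rw [interior_closedBall _ one_ne_zero] at h1
      exact h1 (mem_image_of_mem f hz)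
  have hgf : ∀ z ∈ U, g (f z) = z := by
    intro z hz
    have h1 := hGg.tendsto_comp (hgd.continuousOn _ (hfball hz)) (hfball hz)
      (tendsto_nhdsWithin_iff.2 ⟨hFf.tendsto_at hz, .of_forall fun n => (hF n).mapsTo hz⟩)
    have h2 : (fun n => G n (F n z)) = fun _ => z := funext fun n => (hFG n).left_inv z hz
    rw [h2] at h1
    exact tendsto_nhds_unique h1 tendsto_const_nhds
  have hgU : MapsTo g (ball 0 1) U := by
    intro w hw
    have hw1 : ‖w‖ < 1 := by simpa using hw
    by_contra hcon
    set r := (1 + ‖w‖) / 2 with hr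
    have hr1 : r < 1 := by rw [hr]; linarith
    have hsub : ball (0 : ℂ) r ⊆ ball 0 1 := ball_subset_ball hr1.le
    have hcov := h𝒰 (hcover r hr1)
    have h0r : (0 : ℂ) ∈ ball (0 : ℂ) r := mem_ball_self (by rw [hr]; positivity)
    -- Hurwitz: if `g w` were outside `U`, the functions `G n - g w` would be zero-free, and the
    -- limit does not vanish at `0` because `g 0 = p ∈ U`; so it could not vanish at `w`.
    refine ne_zero_of_tendstoLocallyUniformlyOn (F := fun n z => G n z - g w)
      (f := fun z => g z - g w) (l := 𝒰) isOpen_ball (convex_ball 0 r).isPreconnected ?_ ?_ ?_ h0r ?_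
      w (by rw [mem_ball_zero_iff, hr]; linarith) (sub_self _)
    · exact (hGg.mono hsub).sub
        (tendstoLocallyUniformlyOn_of_tendsto tendsto_const_nhds _)
    · filter_upwards [hcov] with n hn
      exact ((hFG n).diff_inv.mono hn).sub_const _
    · filter_upwards [hcov] with n hn z hz h0
      apply hcon
      rw [← sub_eq_zero.1 h0]
      exact (hFG n).mapsTo_inv (hn hz)
    · have : g 0 = p := by rw [← hfp]; exact hgf p hpU
      rw [this, sub_ne_zero]
      rintro rfl
      exact hcon hpU
  refine ⟨f, g, hfd, hgd, hfball, hgU, hgf, fun w hw => ?_⟩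
  have hw1 : ‖w‖ < 1 := by simpa using hw
  have hcov := h𝒰 (hcover ((1 + ‖w‖) / 2) (by linarith))
  have hwr : w ∈ ball (0 : ℂ) ((1 + ‖w‖) / 2) := by rw [mem_ball_zero_iff]; linarith
  have h1 := hFf.tendsto_comp (hfd.continuousOn _ (hgU hw)) (hgU hw)
    (tendsto_nhdsWithin_iff.2 ⟨hGg.tendsto_at hw, by
      filter_upwards [hcov] with n hn using (hFG n).mapsTo_inv (hn hwr)⟩)
  refine tendsto_nhds_unique (h1.congr' ?_) tendsto_const_nhds
  filter_upwards [hcov] with n hn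
  exact (hFG n).right_inv w (hn hwr)

/-- **The Riemann mapping theorem.** -/
theorem exists_biholo_ball {U : Set ℂ} (hU : IsOpen U) (hUc : IsConnected U)
    (hp : NoCompactPiece Uᶜ) (hne : U ≠ univ) : ∃ f g, IsBiholo f g U (ball 0 1) := by
  obtain ⟨a, ha⟩ := (ne_univ_iff_exists_notMem U).1 hne
  -- translate `a` to the origin
  set e : ℂ ≃ₜ ℂ := Homeomorph.subRight a
  set V := e '' U with hV
  have hVo : IsOpen V := e.isOpenMap U hU
  have hVc : IsConnected V := hUc.image _ e.continuous.continuousOn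
  have hVp : NoCompactPiece Vᶜ := by
    rw [hV, ← image_compl_eq e.bijective]
    exact hp.image_homeomorph e
  have hV0 : (0 : ℂ) ∉ V := by
    rintro ⟨z, hz, h⟩
    exact ha ((sub_eq_zero.1 h) ▸ hz)
  obtain ⟨s, hs, hsq, hsp⟩ := exists_sqrt hVo hVc hVp hV0
  have hsi : InjOn s V := fun x hx y hy h => by
    rw [← hsq x hx, ← hsq y hy]
    exact congrArg (· ^ 2) h
  have hSo : IsOpen (s '' V) := isOpen_image_of_injOn hVo hs hsi hVo subset_rfl
  obtain ⟨p, hpV⟩ := hVc.nonempty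
  obtain ⟨ε, hε, hball⟩ := Metric.isOpen_iff.1 hSo (s p) (mem_image_of_mem s hpV)
  -- The image of a square root branch is disjoint from its negative, so it misses a disc about `-s
  -- p`; inversion in that disc makes the domain bounded.
  have hfar : ∀ z ∈ V, ε ≤ ‖s z + s p‖ := by
    intro z hz
    by_contra hcon
    obtain ⟨w, hw, hwz⟩ := hball (show -s z ∈ ball (s p) ε by
      rw [mem_ball, dist_eq_norm]
      have : -s z - s p = -(s z + s p) := by ring
      rw [this, norm_neg]
      exact not_le.1 hcon)
    have h1 : w = z := by rw [← hsq w hw, ← hsq z hz, hwz, neg_sq]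
    rw [h1] at hwz
    have h2 : s z = 0 := by linear_combination hwz / 2
    have h3 := hsq z hz
    rw [h2] at h3
    exact hV0 (by rw [← h3] at hz; simpa using hz)
  have hne0 : ∀ z ∈ V, s z + s p ≠ 0 := fun z hz h0 => by
    have := hfar z hz
    rw [h0, norm_zero] at this
    linarith
  have hne1 : ∀ z ∈ U, s (e z) + s p ≠ 0 := fun z hz => hne0 _ (mem_image_of_mem e hz)
  have hcpx : ((ε / 2 : ℝ) : ℂ) ≠ 0 := by
    rw [ofReal_ne_zero]; positivity
  set h : ℂ → ℂ := fun z => (ε / 2 : ℝ) * (s (e z) + s p)⁻¹ with hh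
  have hmt : MapsTo h U (ball 0 1) := by
    intro z hz
    have h1 := hfar _ (mem_image_of_mem e hz)
    rw [mem_ball_zero_iff, hh, norm_mul, norm_inv, norm_real, Real.norm_of_nonneg (by positivity),
      ← div_eq_mul_inv, div_lt_one (hε.trans_le h1)]
    linarith
  have hed : DifferentiableOn ℂ e U := by
    change DifferentiableOn ℂ (fun z => z - a) U
    fun_prop
  have hd : DifferentiableOn ℂ h U :=
    (((hs.comp hed (mapsTo_image e U)).add_const _).inv hne1).const_mul _
  have hi : InjOn h U := by
    intro x hx y hy hxy
    have h1 := inv_injective (mul_left_cancel₀ hcpx hxy)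
    exact e.injective (hsi (mem_image_of_mem e hx) (mem_image_of_mem e hy) (add_right_cancel h1))
  have hncp : NoCompactPiece (h '' U)ᶜ := by
    have := hsp.image_mobius hSo (x₀ := -s p) (A := 0) (B := (ε / 2 : ℝ)) (by
      rintro ⟨z, hz, hzs⟩
      exact hne0 z hz (by rw [hzs]; ring)) hcpx
    rw [image_image, hV, image_image] at this
    convert this using 2
    refine image_congr fun z _ => ?_
    simp [hh]
  have hb := IsBiholo.of_injOn hU hd hi
  obtain ⟨f, g, hfg⟩ := exists_biholo_of_subset_ball (isOpen_image_of_injOn hU hd hi hU subset_rfl)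
    (hUc.image h hd.continuousOn) hncp hmt.image_subset
  exact ⟨_, _, hb.trans hfg⟩

end AnnulusModulus

namespace AnnulusModulus
open Set Metric Complex ComplexConjugate RiemannSphere

/-! ### Disc automorphisms without fixed points -/

theorem mem_roundAnnulus_ofReal {a b : ℝ} (ha : 0 ≤ a) {z : ℂ} :
    z ∈ roundAnnulus (ENNReal.ofReal a) (ENNReal.ofReal b) ↔ a < ‖z‖ ∧ ‖z‖ < b := by
  rw [roundAnnulus, mem_ofPred_eq, ← ofReal_norm, ENNReal.ofReal_lt_ofReal_iff_of_nonneg ha,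
    ENNReal.ofReal_lt_ofReal_iff_of_nonneg (norm_nonneg z)]

/-- Linearization of the automorphisms `w ↦ μ w + i t` of the right half plane. -/
theorem exists_biholo_halfPlane {μ t : ℝ} (hμ : 0 < μ) (h : μ = 1 → t ≠ 0) :
    ∃ r R : ℝ≥0∞, r < R ∧ ∃ f g, IsBiholo f g {w : ℂ | 0 < w.re} (exp ⁻¹' roundAnnulus r R) ∧
      ∀ w : ℂ, 0 < w.re → f (μ * w + t * I) = f w + 2 * Real.pi * I := by
  have hpi := Real.pi_pos
  by_cases hμ1 : μ = 1
  -- Parabolic case: the translation by `it` is rescaled to `2πi`. The sign of `t` decides between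
  -- the left and right half planes, which cover a punctured disc and the exterior of a disc.
  · have ht := h hμ1
    subst hμ1
    have htc : (t : ℂ) ≠ 0 := ofReal_ne_zero.2 ht
    have hpc : (Real.pi : ℂ) ≠ 0 := ofReal_ne_zero.2 hpi.ne'
    have hper : ∀ w : ℂ, ((2 * Real.pi / t : ℝ) : ℂ) * (((1 : ℝ) : ℂ) * w + t * I) =
        ((2 * Real.pi / t : ℝ) : ℂ) * w + 2 * Real.pi * I := by
      intro w; push_cast; field_simp
    have hre : ∀ (a : ℝ) (w : ℂ), ((a : ℂ) * w).re = a * w.re := fun a w => by simp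
    have hl : ∀ w : ℂ, ((t / (2 * Real.pi) : ℝ) : ℂ) * (((2 * Real.pi / t : ℝ) : ℂ) * w) = w := by
      intro w; push_cast; field_simp
    have hr : ∀ w : ℂ, ((2 * Real.pi / t : ℝ) : ℂ) * (((t / (2 * Real.pi) : ℝ) : ℂ) * w) = w := by
      intro w; push_cast; field_simp
    rcases lt_or_gt_of_ne ht with ht0 | ht0
    · have hmem : ∀ w : ℂ, w ∈ exp ⁻¹' roundAnnulus 0 1 ↔ w.re < 0 := by
        intro w
        rw [mem_preimage, ← ENNReal.ofReal_one, ← ENNReal.ofReal_zero,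
          mem_roundAnnulus_ofReal le_rfl, norm_exp, Real.exp_lt_one_iff]
        simp [Real.exp_pos]
      refine ⟨0, 1, zero_lt_one, fun w => ((2 * Real.pi / t : ℝ) : ℂ) * w,
        fun w => ((t / (2 * Real.pi) : ℝ) : ℂ) * w, ⟨by fun_prop, by fun_prop, ?_, ?_, fun w _ => hl w,
        fun w _ => hr w⟩, fun w _ => hper w⟩
      · intro w hw
        rw [hmem, hre]
        exact mul_neg_of_neg_of_pos (div_neg_of_pos_of_neg (by positivity) ht0) hw
      · intro w hw
        rw [hmem] at hw
        rw [mem_ofPred_eq, hre]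
        exact mul_pos_of_neg_of_neg (div_neg_of_neg_of_pos ht0 (by positivity)) hw
    · have hmem : ∀ w : ℂ, w ∈ exp ⁻¹' roundAnnulus 1 ⊤ ↔ 0 < w.re := by
        intro w
        rw [mem_preimage, roundAnnulus, mem_ofPred_eq, ← ofReal_norm, ← ENNReal.ofReal_one,
          ENNReal.ofReal_lt_ofReal_iff_of_nonneg zero_le_one, norm_exp, Real.one_lt_exp_iff]
        simp
      refine ⟨1, ⊤, ENNReal.one_lt_top, fun w => ((2 * Real.pi / t : ℝ) : ℂ) * w,
        fun w => ((t / (2 * Real.pi) : ℝ) : ℂ) * w, ⟨by fun_prop, by fun_prop, ?_, ?_, fun w _ => hl w,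
        fun w _ => hr w⟩, fun w _ => hper w⟩
      · intro w hw
        have hw' : 0 < w.re := hw
        rw [hmem, hre]
        positivity
      · intro w hw
        rw [hmem] at hw
        rw [mem_ofPred_eq, hre]
        positivity
  · have hlog : Real.log μ ≠ 0 := Real.log_ne_zero_of_pos_of_ne_one hμ hμ1
    have hlc : (Real.log μ : ℂ) ≠ 0 := ofReal_ne_zero.2 hlog
    have hpc : (Real.pi : ℂ) ≠ 0 := ofReal_ne_zero.2 hpi.ne'
    -- Hyperbolic case: `s i` is the finite boundary fixed point. Taking the logarithm about it
    -- turns dilation by `μ` into translation by `log μ`, and the factor `2πi / log μ` turns this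
    -- into translation by `2πi` of a vertical strip of half-width `b = π² / |log μ|`.
    set s : ℝ := t / (1 - μ) with hs
    have hst : μ * s + t = s := by
      have : 1 - μ ≠ 0 := sub_ne_zero.2 (Ne.symm hμ1)
      rw [hs]; field_simp; ring
    set b : ℝ := Real.pi ^ 2 / |Real.log μ| with hb
    have hb0 : 0 < b := by positivity
    have hmem : ∀ w : ℂ, w ∈ exp ⁻¹' roundAnnulus (ENNReal.ofReal (Real.exp (-b)))
        (ENNReal.ofReal (Real.exp b)) ↔ |w.re| < b := by
      intro w
      rw [mem_preimage, mem_roundAnnulus_ofReal (Real.exp_nonneg _), norm_exp,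
        Real.exp_lt_exp, Real.exp_lt_exp, abs_lt]
    set κ : ℝ := 2 * Real.pi / Real.log μ with hκ
    have hκ0 : κ ≠ 0 := by rw [hκ]; positivity
    have hκc : (κ : ℂ) ≠ 0 := ofReal_ne_zero.2 hκ0
    have hκb : |κ| * (Real.pi / 2) = b := by
      rw [hκ, hb, abs_div, abs_of_pos (by positivity : 0 < 2 * Real.pi)]
      field_simp
    have hre1 : ∀ w : ℂ, ((κ : ℂ) * I * w).re = -(κ * w.im) := fun w => by simp
    refine ⟨_, _, ENNReal.ofReal_lt_ofReal_iff (Real.exp_pos b) |>.2 (Real.exp_lt_exp.2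
        (by linarith : -b < b)),
      fun w => κ * I * log (w - s * I), fun w => exp (w / (κ * I)) + s * I,
      ⟨?_, by fun_prop, ?_, ?_, ?_, ?_⟩, ?_⟩
    · intro w hw
      have hw' : 0 < w.re := hw
      exact ((differentiableAt_id.sub_const _).clog (by
        left; simpa using hw')).const_mul _ |>.differentiableWithinAt
    · intro w hw
      have hw' : 0 < w.re := hw
      rw [hmem, hre1, abs_neg, abs_mul, ← hκb, log_im]
      refine mul_lt_mul_of_pos_left ?_ (abs_pos.2 hκ0)
      exact abs_arg_lt_pi_div_two_iff.2 (Or.inl (by simpa using hw'))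
    · intro w hw
      rw [hmem] at hw
      have him : (w / (κ * I)).im = -w.re / κ := by
        have : w / (κ * I) = -(w * I) * ((κ⁻¹ : ℝ) : ℂ) := by
          push_cast; field_simp; rw [I_sq]; ring
        rw [this, im_mul_ofReal]
        simp; field_simp
      have him' : |(w / (κ * I)).im| < Real.pi / 2 := by
        rw [him, abs_div, abs_neg, div_lt_iff₀ (abs_pos.2 hκ0)]
        linarith
      rw [abs_lt] at him'
      change 0 < (exp (w / (κ * I)) + s * I).re
      simp only [add_re, re_ofReal_mul, I_re, mul_zero, add_zero, exp_re]
      exact mul_pos (Real.exp_pos _) (Real.cos_pos_of_mem_Ioo ⟨him'.1, him'.2⟩)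
    · intro w hw
      have hw' : 0 < w.re := hw
      have hne : w - s * I ≠ 0 := by
        intro h0
        have := congrArg re h0
        simp at this
        linarith
      have : (κ : ℂ) * I * log (w - s * I) / (κ * I) = log (w - s * I) := by
        field_simp
      simp only [this, exp_log hne]
      ring
    · intro w hw
      rw [hmem] at hw
      have him : (w / (κ * I)).im = -w.re / κ := by
        have : w / (κ * I) = -(w * I) * ((κ⁻¹ : ℝ) : ℂ) := by
          push_cast; field_simp; rw [I_sq]; ring
        rw [this, im_mul_ofReal]
        simp; field_simp
      have him' : |(w / (κ * I)).im| < Real.pi / 2 := by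
        rw [him, abs_div, abs_neg, div_lt_iff₀ (abs_pos.2 hκ0)]
        linarith
      rw [abs_lt] at him'
      simp only [add_sub_cancel_right]
      rw [log_exp (by linarith) (by linarith)]
      field_simp
    · intro w hw
      have hne : w - s * I ≠ 0 := by
        intro h0
        have := congrArg re h0
        simp at this
        linarith
      have h1 : (μ : ℂ) * w + t * I - s * I = μ * (w - s * I) := by
        have : (s : ℂ) = μ * s + t := by exact_mod_cast hst.symm
        linear_combination -I * this
      simp only [h1]
      rw [log_ofReal_mul hμ hne, hκ]
      push_cast
      field_simp
      ring

theorem isBiholo_discMobius {a : ℂ} (ha : ‖a‖ < 1) :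
    IsBiholo (discMobius a) (discMobius (-a)) (ball 0 1) (ball 0 1) := by
  have hd : ∀ b : ℂ, ‖b‖ < 1 → DifferentiableOn ℂ (discMobius b) (ball 0 1) := fun b hb z hz =>
    (hasDerivAt_discMobius (one_sub_conj_mul_ne_zero hb
      (mem_ball_zero_iff.1 hz).le)).differentiableAt.differentiableWithinAt
  have hm : ∀ b : ℂ, ‖b‖ < 1 → MapsTo (discMobius b) (ball 0 1) (ball 0 1) := fun b hb z hz => by
    simpa using norm_discMobius_lt_one hb (mem_ball_zero_iff.1 hz)
  have hl : ∀ b : ℂ, ‖b‖ < 1 → ∀ z ∈ ball (0 : ℂ) 1, discMobius (-b) (discMobius b z) = z := by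
    intro b hb z hz
    have h1 := one_sub_conj_mul_ne_zero hb (mem_ball_zero_iff.1 hz).le
    have h2 := one_sub_conj_mul_ne_zero hb hb.le
    have h4 : 1 - conj (-b) * ((z - b) / (1 - conj b * z)) =
        (1 - conj b * b) / (1 - conj b * z) := by
      rw [map_neg, eq_div_iff h1, sub_mul, mul_assoc, div_mul_cancel₀ _ h1]; ring
    have h5 : (z - b) / (1 - conj b * z) - -b = z * (1 - conj b * b) / (1 - conj b * z) := by
      rw [eq_div_iff h1, sub_mul, div_mul_cancel₀ _ h1]; ring
    rw [discMobius, discMobius, h4, h5, div_div_div_cancel_right₀ h1, mul_div_cancel_right₀ _ h2]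
  have ha' : ‖-a‖ < 1 := by rwa [norm_neg]
  exact ⟨hd a ha, hd _ ha', hm a ha, hm _ ha', hl a ha, fun z hz => by
    have := hl (-a) ha' z hz
    rwa [neg_neg] at this⟩

/-- Automorphisms of the disc are Möbius transformations. -/
theorem exists_eq_mul_discMobius {T T' : ℂ → ℂ} (h : IsBiholo T T' (ball 0 1) (ball 0 1)) :
    ∃ l a : ℂ, ‖l‖ = 1 ∧ ‖a‖ < 1 ∧ ∀ z ∈ ball (0 : ℂ) 1, T z = l * discMobius a z := by
  have h0 : (0 : ℂ) ∈ ball (0 : ℂ) 1 := mem_ball_self one_pos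
  set a := T' 0 with ha
  have ha1 : ‖a‖ < 1 := by simpa using h.mapsTo_inv h0
  have hm := isBiholo_discMobius ha1
  have hS := hm.symm.trans h
  set S := T ∘ discMobius (-a) with hSdef
  set S' := discMobius a ∘ T' with hS'def
  have hS0 : S 0 = 0 := by
    have : discMobius (-a) 0 = a := by simp [discMobius]
    rw [hSdef, Function.comp_apply, this]
    exact h.right_inv 0 h0
  have hS'0 : S' 0 = 0 := by
    have := hS.left_inv 0 h0
    rwa [hS0] at this
  have hn : ∀ z ∈ ball (0 : ℂ) 1, ‖S z‖ = ‖z‖ := by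
    intro z hz
    refine le_antisymm ?_ ?_
    · exact norm_le_norm_of_mapsTo_ball hS.diff (hS.mapsTo.mono_right ball_subset_closedBall) hS0
        (mem_ball_zero_iff.1 hz)
    · have := norm_le_norm_of_mapsTo_ball hS.diff_inv
        (hS.mapsTo_inv.mono_right ball_subset_closedBall) hS'0 (mem_ball_zero_iff.1 (hS.mapsTo hz))
      rwa [hS.left_inv z hz] at this
  have hhalf : (1 / 2 : ℂ) ∈ ball (0 : ℂ) 1 := by rw [mem_ball_zero_iff]; norm_num
  obtain ⟨C, hC, hCe⟩ := affine_of_mapsTo_ball_of_exists_norm_dslope_eq_div' (E := ℂ) (f := S) (c := 0)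
    (R₁ := 1) (R₂ := 1) hS.diff (by
      rw [hS0]; exact hS.mapsTo.mono_right ball_subset_closedBall) ⟨1 / 2, hhalf, by
        rw [dslope_of_ne _ (by norm_num), slope_def_field, hS0, sub_zero, sub_zero, norm_div,
          hn _ hhalf]
        norm_num⟩
  refine ⟨C, a, by simpa using hC, ha1, fun z hz => ?_⟩
  have h1 := hCe (hm.mapsTo hz)
  simp only [hS0, sub_zero, zero_add, smul_eq_mul] at h1
  rw [mul_comm, ← h1, hSdef, Function.comp_apply, hm.left_inv z hz]

theorem isBiholo_cayley {p : ℂ} (hp : ‖p‖ = 1) :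
    IsBiholo (fun z => (p + z) / (p - z)) (fun w => p * (w - 1) / (w + 1)) (ball 0 1)
      {w : ℂ | 0 < w.re} := by
  have hp0 : p ≠ 0 := by rintro rfl; simp at hp
  have h1 : ∀ z ∈ ball (0 : ℂ) 1, p - z ≠ 0 := by
    intro z hz h
    rw [← sub_eq_zero.1 h, mem_ball_zero_iff, hp] at hz
    exact lt_irrefl _ hz
  have h2 : ∀ w ∈ {w : ℂ | 0 < w.re}, w + 1 ≠ 0 := by
    intro w hw h
    have hw' : 0 < w.re := hw
    have := congrArg re h
    simp at this
    linarith
  have hpn : p.re ^ 2 + p.im ^ 2 = 1 := by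
    have : normSq p = 1 := by rw [normSq_eq_norm_sq, hp, one_pow]
    rw [normSq_apply] at this; linarith
  refine ⟨?_, ?_, ?_, ?_, ?_, ?_⟩
  · exact DifferentiableOn.div (by fun_prop) (by fun_prop) h1
  · exact DifferentiableOn.div (by fun_prop) (by fun_prop) h2
  · intro z hz
    have h3 := h1 z hz
    have hz1 : z.re ^ 2 + z.im ^ 2 < 1 := by
      have h4 : ‖z‖ < 1 := mem_ball_zero_iff.1 hz
      have : normSq z < 1 := by rw [normSq_eq_norm_sq]; nlinarith [norm_nonneg z]
      rw [normSq_apply] at this; linarith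
    change 0 < ((p + z) / (p - z)).re
    rw [div_re]
    have h5 : 0 < normSq (p - z) := normSq_pos.2 h3
    rw [← add_div]
    refine div_pos ?_ h5
    simp
    nlinarith
  · intro w hw
    have hw' : 0 < w.re := hw
    rw [mem_ball_zero_iff, norm_div, norm_mul, hp, one_mul, div_lt_one (norm_pos_iff.2 (h2 w hw)),
      ← sq_lt_sq₀ (norm_nonneg _) (norm_nonneg _), ← normSq_eq_norm_sq, ← normSq_eq_norm_sq,
      normSq_apply, normSq_apply]
    simp
    nlinarith
  · intro z hz
    have h3 := h1 z hz
    have e1 : (p + z) / (p - z) - 1 = 2 * z / (p - z) := by field_simp; ring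
    have e2 : (p + z) / (p - z) + 1 = 2 * p / (p - z) := by field_simp; ring
    simp only [e1, e2]
    field_simp
  · intro w hw
    have h3 := h2 w hw
    have e1 : p + p * (w - 1) / (w + 1) = 2 * p * w / (w + 1) := by field_simp; ring
    have e2 : p - p * (w - 1) / (w + 1) = 2 * p / (w + 1) := by field_simp; ring
    simp only [e1, e2]
    field_simp

/-- A disc automorphism without fixed points is conjugate to the translation by `2πi` of a strip or
a half plane. -/
theorem exists_biholo_of_no_fixed_point {T T' : ℂ → ℂ} (h : IsBiholo T T' (ball 0 1) (ball 0 1))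
    (hfix : ∀ z ∈ ball (0 : ℂ) 1, T z ≠ z) :
    ∃ r R : ℝ≥0∞, r < R ∧ ∃ f g, IsBiholo f g (ball 0 1) (exp ⁻¹' roundAnnulus r R) ∧
      ∀ z ∈ ball (0 : ℂ) 1, f (T z) = f z + 2 * Real.pi * I := by
  obtain ⟨l, a, hl, ha, hT⟩ := exists_eq_mul_discMobius h
  have hT' : ∀ z ∈ ball (0 : ℂ) 1, T z * (1 - conj a * z) = l * (z - a) := by
    intro z hz
    have h1 := one_sub_conj_mul_ne_zero ha (mem_ball_zero_iff.1 hz).le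
    have h1' : 1 - z * conj a ≠ 0 := by rwa [mul_comm]
    rw [hT z hz, discMobius]
    field_simp
  have ha0 : a ≠ 0 := by
    rintro rfl
    apply hfix 0 (mem_ball_self one_pos)
    have := hT' 0 (mem_ball_self one_pos)
    simpa using this
  have hca : conj a ≠ 0 := by simpa using ha0
  have hll : l * conj l = 1 := by rw [mul_conj, normSq_eq_norm_sq, hl]; simp
  -- The roots of this quadratic in the open disc would be fixed points of `T`.
  have hroot_in : ∀ z : ℂ, conj a * z ^ 2 + (l - 1) * z - l * a = 0 → 1 ≤ ‖z‖ := by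
    intro z hz
    by_contra hcon
    have hzb : z ∈ ball (0 : ℂ) 1 := by simpa using hcon
    apply hfix z hzb
    have h1 := one_sub_conj_mul_ne_zero ha (mem_ball_zero_iff.1 hzb).le
    have h2 := hT' z hzb
    have h3 : (T z - z) * (1 - conj a * z) = 0 := by linear_combination h2 + hz
    simpa [h1, sub_eq_zero] using h3
  obtain ⟨p, hp⟩ : ∃ p : ℂ, conj a * p ^ 2 + (l - 1) * p - l * a = 0 := by
    obtain ⟨s, hs⟩ := IsAlgClosed.exists_eq_mul_self ((l - 1) ^ 2 + 4 * conj a * (l * a))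
    refine ⟨(-(l - 1) + s) / (2 * conj a), ?_⟩
    field_simp
    linear_combination -hs
  have hp1 := hroot_in p hp
  have hp0 : p ≠ 0 := by rintro rfl; rw [norm_zero] at hp1; linarith
  have hcp0 : conj p ≠ 0 := by simpa using hp0
  -- The root set is invariant under reflection in the circle, so `1 / conj p` is a root as well,
  -- which gives `‖p‖ ≤ 1`.
  have hpn : ‖p‖ = 1 := by
    refine le_antisymm ?_ hp1
    have h1 : conj a * ((conj p)⁻¹) ^ 2 + (l - 1) * (conj p)⁻¹ - l * a = 0 := by
      have h2 := congrArg conj hp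
      simp only [map_sub, map_add, map_mul, map_pow, conj_conj, map_one, map_zero] at h2
      field_simp
      linear_combination (-l) * h2 + (conj p - conj a) * hll
    have h3 := hroot_in _ h1
    rw [norm_inv, norm_conj] at h3
    exact (one_le_inv₀ (by positivity)).1 h3
  have hpp : p * conj p = 1 := by rw [mul_conj, normSq_eq_norm_sq, hpn]; simp
  have hpa : p - a ≠ 0 := by
    intro h0
    rw [sub_eq_zero.1 h0] at hpn
    linarith
  have haa : 1 - conj a * a ≠ 0 := one_sub_conj_mul_ne_zero ha ha.le
  have hleq : l * (p - a) = p * (1 - conj a * p) := by linear_combination hp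
  have hc := isBiholo_cayley hpn
  set c : ℂ → ℂ := fun z => (p + z) / (p - z) with hcdef
  set μ : ℝ := ‖p - a‖ ^ 2 / (1 - ‖a‖ ^ 2) with hμ
  have hden : 0 < 1 - ‖a‖ ^ 2 := by nlinarith [norm_nonneg a]
  have hμ0 : 0 < μ := by have := norm_pos_iff.2 hpa; positivity
  set t : ℝ := 2 * (conj a * p).im / (1 - ‖a‖ ^ 2) with ht
  have hdenc : ((1 - ‖a‖ ^ 2 : ℝ) : ℂ) = 1 - conj a * a := by
    rw [mul_comm (conj a), mul_conj, normSq_eq_norm_sq]; push_cast; rfl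
  have hμc : (μ : ℂ) = (p - a) * (conj p - conj a) / (1 - conj a * a) := by
    rw [hμ, ofReal_div, hdenc, ← map_sub, mul_conj, normSq_eq_norm_sq]
  have htc : (t : ℂ) * I = (conj a * p - a * conj p) / (1 - conj a * a) := by
    have h1 : conj a * p - a * conj p = ((2 * (conj a * p).im : ℝ) : ℂ) * I := by
      apply Complex.ext <;> simp <;> ring
    rw [h1, ht, ofReal_div, hdenc]
    ring
  -- The Cayley map sends the boundary fixed point `p` to infinity, so `T` becomes an affine
  -- automorphism of the right half plane.
  have hconj : ∀ z ∈ ball (0 : ℂ) 1, c (T z) = μ * c z + t * I := by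
    intro z hz
    have h1 : p - z ≠ 0 := by
      intro h0
      rw [← sub_eq_zero.1 h0, mem_ball_zero_iff, hpn] at hz
      exact lt_irrefl _ hz
    have h2 := one_sub_conj_mul_ne_zero ha (mem_ball_zero_iff.1 hz).le
    have h3 : p - T z ≠ 0 := by
      intro h0
      have := h.mapsTo hz
      rw [← sub_eq_zero.1 h0, mem_ball_zero_iff, hpn] at this
      exact lt_irrefl _ this
    have h4 := hT' z hz
    have e0 : (p - a) * (T z * (1 - conj a * z)) = p * (1 - conj a * p) * (z - a) := by
      rw [h4]; linear_combination (z - a) * hleq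
    have e1 : (p - T z) * ((p - a) * (1 - conj a * z)) = p * (1 - conj a * a) * (p - z) := by
      linear_combination -e0
    have e2 : (p + T z) * ((p - a) * (1 - conj a * z)) =
        p * ((1 - conj a * z) * (p - a) + (1 - conj a * p) * (z - a)) := by
      linear_combination e0
    have e3 : c (T z) = p * ((1 - conj a * z) * (p - a) + (1 - conj a * p) * (z - a)) /
        (p * (1 - conj a * a) * (p - z)) := by
      rw [← e1, ← e2, mul_div_mul_right _ _ (mul_ne_zero hpa h2)]
    have h5 : p * (1 - conj a * a) * (p - z) ≠ 0 := mul_ne_zero (mul_ne_zero hp0 haa) h1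
    rw [e3, hμc, htc, hcdef]
    rw [div_eq_iff h5]
    have e4 : ((p - a) * (conj p - conj a) / (1 - conj a * a) * ((p + z) / (p - z)) +
        (conj a * p - a * conj p) / (1 - conj a * a)) * (p * (1 - conj a * a) * (p - z)) =
        p * ((p - a) * (conj p - conj a) * (p + z) + (conj a * p - a * conj p) * (p - z)) := by
      have haa' : 1 - a * conj a ≠ 0 := by rwa [mul_comm]
      field_simp
    rw [e4]
    linear_combination (-(p * z - 2 * p * a + p ^ 2)) * hpp
  have hμt : μ = 1 → t ≠ 0 := by
    intro h1 h2
    have h0 := mem_ball_self (x := (0 : ℂ)) one_pos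
    have h3 := hconj 0 h0
    rw [h1, h2] at h3
    simp only [ofReal_one, one_mul, ofReal_zero, zero_mul, add_zero] at h3
    exact hfix 0 h0 (hc.injOn (h.mapsTo h0) h0 h3)
  obtain ⟨r, R, hrR, f, g, hfg, hper⟩ := exists_biholo_halfPlane hμ0 hμt
  refine ⟨r, R, hrR, _, _, hc.trans hfg, fun z hz => ?_⟩
  rw [Function.comp_apply, Function.comp_apply, ← hper _ (hc.mapsTo hz), ← hconj z hz]

end AnnulusModulus

namespace AnnulusModulus
open Set Metric Complex RiemannSphere

/-! ### Rings and their exponential covers -/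

/-- The plane domain `Ω` separates the compact connected set `K` from the closed set `L`, which is
connected once `∞` is added to it. -/
structure IsRing (Ω K L : Set ℂ) : Prop where
  isOpen : IsOpen Ω
  isConnected : IsConnected Ω
  isCompact : IsCompact K
  isConnected_inner : IsConnected K
  isClosed : IsClosed L
  noCompactPiece : NoCompactPiece L
  compl_eq : Ωᶜ = K ∪ L
  disjoint : Disjoint K L

theorem not_hasLogOn_compl_of_isCompact {K : Set ℂ} (hK : IsCompact K) {x : ℂ} :
    ¬ HasLogOn (fun w => w - x) Kᶜ := by
  intro h
  obtain ⟨M, hM⟩ := hK.isBounded.exists_norm_le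
  have hR : 0 < |M| + ‖x‖ + 1 := by positivity
  apply not_hasLogOn_sphere hR
  have h2 := h.comp (f := fun w : ℂ => w + x) (S' := sphere 0 (|M| + ‖x‖ + 1)) (by fun_prop) (by
    intro w hw hwK
    have h3 := hM _ hwK
    have h4 : ‖w‖ ≤ ‖w + x‖ + ‖x‖ := by simpa using norm_sub_le (w + x) x
    rw [mem_sphere_zero_iff_norm] at hw
    have := le_abs_self M
    linarith)
  simpa using h2

/-- A logarithm `L₀` of `w - x` on `Ω` would extend across `L` to all of `Kᶜ`, contradicting the
winding of a large circle. To extend it, glue the functions `1` near `K`, `exp (-η L₀)` on `Ω` and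
`1 / (w - x)` near `L` into a nonvanishing `ψ` on the plane. It has a global logarithm `g`, and `-g`
continues `L₀` up to a constant in `2πiℤ`. -/
theorem IsRing.not_hasLogOn {Ω K L : Set ℂ} (h : IsRing Ω K L) {x : ℂ} (hx : x ∈ K) :
    ¬ HasLogOn (fun w => w - x) Ω := by
  rintro ⟨L₀, hL₀, he⟩
  obtain ⟨χ, hχ0, hχ1, -⟩ := exists_continuous_zero_one_of_isClosed h.isCompact.isClosed h.isClosed
    h.disjoint
  have hcover : ∀ w, χ w ≠ 0 → χ w ≠ 1 → w ∈ Ω := by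
    intro w h0 h1
    by_contra hw
    have : w ∈ K ∪ L := h.compl_eq ▸ hw
    rcases this with hw | hw
    · exact h0 (hχ0 hw)
    · exact h1 (hχ1 hw)
  set η : ℂ → ℝ := fun w => max 0 (min 1 (3 * χ w - 1)) with hη
  have hηc : Continuous η := by fun_prop
  set O₁ : Set ℂ := {w | χ w < 1 / 3} with hO₁
  set O₂ : Set ℂ := {w | 2 / 3 < χ w} with hO₂
  have hO₁o : IsOpen O₁ := isOpen_lt (by fun_prop) (by fun_prop)
  have hO₂o : IsOpen O₂ := isOpen_lt (by fun_prop) (by fun_prop)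
  have hxO : ∀ w ∈ O₂, w - x ≠ 0 := by
    intro w hw h0
    rw [sub_eq_zero] at h0
    subst h0
    have : χ w = 0 := hχ0 hx
    rw [hO₂, mem_ofPred_eq, this] at hw
    norm_num at hw
  have hη₁ : ∀ w ∈ O₁, η w = 0 := by
    intro w hw
    have hw : χ w < 1 / 3 := hw
    simp only [hη]
    rw [max_eq_left]
    exact (min_le_right _ _).trans (by linarith)
  have hη₂ : ∀ w ∈ O₂, η w = 1 := by
    intro w hw
    have hw : 2 / 3 < χ w := hw
    simp only [hη]
    rw [min_eq_left (by linarith), max_eq_right zero_le_one]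
  classical
  set ψ : ℂ → ℂ := fun w => if w ∈ O₁ then 1 else if w ∈ O₂ then (w - x)⁻¹ else
    exp (-(η w * L₀ w)) with hψ
  have hdisj : ∀ w ∈ O₂, w ∉ O₁ := by
    intro w hw hw'
    have hw : 2 / 3 < χ w := hw
    have hw' : χ w < 1 / 3 := hw'
    linarith
  have hψ₁ : ∀ w ∈ O₁, ψ w = 1 := fun w hw => by simp [hψ, hw]
  have hψ₂ : ∀ w ∈ O₂, ψ w = (w - x)⁻¹ := fun w hw => by simp [hψ, hw, hdisj w hw]
  have hψ₃ : ∀ w ∈ Ω, ψ w = exp (-(η w * L₀ w)) := by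
    intro w hw
    by_cases h1 : w ∈ O₁
    · simp [hψ₁ w h1, hη₁ w h1]
    by_cases h2 : w ∈ O₂
    · rw [hψ₂ w h2, hη₂ w h2]
      simp [exp_neg, he w hw]
    · simp [hψ, h1, h2]
  have hall : ∀ w, w ∈ O₁ ∨ w ∈ O₂ ∨ w ∈ Ω := by
    intro w
    by_cases h1 : w ∈ O₁
    · exact Or.inl h1
    by_cases h2 : w ∈ O₂
    · exact Or.inr (Or.inl h2)
    refine Or.inr (Or.inr (hcover w ?_ ?_))
    · intro h0
      exact h1 (by rw [hO₁, mem_ofPred_eq, h0]; norm_num)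
    · intro h0
      exact h2 (by rw [hO₂, mem_ofPred_eq, h0]; norm_num)
  have hψc : Continuous ψ := by
    rw [continuous_iff_continuousAt]
    intro w
    rcases hall w with hw | hw | hw
    · refine continuousAt_const.congr (f := fun _ => (1 : ℂ)) ?_
      filter_upwards [hO₁o.mem_nhds hw] with v hv using (hψ₁ v hv).symm
    · have : ContinuousAt (fun w => (w - x)⁻¹) w :=
        ContinuousAt.inv₀ (by fun_prop) (hxO w hw)
      refine this.congr ?_
      filter_upwards [hO₂o.mem_nhds hw] with v hv using (hψ₂ v hv).symm
    · have h1 : ContinuousAt L₀ w := hL₀.continuousAt (h.isOpen.mem_nhds hw)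
      have : ContinuousAt (fun w => exp (-(η w * L₀ w))) w := by fun_prop
      refine this.congr ?_
      filter_upwards [h.isOpen.mem_nhds hw] with v hv using (hψ₃ v hv).symm
  have hψ0 : ∀ w, ψ w ≠ 0 := by
    intro w
    rcases hall w with hw | hw | hw
    · simp [hψ₁ w hw]
    · rw [hψ₂ w hw]; exact inv_ne_zero (hxO w hw)
    · rw [hψ₃ w hw]; exact exp_ne_zero _
  obtain ⟨g, hgc, hg⟩ := HasLogOn.of_convex (convex_univ) isOpen_univ hψc.continuousOn
    (fun w _ => hψ0 w)
  have hgc' : Continuous g := by simpa [continuousOn_univ] using hgc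
  obtain ⟨k, hk⟩ := exists_eq_add_of_exp_eq h.isConnected.isPreconnected
    (L := g) (M := fun w => -(η w * L₀ w)) hgc'.continuousOn (by fun_prop)
    (fun w hw => by rw [hg w (mem_univ _), hψ₃ w hw])
  apply not_hasLogOn_compl_of_isCompact h.isCompact (x := x)
  have hKc : ∀ w ∈ Kᶜ, w ∈ Ω ∨ w ∈ O₂ := by
    intro w hw
    by_cases h1 : w ∈ Ω
    · exact Or.inl h1
    · have : w ∈ K ∪ L := h.compl_eq ▸ h1
      rcases this with h2 | h2
      · exact absurd h2 hw
      · right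
        have : χ w = 1 := hχ1 h2
        rw [hO₂, mem_ofPred_eq, this]; norm_num
  set N : ℂ → ℂ := fun w => if w ∈ O₂ then -g w + k * (2 * Real.pi * I) else L₀ w with hN
  have hN₂ : ∀ w ∈ O₂, N w = -g w + k * (2 * Real.pi * I) := fun w hw => by simp [hN, hw]
  have hNΩ : ∀ w ∈ Ω, N w = L₀ w := by
    intro w hw
    by_cases h2 : w ∈ O₂
    · rw [hN₂ w h2, hk w hw, hη₂ w h2]; push_cast; ring
    · simp [hN, h2]
  refine ⟨N, ?_, ?_⟩
  · intro w hw
    apply ContinuousAt.continuousWithinAt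
    rcases hKc w hw with hw | hw
    · refine (hL₀.continuousAt (h.isOpen.mem_nhds hw)).congr ?_
      filter_upwards [h.isOpen.mem_nhds hw] with v hv using (hNΩ v hv).symm
    · have : ContinuousAt (fun w => -g w + k * (2 * Real.pi * I)) w := by fun_prop
      refine this.congr ?_
      filter_upwards [hO₂o.mem_nhds hw] with v hv using (hN₂ v hv).symm
  · intro w hw
    rcases hKc w hw with hw | hw
    · rw [hNΩ w hw, he w hw]
    · rw [hN₂ w hw, exp_add, exp_int_mul_two_pi_mul_I, exp_neg, hg w (mem_univ _), hψ₂ w hw]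
      simp

theorem nhds_add_exp (x u : ℂ) : map (fun u => x + exp u) (𝓝 u) = 𝓝 (x + exp u) := by
  have h1 := (Complex.hasStrictDerivAt_exp u).map_nhds_eq (exp_ne_zero u)
  have h2 : map (fun w => x + w) (𝓝 (exp u)) = 𝓝 (x + exp u) := map_add_left_nhds x (exp u)
  rw [← h2, ← h1, map_map]
  rfl

theorem isOpenMap_add_exp (x : ℂ) : IsOpenMap (fun u => x + exp u) :=
  IsOpenMap.of_nhds_le fun u => (nhds_add_exp x u).ge

/-- A component of the preimage of `Ω` under `u ↦ x + exp u`. -/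
structure IsExpCover (x : ℂ) (Ω U : Set ℂ) : Prop where
  isOpen : IsOpen U
  isConnected : IsConnected U
  mapsTo : ∀ u ∈ U, x + exp u ∈ Ω
  maximal : ∀ P : Set ℂ, IsPreconnected P → (∀ u ∈ P, x + exp u ∈ Ω) → (P ∩ U).Nonempty → P ⊆ U

theorem exists_isExpCover {x : ℂ} {Ω : Set ℂ} (hΩ : IsOpen Ω) (hne : Ω.Nonempty) (hx : x ∉ Ω) :
    ∃ U, IsExpCover x Ω U := by
  obtain ⟨w, hw⟩ := hne
  have hwx : w - x ≠ 0 := fun h => hx (by rw [sub_eq_zero] at h; exact h ▸ hw)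
  set S : Set ℂ := (fun u => x + exp u) ⁻¹' Ω with hS
  have hSo : IsOpen S := hΩ.preimage (by fun_prop)
  have hu : log (w - x) ∈ S := by simp [hS, exp_log hwx, hw]
  refine ⟨connectedComponentIn S (log (w - x)), hSo.connectedComponentIn,
    isConnected_connectedComponentIn_iff.2 hu, fun u hu' => connectedComponentIn_subset S _ hu', ?_⟩
  rintro P hP hPS ⟨v, hvP, hvU⟩
  rw [connectedComponentIn_eq hvU]
  exact hP.subset_connectedComponentIn hvP hPS

namespace IsExpCover
variable {x : ℂ} {Ω U : Set ℂ}

/-- Let `Q` be a compact piece of `Uᶜ`. The part of `Q` lying over the complement of `Ω` has an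
image that is compact and relatively open in `K ∪ L`, as `u ↦ x + exp u` is open. If it met the
connected set `K` it would contain `x`, a value never taken; so it is a compact piece of `L`, hence
empty. Thus `Q` lies over `Ω`, is open as a union of pieces of other components, and a compact open
plane set is empty. -/
theorem noCompactPiece_compl {K L : Set ℂ} (h : IsExpCover x Ω U) (hr : IsRing Ω K L)
    (hx : x ∈ K) : NoCompactPiece Uᶜ := by
  intro Q O hQ hO hQO
  set S : Set ℂ := (fun u => x + exp u) ⁻¹' Ω with hS
  have hSo : IsOpen S := hr.isOpen.preimage (by fun_prop)
  have hE : Continuous (fun u => x + exp u) := by fun_prop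
  have hUS : U ⊆ S := h.mapsTo
  set Q₂ := Q ∩ Sᶜ with hQ₂
  have hQ₂c : IsCompact Q₂ := hQ.inter_right hSo.isClosed_compl
  have himc : IsCompact ((fun u => x + exp u) '' Q₂) := hQ₂c.image hE
  have himo : IsOpen ((fun u => x + exp u) '' O) := isOpenMap_add_exp x O hO
  have hsub : (fun u => x + exp u) '' Q₂ ⊆ (fun u => x + exp u) '' O :=
    image_mono (fun u hu => by
      have := hu.1
      rw [← hQO] at this
      exact this.2)
  have hkey : ∀ w ∈ (fun u => x + exp u) '' O, w ∉ Ω → w ∈ (fun u => x + exp u) '' Q₂ := by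
    rintro w ⟨u, hu, rfl⟩ hw
    refine ⟨u, ⟨?_, hw⟩, rfl⟩
    rw [← hQO]
    exact ⟨fun h' => hw (h.mapsTo u h'), hu⟩
  have hnx : ∀ P : Set ℂ, x ∉ (fun u => x + exp u) '' P := by
    rintro P ⟨u, -, hu⟩
    simp [exp_ne_zero] at hu
  have hK0 : ∀ w ∈ K, w ∉ Ω := fun w hw => (hr.compl_eq ▸ Or.inl hw : w ∈ Ωᶜ)
  have hL0 : ∀ w ∈ L, w ∉ Ω := fun w hw => (hr.compl_eq ▸ Or.inr hw : w ∈ Ωᶜ)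
  have hKe : ¬ (K ∩ (fun u => x + exp u) '' O).Nonempty := by
    intro hne
    refine hnx Q₂ (subset_of_relatively_clopen hr.isConnected_inner.isPreconnected himo
      himc.isClosed ?_ hne hx)
    ext w
    exact ⟨fun hw => ⟨hw.1, hkey w hw.2 (hK0 w hw.1)⟩, fun hw => ⟨hw.1, hsub hw.2⟩⟩
  have hLe : (fun u => x + exp u) '' Q₂ = ∅ := by
    refine hr.noCompactPiece _ _ himc himo ?_
    ext w
    refine ⟨fun hw => hkey w hw.2 (hL0 w hw.1), fun hw => ⟨?_, hsub hw⟩⟩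
    have hwΩ : w ∈ Ωᶜ := by
      obtain ⟨u, hu, rfl⟩ := hw
      exact hu.2
    rw [hr.compl_eq] at hwΩ
    rcases hwΩ with hw' | hw'
    · exact absurd ⟨w, hw', hsub hw⟩ hKe
    · exact hw'
  have hQ₂e : Q₂ = ∅ := by simpa using hLe
  apply eq_empty_of_isCompact_of_isOpen hQ
  rw [isOpen_iff_mem_nhds]
  intro u hu
  have huS : u ∈ S := by
    by_contra hcon
    exact (Set.eq_empty_iff_forall_notMem.1 hQ₂e u) ⟨hu, hcon⟩
  rw [← hQO] at hu
  have h1 : IsOpen (connectedComponentIn S u) := hSo.connectedComponentIn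
  filter_upwards [h1.mem_nhds (mem_connectedComponentIn huS), hO.mem_nhds hu.2] with v hv hvO
  rw [← hQO]
  refine ⟨fun hvU => hu.1 ?_, hvO⟩
  exact h.maximal _ isPreconnected_connectedComponentIn
    (fun w hw => connectedComponentIn_subset S _ hw) ⟨v, hv, hvU⟩ (mem_connectedComponentIn huS)

/-- Translation by `2πin` permutes the components over `Ω`, so it preserves `U` as soon as it
returns one point of `U` to `U`. The admissible `n` then form a subgroup of the integers. -/
theorem add_mem_iff (h : IsExpCover x Ω U) {u v : ℂ} (hu : u ∈ U) (hv : v ∈ U) (n : ℤ) :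
    u + n * (2 * Real.pi * I) ∈ U ↔ v + n * (2 * Real.pi * I) ∈ U := by
  have key : ∀ u ∈ U, ∀ v ∈ U, u + n * (2 * Real.pi * I) ∈ U → v + n * (2 * Real.pi * I) ∈ U := by
    intro u hu v hv hun
    refine h.maximal ((fun w => w + n * (2 * Real.pi * I)) '' U)
      (h.isConnected.isPreconnected.image _ (by fun_prop)) ?_ ⟨_, ⟨u, hu, rfl⟩, hun⟩ ⟨v, hv, rfl⟩
    rintro _ ⟨w, hw, rfl⟩
    simp only [exp_add, exp_int_mul_two_pi_mul_I, mul_one]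
    exact h.mapsTo w hw
  exact ⟨key u hu v hv, key v hv u hu⟩

theorem exists_generator (h : IsExpCover x Ω U) :
    ∃ d : ℤ, ∀ u ∈ U, ∀ n : ℤ, u + n * (2 * Real.pi * I) ∈ U ↔ d ∣ n := by
  obtain ⟨u₀, hu₀⟩ := h.isConnected.nonempty
  let D : AddSubgroup ℤ :=
    { carrier := {n | u₀ + n * (2 * Real.pi * I) ∈ U}
      zero_mem' := by simpa using hu₀
      add_mem' := by
        intro a b ha hb
        have := (h.add_mem_iff hu₀ ha b).1 hb
        have e : u₀ + ((a + b : ℤ) : ℂ) * (2 * Real.pi * I) =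
          u₀ + a * (2 * Real.pi * I) + b * (2 * Real.pi * I) := by push_cast; ring
        simp only [mem_ofPred_eq]
        rw [e]
        exact this
      neg_mem' := by
        intro a ha
        have h2 : u₀ + a * (2 * Real.pi * I) + (-a : ℤ) * (2 * Real.pi * I) ∈ U := by
          push_cast
          simpa using hu₀
        exact (h.add_mem_iff ha hu₀ (-a)).1 h2 }
  obtain ⟨d, hd⟩ := Int.subgroup_cyclic D
  refine ⟨d, fun u hu n => ?_⟩
  rw [h.add_mem_iff hu hu₀ n]
  change n ∈ D ↔ _
  rw [hd, AddSubgroup.mem_closure_singleton]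
  simp only [smul_eq_mul, dvd_def, mul_comm d, eq_comm]

/-- The image is open, and it is closed in `Ω`: over a small disc about a limit point, some
`2πi`-translate of a local sheet meets `U` and is absorbed by maximality. -/
theorem image_eq (h : IsExpCover x Ω U) (hΩ : IsOpen Ω) (hc : IsPreconnected Ω) (hx : x ∉ Ω) :
    (fun u => x + exp u) '' U = Ω := by
  have ho : IsOpen ((fun u => x + exp u) '' U) := isOpenMap_add_exp x U h.isOpen
  have hsub : (fun u => x + exp u) '' U ⊆ Ω := by
    rintro _ ⟨u, hu, rfl⟩
    exact h.mapsTo u hu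
  have hcl : Ω ∩ closure ((fun u => x + exp u) '' U) ⊆ (fun u => x + exp u) '' U := by
    rintro w ⟨hw, hwc⟩
    have hwx : w - x ≠ 0 := fun h => hx (by rw [sub_eq_zero] at h; exact h ▸ hw)
    have hwe : x + exp (log (w - x)) = w := by rw [exp_log hwx]; ring
    have hcont : ContinuousAt (fun u => x + exp u) (log (w - x)) := by fun_prop
    have h1 : (fun u => x + exp u) ⁻¹' Ω ∈ 𝓝 (log (w - x)) :=
      hcont.preimage_mem_nhds (by rw [hwe]; exact hΩ.mem_nhds hw)
    obtain ⟨ε, hε, hb⟩ := Metric.mem_nhds_iff.1 h1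
    have h2 : (fun u => x + exp u) '' ball (log (w - x)) ε ∈ 𝓝 (x + exp (log (w - x))) := by
      rw [← nhds_add_exp]
      exact image_mem_map (ball_mem_nhds _ hε)
    rw [hwe] at h2
    obtain ⟨_, ⟨v, hv, rfl⟩, u, hu, huv⟩ := mem_closure_iff_nhds.1 hwc _ h2
    have h3 : exp u = exp v := by simpa using huv
    obtain ⟨n, hn⟩ := exp_eq_exp_iff_exists_int.1 h3
    have h4 : log (w - x) + n * (2 * Real.pi * I) ∈ U := by
      refine h.maximal ((fun w => w + n * (2 * Real.pi * I)) '' ball (log (w - x)) ε)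
        ((convex_ball _ _).isPreconnected.image _ (by fun_prop)) ?_
        ⟨u, ⟨v, hv, hn.symm⟩, hu⟩ ⟨_, mem_ball_self hε, rfl⟩
      rintro _ ⟨a, ha, rfl⟩
      simp only [exp_add, exp_int_mul_two_pi_mul_I, mul_one]
      exact hb ha
    exact ⟨_, h4, by simp only [exp_add, exp_int_mul_two_pi_mul_I, mul_one]; exact hwe⟩
  refine hsub.antisymm fun w hw => hcl ⟨hw, ?_⟩
  refine subset_of_relatively_clopen hc ho isClosed_closure ?_ ?_ hw
  · exact Subset.antisymm (fun w hw => ⟨hw.1, subset_closure hw.2⟩)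
      (fun w hw => ⟨hw.1, hcl hw⟩)
  · obtain ⟨u, hu⟩ := h.isConnected.nonempty
    exact ⟨_, h.mapsTo u hu, u, hu, rfl⟩

end IsExpCover

/-! ### Uniformization of rings -/

theorem isOpen_roundAnnulus (r R : ℝ≥0∞) : IsOpen (roundAnnulus r R) :=
  (isOpen_lt continuous_const continuous_enorm).inter (isOpen_lt continuous_enorm continuous_const)

theorem ne_zero_of_mem_roundAnnulus {r R : ℝ≥0∞} {z : ℂ} (hz : z ∈ roundAnnulus r R) : z ≠ 0 := by
  rintro rfl
  exact absurd hz.1 (by simp)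

/-- A holomorphic function on the preimage of an annulus under `exp` which is `2πi`-periodic
descends to the annulus. -/
theorem exists_descent {S A : Set ℂ} (hA : IsOpen A) (h0 : ∀ z ∈ A, z ≠ 0) (hS : S = exp ⁻¹' A)
    {P : ℂ → ℂ} (hP : DifferentiableOn ℂ P S) (hper : ∀ s ∈ S, P (s + 2 * Real.pi * I) = P s) :
    ∃ q : ℂ → ℂ, DifferentiableOn ℂ q A ∧ ∀ s ∈ S, q (exp s) = P s := by
  subst hS
  have hmem : ∀ s ∈ exp ⁻¹' A, ∀ n : ℤ, s + n * (2 * Real.pi * I) ∈ exp ⁻¹' A := by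
    intro s hs n
    rw [mem_preimage, exp_add, exp_int_mul_two_pi_mul_I, mul_one]
    exact hs
  have hper' : ∀ n : ℤ, ∀ s ∈ exp ⁻¹' A, P (s + n * (2 * Real.pi * I)) = P s := by
    intro n
    induction n using Int.induction_on with
    | zero => simp
    | succ n ih =>
      intro s hs
      have := hper _ (hmem s hs n)
      rw [← ih s hs, ← this]
      congr 1
      push_cast
      ring
    | pred n ih =>
      intro s hs
      have := hper _ (hmem s hs (-n - 1))
      rw [← ih s hs, ← this]
      congr 1
      push_cast
      ring
  have hq : ∀ s ∈ exp ⁻¹' A, P (log (exp s)) = P s := by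
    intro s hs
    have h1 : exp (log (exp s)) = exp s := exp_log (exp_ne_zero s)
    obtain ⟨n, hn⟩ := exp_eq_exp_iff_exists_int.1 h1
    rw [hn, hper' n s hs]
  have hSo : IsOpen (exp ⁻¹' A) := hA.preimage continuous_exp
  refine ⟨fun z => P (log z), fun z hz => ?_, hq⟩
  apply DifferentiableAt.differentiableWithinAt
  have hz0 := h0 z hz
  -- Off the cut `P ∘ log` is holomorphic; on the cut the branch `log (-w) + πi` is used instead,
  -- and periodicity makes the two agree.
  by_cases hs : z ∈ slitPlane
  · have h1 : DifferentiableAt ℂ P (log z) := hP.differentiableAt (hSo.mem_nhds (by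
      rw [mem_preimage, exp_log hz0]; exact hz))
    exact h1.comp z (differentiableAt_log hs)
  · have hs' : -z ∈ slitPlane := by
      rcases mem_slitPlane_or_neg_mem_slitPlane hz0 with h | h
      · exact absurd h hs
      · exact h
    have hexp : ∀ w : ℂ, w ≠ 0 → exp (log (-w) + Real.pi * I) = w := by
      intro w hw
      rw [exp_add, exp_log (neg_ne_zero.2 hw), exp_pi_mul_I]
      ring
    have h1 : DifferentiableAt ℂ P (log (-z) + Real.pi * I) :=
      hP.differentiableAt (hSo.mem_nhds (by rw [mem_preimage, hexp z hz0]; exact hz))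
    have h2 : DifferentiableAt ℂ (fun w : ℂ => log (-w) + Real.pi * I) z :=
      (DifferentiableAt.clog (by fun_prop) hs').add_const _
    have h3 : DifferentiableAt ℂ (fun w => P (log (-w) + Real.pi * I)) z :=
      DifferentiableAt.comp z (g := P) h1 h2
    refine h3.congr_of_eventuallyEq ?_
    filter_upwards [hA.mem_nhds hz] with w hw
    have h4 := hq (log (-w) + Real.pi * I) (by rw [mem_preimage, hexp w (h0 w hw)]; exact hw)
    rw [hexp w (h0 w hw)] at h4
    exact h4

/-- The cover `U` is a simply connected proper domain (a second point of `K` supplies an omitted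
logarithm), so it is a disc on which the deck translation by `2πid` acts without fixed points.
Normalizing this action to the translation by `2πi` identifies the quotient with a round annulus. -/
theorem IsRing.exists_uniformization {Ω K L : Set ℂ} (h : IsRing Ω K L) (hK : K.Nontrivial) :
    ∃ r R : ℝ≥0∞, r < R ∧ ∃ q : ℂ → ℂ, DifferentiableOn ℂ q (roundAnnulus r R) ∧
      BijOn q (roundAnnulus r R) Ω := by
  obtain ⟨x, hx, x₁, hx₁, hne⟩ := hK
  have hK0 : ∀ w ∈ K, w ∉ Ω := fun w hw => (h.compl_eq ▸ Or.inl hw : w ∈ Ωᶜ)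
  obtain ⟨U, hU⟩ := exists_isExpCover h.isOpen h.isConnected.nonempty (hK0 x hx)
  have him := hU.image_eq h.isOpen h.isConnected.isPreconnected (hK0 x hx)
  have hUne : U ≠ univ := by
    intro hcon
    have h1 := hU.mapsTo (log (x₁ - x)) (hcon ▸ mem_univ _)
    rw [exp_log (sub_ne_zero.2 hne.symm), add_sub_cancel] at h1
    exact hK0 _ hx₁ h1
  obtain ⟨φ, ψ, hφ⟩ := exists_biholo_ball hU.isOpen hU.isConnected
    (hU.noCompactPiece_compl h hx) hUne
  obtain ⟨d, hd⟩ := hU.exists_generator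
  -- With trivial deck group the covering map would be injective on `U`, and its inverse would be a
  -- logarithm of `w - x` on `Ω`.
  have hd0 : d ≠ 0 := by
    rintro rfl
    apply h.not_hasLogOn hx
    have hinj : InjOn (fun u => x + exp u) U := by
      intro u hu v hv huv
      have h3 : exp u = exp v := by simpa using huv
      obtain ⟨n, hn⟩ := exp_eq_exp_iff_exists_int.1 h3
      have h4 : (0 : ℤ) ∣ n := (hd v hv n).1 (hn ▸ hu)
      rw [zero_dvd_iff] at h4
      simpa [h4] using hn
    have hb := IsBiholo.of_injOn hU.isOpen
      (by fun_prop : DifferentiableOn ℂ (fun u => x + exp u) U) hinj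
    rw [him] at hb
    refine ⟨_, hb.diff_inv.continuousOn, fun w hw => ?_⟩
    have := hb.right_inv w hw
    exact eq_sub_of_add_eq' this
  have htr : ∀ e : ℤ, d ∣ e → IsBiholo (fun u => u + e * (2 * Real.pi * I))
      (fun u => u + (-e : ℤ) * (2 * Real.pi * I)) U U := fun e he =>
    { diff := by fun_prop
      diff_inv := by fun_prop
      mapsTo := fun u hu => (hd u hu e).2 he
      mapsTo_inv := fun u hu => (hd u hu _).2 (by simpa using he)
      left_inv := fun u _ => by push_cast; ring
      right_inv := fun u _ => by push_cast; ring }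
  have hT := (hφ.symm.trans (htr d dvd_rfl)).trans hφ
  have hψT : ∀ z ∈ ball (0 : ℂ) 1, ψ ((φ ∘ (fun u => u + d * (2 * Real.pi * I)) ∘ ψ) z) =
      ψ z + d * (2 * Real.pi * I) := by
    intro z hz
    simp only [Function.comp_apply]
    exact hφ.left_inv _ ((htr d dvd_rfl).mapsTo (hφ.mapsTo_inv hz))
  obtain ⟨r, R, hrR, f, g, hfg, hper⟩ := exists_biholo_of_no_fixed_point hT (by
    intro z hz hcon
    have h1 := hψT z hz
    rw [hcon] at h1
    have : (d : ℂ) * (2 * Real.pi * I) ≠ 0 := by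
      simp [hd0, Real.pi_ne_zero]
    exact this (by linear_combination -h1))
  set S : Set ℂ := exp ⁻¹' roundAnnulus r R with hS
  have hmem : ∀ s ∈ S, ∀ n : ℤ, s + n * (2 * Real.pi * I) ∈ S := by
    intro s hs n
    rw [hS, mem_preimage, exp_add, exp_int_mul_two_pi_mul_I, mul_one]
    exact hs
  have hb := hfg.symm.trans hφ.symm
  have ha1 : ∀ s ∈ S, (ψ ∘ g) (s + 2 * Real.pi * I) = (ψ ∘ g) s + d * (2 * Real.pi * I) := by
    intro s hs
    have h1 := hfg.mapsTo_inv hs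
    have h2 := hper _ h1
    rw [hfg.right_inv s hs] at h2
    rw [Function.comp_apply, Function.comp_apply, ← h2, hfg.left_inv _ (hT.mapsTo h1),
      hψT _ h1]
  have ha : ∀ n : ℤ, ∀ s ∈ S, (ψ ∘ g) (s + n * (2 * Real.pi * I)) =
      (ψ ∘ g) s + (d * n) * (2 * Real.pi * I) := by
    intro n
    induction n using Int.induction_on with
    | zero => simp
    | succ n ih =>
      intro s hs
      have h1 := ha1 _ (hmem s hs n)
      rw [ih s hs] at h1
      have e : s + ((n + 1 : ℤ) : ℂ) * (2 * Real.pi * I) =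
        s + ((n : ℤ) : ℂ) * (2 * Real.pi * I) + 2 * Real.pi * I := by push_cast; ring
      rw [e, h1]
      push_cast
      ring
    | pred n ih =>
      intro s hs
      have h1 := ha1 _ (hmem s hs (-n - 1))
      have e : s + ((-n - 1 : ℤ) : ℂ) * (2 * Real.pi * I) + 2 * Real.pi * I =
        s + ((-n : ℤ) : ℂ) * (2 * Real.pi * I) := by push_cast; ring
      rw [e, ih s hs] at h1
      push_cast at h1 ⊢
      linear_combination -h1
  have hPd : DifferentiableOn ℂ (fun s => x + exp ((ψ ∘ g) s)) S := (hb.diff.cexp).const_add x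
  obtain ⟨q, hqd, hq⟩ := exists_descent (isOpen_roundAnnulus r R)
    (fun z hz => ne_zero_of_mem_roundAnnulus hz) hS hPd (by
      intro s hs
      rw [ha1 s hs, exp_add, exp_int_mul_two_pi_mul_I, mul_one])
  have hsurj : ∀ z ∈ roundAnnulus r R, ∃ s ∈ S, exp s = z := fun z hz =>
    ⟨log z, by rw [hS, mem_preimage, exp_log (ne_zero_of_mem_roundAnnulus hz)]; exact hz,
      exp_log (ne_zero_of_mem_roundAnnulus hz)⟩
  refine ⟨r, R, hrR, q, hqd, ?_, ?_, ?_⟩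
  · intro z hz
    obtain ⟨s, hs, rfl⟩ := hsurj z hz
    rw [hq s hs]
    exact hU.mapsTo _ (hb.mapsTo hs)
  · intro z hz z' hz' hzz
    obtain ⟨s, hs, rfl⟩ := hsurj z hz
    obtain ⟨s', hs', rfl⟩ := hsurj z' hz'
    rw [hq s hs, hq s' hs'] at hzz
    have h3 : exp ((ψ ∘ g) s) = exp ((ψ ∘ g) s') := by simpa using hzz
    obtain ⟨n, hn⟩ := exp_eq_exp_iff_exists_int.1 h3
    obtain ⟨m, rfl⟩ : d ∣ n := (hd _ (hb.mapsTo hs') n).1 (hn ▸ hb.mapsTo hs)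
    have h4 := ha m s' hs'
    push_cast at hn
    rw [← hn] at h4
    have h5 := hb.injOn (hmem s' hs' m) hs h4
    rw [← h5, exp_add, exp_int_mul_two_pi_mul_I, mul_one]
  · intro w hw
    rw [← him] at hw
    obtain ⟨u, hu, rfl⟩ := hw
    have h1 := hb.mapsTo_inv hu
    refine ⟨exp _, h1, ?_⟩
    rw [hq _ h1, hb.right_inv u hu]

/-! ### Winding on round annuli and monotonicity of the modulus -/

theorem enorm_exp (s : ℂ) : ‖exp s‖ₑ = ENNReal.ofReal (Real.exp s.re) := by
  rw [← ofReal_norm, norm_exp]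

theorem enorm_of_mem_sphere {s : ℝ} {z : ℂ} (hz : z ∈ sphere (0 : ℂ) s) :
    ‖z‖ₑ = ENNReal.ofReal s := by
  rw [← ofReal_norm, mem_sphere_zero_iff_norm.1 hz]

theorem convex_exp_preimage_roundAnnulus (r R : ℝ≥0∞) : Convex ℝ (exp ⁻¹' roundAnnulus r R) := by
  have h : OrdConnected {t : ℝ | r < ENNReal.ofReal (Real.exp t) ∧
      ENNReal.ofReal (Real.exp t) < R} := by
    refine ⟨fun x hx y hy t ht => ⟨hx.1.trans_le ?_, lt_of_le_of_lt ?_ hy.2⟩⟩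
    · exact ENNReal.ofReal_le_ofReal (Real.exp_le_exp.2 ht.1)
    · exact ENNReal.ofReal_le_ofReal (Real.exp_le_exp.2 ht.2)
  have h2 := h.convex (𝕜 := ℝ) |>.linear_preimage Complex.reLm
  have e : exp ⁻¹' roundAnnulus r R = Complex.reLm ⁻¹' {t : ℝ | r < ENNReal.ofReal (Real.exp t) ∧
      ENNReal.ofReal (Real.exp t) < R} := by
    ext s
    simp [roundAnnulus, enorm_exp]
  rw [e]
  exact h2

theorem exists_circle {r R : ℝ≥0∞} (h : r < R) :
    ∃ s : ℝ, 0 < s ∧ r < ENNReal.ofReal s ∧ ENNReal.ofReal s < R := by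
  obtain ⟨s, h1, h2⟩ := ENNReal.lt_iff_exists_nnreal_btwn.1 h
  refine ⟨s, ?_, by simpa using h1, by simpa using h2⟩
  have := (zero_le).trans_lt h1
  simpa using this

theorem sphere_subset_roundAnnulus {r R : ℝ≥0∞} {s : ℝ} (h1 : r < ENNReal.ofReal s)
    (h2 : ENNReal.ofReal s < R) : sphere (0 : ℂ) s ⊆ roundAnnulus r R := by
  intro z hz
  rw [roundAnnulus, mem_ofPred_eq, enorm_of_mem_sphere hz]
  exact ⟨h1, h2⟩

theorem isConnected_roundAnnulus {r R : ℝ≥0∞} (h : r < R) : IsConnected (roundAnnulus r R) := by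
  have e : exp '' (exp ⁻¹' roundAnnulus r R) = roundAnnulus r R := by
    rw [image_preimage_eq_inter_range, range_exp, inter_eq_left]
    exact fun z hz => ne_zero_of_mem_roundAnnulus hz
  obtain ⟨s, hs, h1, h2⟩ := exists_circle h
  rw [← e]
  refine ⟨?_, (convex_exp_preimage_roundAnnulus r R).isPreconnected.image _
    continuous_exp.continuousOn⟩
  rw [e]
  exact ⟨s, sphere_subset_roundAnnulus h1 h2 (by simp [hs.le])⟩

/-- The lift of a nonvanishing function on an annulus to the covering strip, with its period. -/
theorem exists_strip_log {r R : ℝ≥0∞} {u : ℂ → ℂ} (hu : DifferentiableOn ℂ u (roundAnnulus r R))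
    (h0 : ∀ z ∈ roundAnnulus r R, u z ≠ 0) :
    ∃ M : ℂ → ℂ, ∃ k : ℤ, DifferentiableOn ℂ M (exp ⁻¹' roundAnnulus r R) ∧
      (∀ s ∈ exp ⁻¹' roundAnnulus r R, exp (M s) = u (exp s)) ∧
      ∀ s ∈ exp ⁻¹' roundAnnulus r R, M (s + 2 * Real.pi * I) = M s + k * (2 * Real.pi * I) := by
  have hcv := convex_exp_preimage_roundAnnulus r R
  have hSo : IsOpen (exp ⁻¹' roundAnnulus r R) := (isOpen_roundAnnulus r R).preimage continuous_exp
  have hd : DifferentiableOn ℂ (fun s => u (exp s)) (exp ⁻¹' roundAnnulus r R) :=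
    hu.comp (by fun_prop) (fun s hs => hs)
  obtain ⟨M, hM, he⟩ := HasLogOn.of_convex hcv hSo hd.continuousOn (fun s hs => h0 _ hs)
  have htr : MapsTo (fun s => s + 2 * Real.pi * I) (exp ⁻¹' roundAnnulus r R)
      (exp ⁻¹' roundAnnulus r R) := by
    intro s hs
    rw [mem_preimage, exp_periodic s]
    exact hs
  obtain ⟨k, hk⟩ := exists_eq_add_of_exp_eq hcv.isPreconnected
    (L := fun s => M (s + 2 * Real.pi * I)) (M := M)
    (hM.comp (by fun_prop) htr) hM
    (fun s hs => by rw [he _ (htr hs), he s hs]; simp only [exp_periodic s])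
  refine ⟨M, k, fun s hs => ?_, he, hk⟩
  exact (hasDerivAt_log_of_exp_eq hSo hM he hs
    (hd.differentiableAt (hSo.mem_nhds hs)).hasDerivAt).differentiableAt.differentiableWithinAt

/-- The period `k` of the lift to the strip can be read off on a single vertical line. A logarithm
on one circle forces `k = 0`, and then the lift descends to the whole annulus. -/
theorem HasLogOn.of_sphere {r R : ℝ≥0∞} {s : ℝ} (hs : 0 < s) (h1 : r < ENNReal.ofReal s)
    (h2 : ENNReal.ofReal s < R) {u : ℂ → ℂ} (hu : DifferentiableOn ℂ u (roundAnnulus r R))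
    (h0 : ∀ z ∈ roundAnnulus r R, u z ≠ 0) (h : HasLogOn u (sphere 0 s)) :
    HasLogOn u (roundAnnulus r R) := by
  obtain ⟨M, k, hM, he, hk⟩ := exists_strip_log hu h0
  obtain ⟨N, hN, hNe⟩ := h
  have hl : Convex ℝ {σ : ℂ | σ.re = Real.log s} := convex_hyperplane Complex.reLm.isLinear _
  have hmem : ∀ σ : ℂ, σ.re = Real.log s → exp σ ∈ sphere (0 : ℂ) s := by
    intro σ hσ
    rw [mem_sphere_zero_iff_norm, norm_exp, hσ, Real.exp_log hs]
  have hsub : ∀ σ : ℂ, σ.re = Real.log s → exp σ ∈ roundAnnulus r R := fun σ hσ =>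
    sphere_subset_roundAnnulus h1 h2 (hmem σ hσ)
  obtain ⟨j, hj⟩ := exists_eq_add_of_exp_eq hl.isPreconnected (L := M) (M := fun σ => N (exp σ))
    (hM.continuousOn.mono fun σ hσ => hsub σ hσ)
    (hN.comp (by fun_prop) fun σ hσ => hmem σ hσ)
    (fun σ hσ => by rw [he σ (hsub σ hσ), hNe _ (hmem σ hσ)])
  have hk0 : (k : ℂ) * (2 * Real.pi * I) = 0 := by
    have e1 := hj ((Real.log s : ℝ) : ℂ) (ofReal_re _)
    have e2 := hj ((Real.log s : ℝ) + 2 * Real.pi * I : ℂ) (by simp)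
    have e3 := hk ((Real.log s : ℝ) : ℂ) (hsub _ (ofReal_re _))
    simp only [exp_periodic _] at e2
    linear_combination e2 - e1 - e3
  obtain ⟨q, hq, hqe⟩ := exists_descent (isOpen_roundAnnulus r R)
    (fun z hz => ne_zero_of_mem_roundAnnulus hz) rfl hM (fun σ hσ => by rw [hk σ hσ, hk0, add_zero])
  refine ⟨q, hq.continuousOn, fun z hz => ?_⟩
  have hz0 := exp_log (ne_zero_of_mem_roundAnnulus hz)
  have hm : log z ∈ exp ⁻¹' roundAnnulus r R := by rw [mem_preimage, hz0]; exact hz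
  have e1 := hqe _ hm
  have e2 := he _ hm
  rw [hz0] at e1 e2
  rw [e1, e2]

theorem roundModulus_ofReal {a b : ℝ} (ha : 0 < a) (hab : a < b) :
    roundModulus (ENNReal.ofReal a) (ENNReal.ofReal b) =
      ENNReal.ofReal (Real.log (b / a) / (2 * Real.pi)) := by
  rw [roundModulus, ← ENNReal.ofReal_div_of_pos ha, ENNReal.log_ofReal_of_pos (by
    have := ha.trans hab
    positivity), EReal.real_coe_toENNReal, ENNReal.ofReal_div_of_pos (by positivity)]

theorem roundModulus_eq_top {r R : ℝ≥0∞} (hrR : r < R) (h : r = 0 ∨ R = ⊤) :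
    roundModulus r R = ⊤ := by
  have : R / r = ⊤ := by
    rcases h with rfl | rfl
    · exact ENNReal.div_zero hrR.ne'
    · exact ENNReal.top_div_of_ne_top hrR.ne
  rw [roundModulus, this, ENNReal.log_top, EReal.toENNReal_top]
  exact ENNReal.top_div_of_ne_top ENNReal.ofReal_ne_top

/-- Annuli are exhausted by compactly contained annuli, in modulus as well. -/
theorem exists_lt_roundModulus {r R m : ℝ≥0∞} (hm : m < roundModulus r R) :
    ∃ a b : ℝ, 0 < a ∧ a < b ∧ r < ENNReal.ofReal a ∧ ENNReal.ofReal b < R ∧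
      m = ENNReal.ofReal m.toReal ∧ 2 * Real.pi * m.toReal < Real.log (b / a) := by
  have hpi := Real.pi_pos
  have hmt : m ≠ ⊤ := hm.ne_top
  set ρ : ℝ := Real.exp (2 * Real.pi * m.toReal) with hρ
  have hρ1 : 1 ≤ ρ := Real.one_le_exp (by positivity)
  have hρ0 : 0 < ρ := by linarith
  have h1 : ENNReal.ofReal ρ < R / r := by
    by_contra! hcon
    refine hm.not_ge ?_
    rw [roundModulus]
    have h2 := EReal.toENNReal_le_toENNReal (ENNReal.log_le_log hcon)
    rw [ENNReal.log_ofReal_of_pos hρ0, hρ, Real.log_exp, EReal.real_coe_toENNReal,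
      ENNReal.ofReal_mul (by positivity), ENNReal.ofReal_toReal hmt] at h2
    refine ENNReal.div_le_of_le_mul ?_
    rw [mul_comm]
    exact h2
  have h2 : ENNReal.ofReal ρ * r < R := ENNReal.mul_lt_of_lt_div h1
  obtain ⟨b, hb1, hb2⟩ := ENNReal.lt_iff_exists_nnreal_btwn.1 h2
  have hρe : ENNReal.ofReal ρ ≠ 0 := by simpa using hρ0
  have h3 : r < (b : ℝ≥0∞) / ENNReal.ofReal ρ := by
    rw [ENNReal.lt_div_iff_mul_lt (Or.inl hρe) (Or.inl ENNReal.ofReal_ne_top), mul_comm]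
    exact hb1
  obtain ⟨a, ha1, ha2⟩ := ENNReal.lt_iff_exists_nnreal_btwn.1 h3
  have ha0 : 0 < (a : ℝ) := by
    have := (zero_le).trans_lt ha1
    simpa using this
  have h4 : ρ * a < b := by
    rw [ENNReal.lt_div_iff_mul_lt (Or.inl hρe) (Or.inl ENNReal.ofReal_ne_top), mul_comm,
      ← ENNReal.ofReal_coe_nnreal, ← ENNReal.ofReal_coe_nnreal, ← ENNReal.ofReal_mul hρ0.le] at ha2
    exact (ENNReal.ofReal_lt_ofReal_iff_of_nonneg (by positivity)).1 ha2
  refine ⟨a, b, ha0, ?_, by simpa using ha1, by simpa using hb2,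
    (ENNReal.ofReal_toReal hmt).symm, ?_⟩
  · nlinarith
  · rw [Real.lt_log_iff_exp_lt (by
      have : 0 < (b : ℝ) := by nlinarith
      positivity), lt_div_iff₀ ha0]
    exact h4

/-- A holomorphic map between round annuli which is not null-homotopic does not decrease the
modulus. -/
theorem roundModulus_le_of_not_hasLogOn {r₁ R₁ r₂ R₂ : ℝ≥0∞} {G : ℂ → ℂ}
    (hG : DifferentiableOn ℂ G (roundAnnulus r₁ R₁))
    (hm : MapsTo G (roundAnnulus r₁ R₁) (roundAnnulus r₂ R₂))
    (hl : ¬ HasLogOn G (roundAnnulus r₁ R₁)) : roundModulus r₁ R₁ ≤ roundModulus r₂ R₂ := by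
  have hpi := Real.pi_pos
  have h0 : ∀ z ∈ roundAnnulus r₁ R₁, G z ≠ 0 := fun z hz => ne_zero_of_mem_roundAnnulus (hm hz)
  obtain ⟨M, k, hM, he, hk⟩ := exists_strip_log hG h0
  have hk0 : k ≠ 0 := by
    rintro rfl
    obtain ⟨q, hq, hqe⟩ := exists_descent (isOpen_roundAnnulus r₁ R₁)
      (fun z hz => ne_zero_of_mem_roundAnnulus hz) rfl hM
      (fun σ hσ => by rw [hk σ hσ]; simp)
    refine hl ⟨q, hq.continuousOn, fun z hz => ?_⟩
    have hz0 := exp_log (ne_zero_of_mem_roundAnnulus hz)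
    have hm : log z ∈ exp ⁻¹' roundAnnulus r₁ R₁ := by rw [mem_preimage, hz0]; exact hz
    have e1 := hqe _ hm
    have e2 := he _ hm
    rw [hz0] at e1 e2
    rw [e1, e2]
  refine le_of_forall_lt fun m hmlt => ?_
  obtain ⟨a, b, ha, hab, hra, hbR, hme, hmlog⟩ := exists_lt_roundModulus hmlt
  have hb : 0 < b := ha.trans hab
  obtain ⟨z₀, hz₀⟩ : ∃ z, z ∈ roundAnnulus r₁ R₁ := ⟨a, sphere_subset_roundAnnulus hra
    (((ENNReal.ofReal_lt_ofReal_iff_of_nonneg ha.le).2 hab).trans hbR) (by simp [ha.le])⟩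
  have h2lt : r₂ < R₂ := (hm hz₀).1.trans (hm hz₀).2
  by_cases hinf : r₂ = 0 ∨ R₂ = ⊤
  · rw [roundModulus_eq_top h2lt hinf]
    exact hmlt.lt_top
  push Not at hinf
  obtain ⟨hr0, hRt⟩ := hinf
  have hrt : r₂ ≠ ⊤ := h2lt.ne_top
  obtain ⟨α, hα, rfl⟩ : ∃ α : ℝ, 0 < α ∧ ENNReal.ofReal α = r₂ :=
    ⟨r₂.toReal, ENNReal.toReal_pos hr0 hrt, ENNReal.ofReal_toReal hrt⟩
  obtain ⟨β, hβ, rfl⟩ : ∃ β : ℝ, 0 < β ∧ ENNReal.ofReal β = R₂ :=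
    ⟨R₂.toReal, ENNReal.toReal_pos (((zero_le).trans_lt h2lt).ne') hRt, ENNReal.ofReal_toReal hRt⟩
  have hαβ : α < β := (ENNReal.ofReal_lt_ofReal_iff_of_nonneg hα.le).1 h2lt
  rw [roundModulus_ofReal hα hαβ, hme, ENNReal.ofReal_lt_ofReal_iff_of_nonneg (by positivity)]
  rw [lt_div_iff₀ (by positivity)]
  suffices Real.log (b / a) ≤ Real.log (β / α) by linarith
  have hS : ∀ t y : ℝ, Real.log a ≤ t → t ≤ Real.log b →
      (t + y * I : ℂ) ∈ exp ⁻¹' roundAnnulus r₁ R₁ := by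
    intro t y h1 h2
    rw [mem_preimage, roundAnnulus, mem_ofPred_eq, enorm_exp]
    have e : (t + y * I : ℂ).re = t := by simp
    rw [e]
    constructor
    · refine hra.trans_le (ENNReal.ofReal_le_ofReal ?_)
      rwa [← Real.log_le_iff_le_exp ha]
    · refine lt_of_le_of_lt (ENNReal.ofReal_le_ofReal ?_) hbR
      rwa [← Real.le_log_iff_exp_le hb]
  have hlog : Real.log a < Real.log b := Real.log_lt_log ha hab
  -- Cauchy's theorem on a rectangle of height `2π`. The horizontal sides contribute `(log b - log
  -- a) · 2πik`, and the integrals over the vertical sides have real parts between `2π log α` and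
  -- `2π log β`; hence `|k| log (b/a) ≤ log (β/α)` with `|k| ≥ 1`.
  have hrect := integral_boundary_rect_eq_zero_of_differentiableOn M (Real.log a : ℂ)
    (Real.log b + (2 * Real.pi : ℝ) * I : ℂ) (hM.mono (by
      rintro σ ⟨h1, -⟩
      simp only [mem_preimage, ofReal_re, add_re, mul_re, I_re, mul_zero, ofReal_im, I_im, mul_one,
        sub_self, add_zero, uIcc_of_le hlog.le] at h1
      have := hS σ.re σ.im h1.1 h1.2
      rwa [re_add_im] at this))
  simp only [ofReal_re, add_re, mul_re, I_re, mul_zero, ofReal_im, I_im, mul_one, sub_self,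
    add_zero, add_im, mul_im, zero_add, ofReal_zero, zero_mul] at hrect
  have hdiff : (∫ x : ℝ in Real.log a..Real.log b, M (x + (2 * Real.pi : ℝ) * I)) =
      (∫ x : ℝ in Real.log a..Real.log b, M x) +
        (Real.log b - Real.log a : ℝ) • ((k : ℂ) * (2 * Real.pi * I)) := by
    rw [← intervalIntegral.integral_const, ← intervalIntegral.integral_add]
    · apply intervalIntegral.integral_congr
      intro x hx
      rw [uIcc_of_le hlog.le] at hx
      have := hk x (by simpa using hS x 0 hx.1 hx.2)
      simpa using this
    · apply ContinuousOn.intervalIntegrable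
      refine hM.continuousOn.comp (by fun_prop) ?_
      intro x hx
      rw [uIcc_of_le hlog.le] at hx
      simpa using hS x 0 hx.1 hx.2
    · exact intervalIntegrable_const
  have hre : ∀ t : ℝ, Real.log a ≤ t → t ≤ Real.log b →
      2 * Real.pi * Real.log α ≤ (∫ y : ℝ in (0 : ℝ)..2 * Real.pi, M (t + y * I)).re ∧
      (∫ y : ℝ in (0 : ℝ)..2 * Real.pi, M (t + y * I)).re ≤ 2 * Real.pi * Real.log β := by
    intro t h1 h2
    have hc : Continuous (fun y : ℝ => M (t + y * I)) := by
      rw [← continuousOn_univ]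
      exact hM.continuousOn.comp (by fun_prop) (fun y _ => hS t y h1 h2)
    have hI : IntervalIntegrable (fun y : ℝ => M (t + y * I)) MeasureTheory.volume 0 (2 * Real.pi) :=
      hc.intervalIntegrable _ _
    have e1 : (∫ y : ℝ in (0 : ℝ)..2 * Real.pi, M (t + y * I)).re =
        ∫ y : ℝ in (0 : ℝ)..2 * Real.pi, (M (t + y * I)).re := by
      exact (Complex.reCLM.intervalIntegral_comp_comm hI).symm
    have hrec : Continuous (fun y : ℝ => (M (t + y * I)).re) := continuous_re.comp hc
    have hbd : ∀ y : ℝ, Real.log α ≤ (M (t + y * I)).re ∧ (M (t + y * I)).re ≤ Real.log β := by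
      intro y
      have h3 := hS t y h1 h2
      have h4 := (mem_roundAnnulus_ofReal hα.le).1 (hm h3)
      rw [← he _ h3, norm_exp] at h4
      exact ⟨(Real.log_le_iff_le_exp hα).2 h4.1.le, (Real.le_log_iff_exp_le hβ).2 h4.2.le⟩
    rw [e1]
    have e2 : ∀ c : ℝ, ∫ _ in (0 : ℝ)..2 * Real.pi, c = 2 * Real.pi * c := by intro c; simp
    rw [← e2, ← e2]
    constructor
    · exact intervalIntegral.integral_mono_on (by positivity) intervalIntegrable_const
        (hrec.intervalIntegrable _ _) fun y _ => (hbd y).1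
    · exact intervalIntegral.integral_mono_on (by positivity)
        (hrec.intervalIntegrable _ _) intervalIntegrable_const fun y _ => (hbd y).2
  rw [hdiff] at hrect
  set J₁ := ∫ y : ℝ in (0 : ℝ)..2 * Real.pi, M (Real.log a + y * I) with hJ₁
  set J₂ := ∫ y : ℝ in (0 : ℝ)..2 * Real.pi, M (Real.log b + y * I) with hJ₂
  have hJ : J₂ - J₁ = ((Real.log b - Real.log a) * (k * (2 * Real.pi)) : ℝ) := by
    simp only [smul_eq_mul, real_smul] at hrect
    have : I * (J₂ - J₁ - ((Real.log b - Real.log a) * (k * (2 * Real.pi)) : ℝ)) = 0 := by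
      push_cast at hrect ⊢
      linear_combination hrect
    rw [mul_eq_zero, or_iff_right I_ne_zero, sub_eq_zero] at this
    exact this
  have hJre := congrArg Complex.re hJ
  rw [sub_re, ofReal_re] at hJre
  have b1 := hre (Real.log a) le_rfl hlog.le
  have b2 := hre (Real.log b) hlog.le le_rfl
  rw [Real.log_div hb.ne' ha.ne', Real.log_div hβ.ne' hα.ne']
  have hk1 : (1 : ℝ) ≤ |(k : ℝ)| := by exact_mod_cast Int.one_le_abs hk0
  have hδ : 0 < Real.log b - Real.log a := by linarith
  have h5 : 2 * Real.pi * ((Real.log b - Real.log a) * |(k : ℝ)|) ≤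
      2 * Real.pi * (Real.log β - Real.log α) := by
    rcases abs_cases (k : ℝ) with ⟨h, -⟩ | ⟨h, -⟩ <;> rw [h] <;> nlinarith
  have h6 := le_of_mul_le_mul_left h5 (by positivity)
  nlinarith

/-- If `G` lifts to the strip covering an annulus, every nonvanishing holomorphic function of `G` has
a logarithm. -/
theorem HasLogOn.comp_roundAnnulus {X : Type*} [TopologicalSpace X] {S : Set X} {r R : ℝ≥0∞}
    {u : ℂ → ℂ} (hu : DifferentiableOn ℂ u (roundAnnulus r R)) (h0 : ∀ z ∈ roundAnnulus r R, u z ≠ 0)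
    {G : X → ℂ} (hm : MapsTo G S (roundAnnulus r R)) (hG : HasLogOn G S) :
    HasLogOn (fun x => u (G x)) S := by
  obtain ⟨M, -, hM, he, -⟩ := exists_strip_log hu h0
  obtain ⟨l, hl, hle⟩ := hG
  have hml : MapsTo l S (exp ⁻¹' roundAnnulus r R) := fun x hx => by
    rw [mem_preimage, hle x hx]
    exact hm hx
  exact ⟨fun x => M (l x), hM.continuousOn.comp hl hml, fun x hx => by rw [he _ (hml hx), hle x hx]⟩

theorem isBiholo_of_bijOn {U V : Set ℂ} (hU : IsOpen U) {q : ℂ → ℂ} (hd : DifferentiableOn ℂ q U)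
    (hb : BijOn q U V) : ∃ g, IsBiholo q g U V :=
  ⟨_, hb.image_eq ▸ IsBiholo.of_injOn hU hd hb.injOn⟩

/-- Transport by the inverse `g` of `q`: a logarithm of `g ∘ p` would lift `p` to the strip and
thereby give a logarithm of `q ∘ g ∘ p - x = p - x`. -/
theorem roundModulus_le_of_mapsTo {r₁ R₁ r₂ R₂ : ℝ≥0∞} {Ω : Set ℂ} {x : ℂ} (hx : x ∉ Ω) {q p : ℂ → ℂ}
    (hq : DifferentiableOn ℂ q (roundAnnulus r₂ R₂)) (hqb : BijOn q (roundAnnulus r₂ R₂) Ω)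
    (hp : DifferentiableOn ℂ p (roundAnnulus r₁ R₁)) (hpm : MapsTo p (roundAnnulus r₁ R₁) Ω)
    (hl : ¬ HasLogOn (fun z => p z - x) (roundAnnulus r₁ R₁)) :
    roundModulus r₁ R₁ ≤ roundModulus r₂ R₂ := by
  obtain ⟨g, hg⟩ := isBiholo_of_bijOn (isOpen_roundAnnulus _ _) hq hqb
  refine roundModulus_le_of_not_hasLogOn (G := fun z => g (p z)) (hg.diff_inv.comp hp hpm)
    (hg.mapsTo_inv.comp hpm) fun hG => hl ?_
  have h0 : ∀ z ∈ roundAnnulus r₂ R₂, q z - x ≠ 0 := fun z hz h =>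
    hx (by rw [sub_eq_zero] at h; exact h ▸ hqb.mapsTo hz)
  refine (HasLogOn.comp_roundAnnulus (hq.sub_const x) h0 (hg.mapsTo_inv.comp hpm) hG).congr ?_
  intro z hz
  simp only [Function.comp_apply]
  rw [hg.right_inv _ (hpm hz)]

/-- The outer radius of the annulus of modulus `m` with inner radius `1`. -/
noncomputable def outerRadius (m : ℝ≥0∞) : ℝ≥0∞ := ENNReal.ofReal (Real.exp (2 * Real.pi * m.toReal))

theorem one_lt_outerRadius {m : ℝ≥0∞} (hm0 : 0 < m) (hm : m ≠ ⊤) : 1 < outerRadius m := by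
  have := ENNReal.toReal_pos hm0.ne' hm
  rw [outerRadius, ← ENNReal.ofReal_one, ENNReal.ofReal_lt_ofReal_iff_of_nonneg zero_le_one,
    Real.one_lt_exp_iff]
  have := Real.pi_pos
  positivity

theorem roundModulus_one_outerRadius {m : ℝ≥0∞} (hm0 : 0 < m) (hm : m ≠ ⊤) :
    roundModulus 1 (outerRadius m) = m := by
  have h := one_lt_outerRadius hm0 hm
  rw [outerRadius, ← ENNReal.ofReal_one, ENNReal.ofReal_lt_ofReal_iff_of_nonneg zero_le_one] at h
  rw [outerRadius, ← ENNReal.ofReal_one, roundModulus_ofReal one_pos h, div_one, Real.log_exp,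
    mul_div_cancel_left₀ _ (by have := Real.pi_pos; positivity), ENNReal.ofReal_toReal hm]

/-! ### Essential annuli in rings -/

section Ring
variable {Ω K L : Set ℂ} {r R : ℝ≥0∞} {q : ℂ → ℂ}

theorem IsRing.notMem_of_mem_inner (h : IsRing Ω K L) {x : ℂ} (hx : x ∈ K) : x ∉ Ω :=
  (h.compl_eq ▸ Or.inl hx : x ∈ Ωᶜ)

theorem IsRing.notMem_of_mem_outer (h : IsRing Ω K L) {x : ℂ} (hx : x ∈ L) : x ∉ Ω :=
  (h.compl_eq ▸ Or.inr hx : x ∈ Ωᶜ)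

theorem sub_ne_zero_of_mapsTo {S : Set ℂ} (hq : MapsTo q S Ω) {x : ℂ} (hx : x ∉ Ω) :
    ∀ z ∈ S, q z - x ≠ 0 := fun z hz h => hx (by rw [sub_eq_zero] at h; exact h ▸ hq hz)

theorem IsRing.not_hasLogOn_sub (h : IsRing Ω K L) (hq : DifferentiableOn ℂ q (roundAnnulus r R))
    (hqb : BijOn q (roundAnnulus r R) Ω) {x : ℂ} (hx : x ∈ K) :
    ¬ HasLogOn (fun z => q z - x) (roundAnnulus r R) := by
  intro hl
  obtain ⟨g, hg⟩ := isBiholo_of_bijOn (isOpen_roundAnnulus _ _) hq hqb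
  apply h.not_hasLogOn hx
  refine (hl.comp hg.diff_inv.continuousOn hg.mapsTo_inv).congr fun w hw => ?_
  rw [hg.right_inv w hw]

theorem IsRing.not_hasLogOn_sub_sphere (h : IsRing Ω K L)
    (hq : DifferentiableOn ℂ q (roundAnnulus r R))
    (hqb : BijOn q (roundAnnulus r R) Ω) {x : ℂ} (hx : x ∈ K) {s : ℝ} (hs : 0 < s)
    (h1 : r < ENNReal.ofReal s) (h2 : ENNReal.ofReal s < R) :
    ¬ HasLogOn (fun z => q z - x) (sphere 0 s) := fun hl =>
  h.not_hasLogOn_sub hq hqb hx (hl.of_sphere hs h1 h2 (hq.sub_const x)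
    (sub_ne_zero_of_mapsTo hqb.mapsTo (h.notMem_of_mem_inner hx)))

theorem IsRing.hasLogOn_sub (h : IsRing Ω K L) (hrR : r < R)
    (hq : DifferentiableOn ℂ q (roundAnnulus r R))
    (hqb : BijOn q (roundAnnulus r R) Ω) {y : ℂ} (hy : y ∈ L) :
    HasLogOn (fun z => q z - y) (roundAnnulus r R) := by
  obtain ⟨s, hs, h1, h2⟩ := exists_circle hrR
  have hsub := sphere_subset_roundAnnulus h1 h2
  have hc : ContinuousOn q (sphere 0 s) := hq.continuousOn.mono hsub
  refine HasLogOn.of_sphere hs h1 h2 (hq.sub_const y)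
    (sub_ne_zero_of_mapsTo hqb.mapsTo (h.notMem_of_mem_outer hy)) ?_
  have hd : Disjoint (q '' sphere 0 s) L := by
    rw [Set.disjoint_left]
    rintro _ ⟨z, hz, rfl⟩ hL
    exact h.notMem_of_mem_outer hL (hqb.mapsTo (hsub hz))
  exact (HasLogOn.sub_of_noCompactPiece ((isCompact_sphere 0 s).image_of_continuousOn hc) h.isClosed
    h.noCompactPiece hd hy).comp hc (mapsTo_image _ _)

/-- A ring of modulus greater than `m` contains an essential conformal image of the standard annulus
of modulus `m`. -/
theorem IsRing.exists_standard_annulus (h : IsRing Ω K L)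
    (hq : DifferentiableOn ℂ q (roundAnnulus r R)) (hqb : BijOn q (roundAnnulus r R) Ω) {m : ℝ≥0∞}
    (hm0 : 0 < m) (hm : m < roundModulus r R) :
    ∃ p : ℂ → ℂ, DifferentiableOn ℂ p (roundAnnulus 1 (outerRadius m)) ∧
      InjOn p (roundAnnulus 1 (outerRadius m)) ∧
      MapsTo p (roundAnnulus 1 (outerRadius m)) Ω ∧
      (∀ x ∈ K, ¬ HasLogOn (fun z => p z - x) (roundAnnulus 1 (outerRadius m))) ∧
      ∀ y ∈ L, HasLogOn (fun z => p z - y) (roundAnnulus 1 (outerRadius m)) := by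
  rw [outerRadius]
  obtain ⟨a, b, ha, hab, hra, hbR, hme, hlt⟩ := exists_lt_roundModulus hm
  have hb := ha.trans hab
  set ρ : ℝ := Real.exp (2 * Real.pi * m.toReal) with hρ
  have hm' : 0 < m.toReal := ENNReal.toReal_pos hm0.ne' hm.ne_top
  have hρ1 : 1 < ρ := Real.one_lt_exp_iff.2 (by have := Real.pi_pos; positivity)
  have hab' : a * ρ < b := by
    rw [Real.lt_log_iff_exp_lt (by positivity), lt_div_iff₀ ha] at hlt
    linarith
  have hmem : ∀ z ∈ roundAnnulus 1 (ENNReal.ofReal ρ), (a : ℂ) * z ∈ roundAnnulus r R := by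
    intro z hz
    rw [← ENNReal.ofReal_one, mem_roundAnnulus_ofReal zero_le_one] at hz
    have h1 : (a : ℂ) * z ∈ roundAnnulus (ENNReal.ofReal a) (ENNReal.ofReal b) := by
      rw [mem_roundAnnulus_ofReal ha.le, norm_mul, norm_real, Real.norm_of_nonneg ha.le]
      constructor <;> nlinarith
    exact ⟨hra.trans h1.1, h1.2.trans hbR⟩
  have hac : (a : ℂ) ≠ 0 := ofReal_ne_zero.2 ha.ne'
  -- Rescaling by `a` puts the domain in standard position, so that one domain depending only on `m`
  -- serves for all rings and normal family arguments apply.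
  refine ⟨fun z => q (a * z), hq.comp (by fun_prop) hmem, fun z hz w hw hzw => ?_,
    fun z hz => hqb.mapsTo (hmem z hz), fun x hx hl => ?_, fun y hy => ?_⟩
  · exact mul_left_cancel₀ hac (hqb.injOn (hmem z hz) (hmem w hw) hzw)
  · obtain ⟨s, hs1, hs2⟩ := exists_between hρ1
    have hs0 : 0 < s := zero_lt_one.trans hs1
    have hsub : sphere (0 : ℂ) s ⊆ roundAnnulus 1 (ENNReal.ofReal ρ) := by
      apply sphere_subset_roundAnnulus
      · rwa [← ENNReal.ofReal_one, ENNReal.ofReal_lt_ofReal_iff_of_nonneg zero_le_one]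
      · rwa [ENNReal.ofReal_lt_ofReal_iff_of_nonneg hs0.le]
    have h3 : ENNReal.ofReal a < ENNReal.ofReal (a * s) := by
      rw [ENNReal.ofReal_lt_ofReal_iff_of_nonneg ha.le]; nlinarith
    have h4 : ENNReal.ofReal (a * s) < ENNReal.ofReal b := by
      rw [ENNReal.ofReal_lt_ofReal_iff_of_nonneg (by positivity)]; nlinarith
    refine h.not_hasLogOn_sub_sphere hq hqb hx (s := a * s) (by positivity) (hra.trans h3)
      (h4.trans hbR) ?_
    refine (hl.comp (f := fun z : ℂ => (a : ℂ)⁻¹ * z) (S' := sphere 0 (a * s)) (by fun_prop)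
      fun z hz => hsub ?_).congr fun z hz => ?_
    · rw [mem_sphere_zero_iff_norm] at hz ⊢
      rw [norm_mul, norm_inv, norm_real, Real.norm_of_nonneg ha.le, hz]
      field_simp
    · simp only [mul_inv_cancel_left₀ hac]
  · have hrR : r < R := by
      have h3 : ENNReal.ofReal a < ENNReal.ofReal b :=
        (ENNReal.ofReal_lt_ofReal_iff_of_nonneg ha.le).2 hab
      exact hra.trans (h3.trans hbR)
    exact (h.hasLogOn_sub hrR hq hqb hy).comp (f := fun z => (a : ℂ) * z) (by fun_prop) hmem

end Ring

/-! ### Limits of univalent maps of annuli -/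

theorem eventually_hasLogOn_div {ι X : Type*} [TopologicalSpace X] {l : Filter ι} {S : Set X}
    (hS : IsCompact S) {u : ι → X → ℂ} {v : X → ℂ} (h : TendstoUniformlyOn u v l S)
    (hu : ∀ᶠ i in l, ContinuousOn (u i) S) (hv : ContinuousOn v S) (h0 : ∀ z ∈ S, v z ≠ 0) :
    ∀ᶠ i in l, HasLogOn (fun z => u i z / v z) S := by
  obtain ⟨δ, hδ, hδv⟩ : ∃ δ > 0, ∀ z ∈ S, δ ≤ ‖v z‖ := by
    rcases S.eq_empty_or_nonempty with rfl | hne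
    · exact ⟨1, one_pos, by simp⟩
    · obtain ⟨z, hz, hmin⟩ := hS.exists_isMinOn hne hv.norm
      exact ⟨‖v z‖, norm_pos_iff.2 (h0 z hz), fun w hw => hmin hw⟩
  filter_upwards [Metric.tendstoUniformlyOn_iff.1 h δ hδ, hu] with i hi hui
  refine HasLogOn.of_norm_sub_one_lt (hui.div hv h0) fun z hz => ?_
  have h1 := hi z hz
  have h2 := h0 z hz
  have e : u i z / v z - 1 = (u i z - v z) / v z := by field_simp
  rw [e, norm_div, div_lt_one (norm_pos_iff.2 h2)]
  rw [dist_comm, dist_eq_norm] at h1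
  exact h1.trans_le (hδv z hz)

/-- On a compact set a zero-free limit is bounded away from `0`, so the quotients tend uniformly to
`1` and eventually have logarithms: winding is continuous. -/
theorem eventually_hasLogOn_iff {ι X : Type*} [TopologicalSpace X] {l : Filter ι} {S : Set X}
    (hS : IsCompact S) {u : ι → X → ℂ} {v : X → ℂ} (h : TendstoUniformlyOn u v l S)
    (hu : ∀ᶠ i in l, ContinuousOn (u i) S) (hv : ContinuousOn v S) (h0 : ∀ z ∈ S, v z ≠ 0) :
    ∀ᶠ i in l, (HasLogOn (u i) S ↔ HasLogOn v S) :=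
  (eventually_hasLogOn_div hS h hu hv h0).mono fun _ hi => hi.div_iff h0

theorem exists_harnack_constant_of_isCompact {U S : Set ℂ} (hU : IsOpen U) (hUc : IsPreconnected U)
    {z₀ : ℂ} (hz₀ : z₀ ∈ U) (hS : IsCompact S) (hSU : S ⊆ U) :
    ∃ C > 0, ∀ f : ℂ → ℂ, DifferentiableOn ℂ f U → InjOn f U →
      (∀ w ∈ U, f w ≠ 0) → ∀ w ∈ S, ‖f z₀‖ ≤ C * ‖f w‖ := by
  refine hS.induction_on (p := fun S => ∃ C > 0, ∀ f : ℂ → ℂ, DifferentiableOn ℂ f U → InjOn f U →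
      (∀ w ∈ U, f w ≠ 0) → ∀ w ∈ S, ‖f z₀‖ ≤ C * ‖f w‖) ⟨1, one_pos, by simp⟩ ?_ ?_ ?_
  · rintro s t hst ⟨C, hC, h⟩
    exact ⟨C, hC, fun f h1 h2 h3 w hw => h f h1 h2 h3 w (hst hw)⟩
  · rintro s t ⟨C, hC, h⟩ ⟨D, hD, h'⟩
    refine ⟨C + D, by positivity, fun f h1 h2 h3 w hw => ?_⟩
    have := norm_nonneg (f w)
    rcases hw with hw | hw
    · have := h f h1 h2 h3 w hw
      nlinarith
    · have := h' f h1 h2 h3 w hw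
      nlinarith
  · intro z hz
    obtain ⟨r, hr, C, hC, h⟩ := exists_harnack_constant hU hUc hz₀ (hSU hz)
    exact ⟨ball z r, mem_nhdsWithin_of_mem_nhds (ball_mem_nhds z hr), C, hC,
      fun f h1 h2 h3 w hw => (h f h1 h2 h3 w hw).2⟩

theorem tendstoLocallyUniformlyOn_sub {ι : Type*} {l : Filter ι} {U : Set ℂ} {F : ι → ℂ → ℂ}
    {f : ℂ → ℂ} (h : TendstoLocallyUniformlyOn F f l U) {c : ι → ℂ} {c₀ : ℂ}
    (hc : Tendsto c l (𝓝 c₀)) :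
    TendstoLocallyUniformlyOn (fun i z => F i z - c i) (fun z => f z - c₀) l U := by
  have := h.sub (tendstoLocallyUniformlyOn_of_tendsto hc U)
  exact this

section Limit
variable {ι : Type*} {𝒰 : Ultrafilter ι} {r R : ℝ≥0∞} {q : ι → ℂ → ℂ}

/-- A family of univalent functions on an annulus that separate two convergent sequences of points
from a third one has a nonconstant limit. -/
theorem exists_limit_of_separating (hrR : r < R)
    (hd : ∀ᶠ i in 𝒰, DifferentiableOn ℂ (q i) (roundAnnulus r R))
    (hi : ∀ᶠ i in 𝒰, InjOn (q i) (roundAnnulus r R))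
    {x x' y : ι → ℂ} {x₀ x₀' y₀ : ℂ} (hx : Tendsto x 𝒰 (𝓝 x₀)) (hx' : Tendsto x' 𝒰 (𝓝 x₀'))
    (hy : Tendsto y 𝒰 (𝓝 y₀)) (hne : x₀ ≠ x₀')
    (hqx : ∀ᶠ i in 𝒰, ∀ z ∈ roundAnnulus r R, q i z - x i ≠ 0)
    (hqx' : ∀ᶠ i in 𝒰, ∀ z ∈ roundAnnulus r R, q i z - x' i ≠ 0)
    (hlx : ∀ᶠ i in 𝒰, ¬ HasLogOn (fun z => q i z - x i) (roundAnnulus r R))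
    (hlx' : ∀ᶠ i in 𝒰, ¬ HasLogOn (fun z => q i z - x' i) (roundAnnulus r R))
    (hly : ∀ᶠ i in 𝒰, HasLogOn (fun z => q i z - y i) (roundAnnulus r R)) :
    ∃ f : ℂ → ℂ, TendstoLocallyUniformlyOn q f 𝒰 (roundAnnulus r R) ∧
      DifferentiableOn ℂ f (roundAnnulus r R) ∧ ∀ c, ∃ z ∈ roundAnnulus r R, f z ≠ c := by
  obtain ⟨s, hs, h1, h2⟩ := exists_circle hrR
  have hsub := sphere_subset_roundAnnulus h1 h2
  have hAo := isOpen_roundAnnulus r R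
  have hAc := (isConnected_roundAnnulus hrR).isPreconnected
  have hSc : IsCompact (sphere (0 : ℂ) s) := isCompact_sphere 0 s
  have hz₀ : (s : ℂ) ∈ roundAnnulus r R := hsub (by simp [hs.le])
  have hvd : ∀ᶠ i in 𝒰, DifferentiableOn ℂ (fun z => q i z - x i) (roundAnnulus r R) :=
    hd.mono fun i h => h.sub_const _
  have hvi : ∀ᶠ i in 𝒰, InjOn (fun z => q i z - x i) (roundAnnulus r R) :=
    hi.mono fun i h z hz w hw hzw => h hz hw (sub_left_injective hzw)
  -- Otherwise Harnack makes `q i - x i` large compared with `x i - y i` on the whole circle; then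
  -- `(q i - y i) / (q i - x i)` is near `1`, and `q i - x i` would have a logarithm because `q i -
  -- y i` does.
  have hbdd : ∃ M : ℝ, ∀ᶠ i in 𝒰, ‖q i s - x i‖ ≤ M := by
    by_contra! hcon
    obtain ⟨C, hC, hH⟩ := exists_harnack_constant_of_isCompact hAo hAc hz₀ hSc hsub
    have hxy : ∀ᶠ i in 𝒰, ‖x i - y i‖ < ‖x₀ - y₀‖ + 1 :=
      (hx.sub hy).norm.eventually (gt_mem_nhds (lt_add_one _))
    have hlarge := hcon (C * (‖x₀ - y₀‖ + 1))
    obtain ⟨i, hdi, hii, hqi, hli, hlyi, hxyi, hlargei⟩ :=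
      (hvd.and (hvi.and (hqx.and (hlx.and (hly.and (hxy.and hlarge)))))).exists
    apply hli
    refine HasLogOn.of_sphere hs h1 h2 hdi hqi ?_
    have hy0 : ∀ z ∈ sphere (0 : ℂ) s, q i z - x i ≠ 0 := fun z hz => hqi z (hsub hz)
    refine (HasLogOn.div_iff (u := fun z => q i z - y i) (v := fun z => q i z - x i) ?_ hy0).1
      (hlyi.mono hsub)
    have hc := hdi.continuousOn.mono hsub
    refine HasLogOn.of_norm_sub_one_lt (ContinuousOn.div ?_ hc hy0) fun z hz => ?_
    · have : ContinuousOn (fun z => (q i z - x i) + (x i - y i)) (sphere 0 s) :=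
        hc.add continuousOn_const
      simpa using this
    · have h3 := hH _ hdi hii hqi z hz
      have h4 := hy0 z hz
      have e : (q i z - y i) / (q i z - x i) - 1 = (x i - y i) / (q i z - x i) := by
        field_simp; ring
      rw [e, norm_div, div_lt_one (norm_pos_iff.2 h4)]
      have h5 := hlargei.trans_le h3
      exact hxyi.trans (lt_of_mul_lt_mul_left h5 hC.le)
  obtain ⟨M, hM⟩ := hbdd
  obtain ⟨v, hv, hvdiff⟩ := exists_tendstoLocallyUniformlyOn 𝒰 hAo
    (F := fun i z => q i z - x i) (by
      intro z hz
      obtain ⟨ρ, hρ, C, hC, hH⟩ := exists_harnack_constant hAo hAc hz₀ hz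
      obtain ⟨ε, hε, hb⟩ := Metric.isOpen_iff.1 hAo z hz
      refine ⟨min ρ ε, lt_min hρ hε, C * M, ?_⟩
      filter_upwards [hvd, hvi, hqx, hM] with i hdi hii hqi hMi
      refine ⟨hdi.mono ((ball_subset_ball (min_le_right _ _)).trans hb), fun w hw => ?_⟩
      exact ((hH _ hdi hii hqi w (ball_subset_ball (min_le_left _ _) hw)).1).trans (by gcongr))
  have hq : TendstoLocallyUniformlyOn q (fun z => v z + x₀) 𝒰 (roundAnnulus r R) := by
    have := tendstoLocallyUniformlyOn_sub hv hx.neg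
    simpa using this
  refine ⟨_, hq, hvdiff.add_const _, fun c => ?_⟩
  by_contra! hcon
  -- A constant limit `c ≠ p₀` would make `q i - p i` uniformly close to a nonzero constant on a
  -- circle, which destroys the winding. So `c` would equal both `x₀` and `x₀'`.
  have key : ∀ (p : ι → ℂ) (p₀ : ℂ), Tendsto p 𝒰 (𝓝 p₀) →
      (∀ᶠ i in 𝒰, ∀ z ∈ roundAnnulus r R, q i z - p i ≠ 0) →
      (∀ᶠ i in 𝒰, ¬ HasLogOn (fun z => q i z - p i) (roundAnnulus r R)) → c = p₀ := by
    intro p p₀ hp hqp hlp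
    by_contra hne
    have h3 := tendstoLocallyUniformlyOn_sub hq hp
    have h4 := (tendstoLocallyUniformlyOn_iff_forall_isCompact hAo).1 h3 _ hsub hSc
    have h5 := eventually_hasLogOn_iff hSc h4
      (hd.mono fun i h => (h.sub_const _).continuousOn.mono hsub)
      ((hvdiff.add_const x₀).sub_const p₀ |>.continuousOn.mono hsub)
      (fun z hz => by rw [hcon z (hsub hz)]; exact sub_ne_zero.2 hne)
    obtain ⟨i, h5i, hqi, hli, hdi⟩ := (h5.and (hqp.and (hlp.and hd))).exists
    apply hli
    refine HasLogOn.of_sphere hs h1 h2 (hdi.sub_const _) hqi (h5i.2 ?_)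
    refine (HasLogOn.const (sub_ne_zero.2 hne) _).congr fun z hz => ?_
    rw [hcon z (hsub hz)]
  exact hne ((key x x₀ hx hqx hlx).symm.trans (key x' x₀' hx' hqx' hlx'))

/-- The nonconstant limit of nonvanishing differences does not vanish, and winds around `0` as they
do. -/
theorem limit_sub_ne_zero_and_hasLogOn (hrR : r < R) {f : ℂ → ℂ}
    (hq : TendstoLocallyUniformlyOn q f 𝒰 (roundAnnulus r R))
    (hf : DifferentiableOn ℂ f (roundAnnulus r R)) (hnc : ∀ c, ∃ z ∈ roundAnnulus r R, f z ≠ c)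
    (hd : ∀ᶠ i in 𝒰, DifferentiableOn ℂ (q i) (roundAnnulus r R))
    {p : ι → ℂ} {p₀ : ℂ} (hp : Tendsto p 𝒰 (𝓝 p₀))
    (hqp : ∀ᶠ i in 𝒰, ∀ z ∈ roundAnnulus r R, q i z - p i ≠ 0) :
    (∀ z ∈ roundAnnulus r R, f z - p₀ ≠ 0) ∧
      ∀ᶠ i in 𝒰, (HasLogOn (fun z => q i z - p i) (roundAnnulus r R) ↔
        HasLogOn (fun z => f z - p₀) (roundAnnulus r R)) := by
  obtain ⟨s, hs, h1, h2⟩ := exists_circle hrR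
  have hsub := sphere_subset_roundAnnulus h1 h2
  have hAo := isOpen_roundAnnulus r R
  have hSc : IsCompact (sphere (0 : ℂ) s) := isCompact_sphere 0 s
  have h3 := tendstoLocallyUniformlyOn_sub hq hp
  obtain ⟨z₁, hz₁, hne⟩ := hnc p₀
  have h0 := ne_zero_of_tendstoLocallyUniformlyOn hAo (isConnected_roundAnnulus hrR).isPreconnected
    h3 (hd.mono fun i h => h.sub_const _) hqp hz₁ (sub_ne_zero.2 hne)
  refine ⟨h0, ?_⟩
  have h4 := (tendstoLocallyUniformlyOn_iff_forall_isCompact hAo).1 h3 _ hsub hSc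
  have h5 := eventually_hasLogOn_iff hSc h4
    (hd.mono fun i h => (h.sub_const _).continuousOn.mono hsub)
    ((hf.sub_const p₀).continuousOn.mono hsub) (fun z hz => h0 z (hsub hz))
  filter_upwards [h5, hd, hqp] with i hi hdi hqi
  exact ⟨fun h => (hi.1 (h.mono hsub)).of_sphere hs h1 h2 (hf.sub_const p₀) h0,
    fun h => (hi.2 (h.mono hsub)).of_sphere hs h1 h2 (hdi.sub_const _) hqi⟩

end Limit

/-! ### Charts of the sphere with a pole in the plane -/

/-- The chart `z ↦ c + 1 / z` of the Riemann sphere, whose range is the complement of `c`. -/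
noncomputable def invChart (c z : ℂ) : RiemannSphere :=
  if z = 0 then OnePoint.infty else ((c + z⁻¹ : ℂ) : RiemannSphere)

/-- The inverse `w ↦ 1 / (w - c)` of `invChart c`. -/
noncomputable def invCoord (c : ℂ) : RiemannSphere → ℂ
  | OnePoint.infty => 0
  | OnePoint.some w => (w - c)⁻¹

@[simp] theorem invCoord_infty (c : ℂ) : invCoord c OnePoint.infty = 0 := rfl

@[simp] theorem invCoord_coe (c w : ℂ) : invCoord c (w : RiemannSphere) = (w - c)⁻¹ := rfl

theorem invCoord_invChart (c z : ℂ) : invCoord c (invChart c z) = z := by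
  rw [invChart]
  split_ifs with h
  · simp [h]
  · simp

theorem invChart_invCoord {c : ℂ} {w : RiemannSphere} (hw : w ≠ (c : RiemannSphere)) :
    invChart c (invCoord c w) = w := by
  induction w using OnePoint.rec with
  | infty => simp [invChart]
  | coe w =>
    have h : w - c ≠ 0 := fun h => hw (by rw [sub_eq_zero.1 h])
    simp [invChart, h]

theorem invChart_ne (c z : ℂ) : invChart c z ≠ (c : RiemannSphere) := by
  rw [invChart]
  split_ifs with h
  · exact OnePoint.infty_ne_coe c
  · rw [Ne, OnePoint.coe_eq_coe]
    simpa using h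

theorem range_invChart (c : ℂ) : range (invChart c) = {(c : RiemannSphere)}ᶜ := by
  ext w
  exact ⟨by rintro ⟨z, rfl⟩; exact invChart_ne c z, fun hw => ⟨_, invChart_invCoord hw⟩⟩

theorem invChart_injective (c : ℂ) : Function.Injective (invChart c) :=
  Function.LeftInverse.injective (invCoord_invChart c)

theorem coclosedCompact_eq_cobounded : coclosedCompact ℂ = Bornology.cobounded ℂ := by
  rw [coclosedCompact_eq_cocompact, Metric.cobounded_eq_cocompact]

theorem continuous_invChart (c : ℂ) : Continuous (invChart c) := by
  rw [continuous_iff_continuousAt]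
  intro z
  by_cases hz : z = 0
  · subst hz
    rw [continuousAt_iff_punctured_nhds]
    have h0 : invChart c 0 = OnePoint.infty := by simp [invChart]
    rw [h0]
    have h1 : Tendsto (fun z : ℂ => c + z⁻¹) (𝓝[≠] 0) (coclosedCompact ℂ) := by
      rw [coclosedCompact_eq_cocompact]
      refine (Homeomorph.addLeft c).isClosedEmbedding.tendsto_cocompact.comp ?_
      rw [← Metric.cobounded_eq_cocompact]
      exact Filter.tendsto_inv₀_nhdsNE_zero
    refine (OnePoint.tendsto_coe_infty.comp h1).congr' ?_
    filter_upwards [self_mem_nhdsWithin] with w hw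
    have hw : w ≠ 0 := hw
    simp [invChart, hw]
  · have h1 : ContinuousAt (fun z : ℂ => ((c + z⁻¹ : ℂ) : RiemannSphere)) z :=
      OnePoint.continuous_coe.continuousAt.comp (continuousAt_const.add (continuousAt_inv₀ hz))
    refine h1.congr ?_
    filter_upwards [isOpen_ne.mem_nhds hz] with w hw
    simp [invChart, hw]

theorem continuousAt_invCoord {c : ℂ} {w : RiemannSphere} (hw : w ≠ (c : RiemannSphere)) :
    ContinuousAt (invCoord c) w := by
  induction w using OnePoint.rec with
  | infty =>
    rw [OnePoint.continuousAt_infty', coclosedCompact_eq_cocompact]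
    refine Filter.tendsto_inv₀_cobounded.comp ?_
    rw [Metric.cobounded_eq_cocompact]
    exact (Homeomorph.subRight c).isClosedEmbedding.tendsto_cocompact
  | coe w =>
    have h : w - c ≠ 0 := fun h => hw (by rw [sub_eq_zero.1 h])
    rw [OnePoint.continuousAt_coe]
    change ContinuousAt (fun w : ℂ => (w - c)⁻¹) w
    exact ContinuousAt.inv₀ (by fun_prop) h

theorem isOpenEmbedding_invChart (c : ℂ) : IsOpenEmbedding (invChart c) := by
  refine .of_continuous_injective_isOpenMap (continuous_invChart c) (invChart_injective c) ?_
  intro U hU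
  have h1 : IsOpen ({(c : RiemannSphere)}ᶜ ∩ invCoord c ⁻¹' U) :=
    ContinuousOn.isOpen_inter_preimage
      (fun w hw => (continuousAt_invCoord hw).continuousWithinAt) isOpen_compl_singleton hU
  convert h1 using 1
  ext w
  constructor
  · rintro ⟨z, hz, rfl⟩
    exact ⟨invChart_ne c z, by rwa [mem_preimage, invCoord_invChart]⟩
  · rintro ⟨hw, hwU⟩
    exact ⟨_, hwU, invChart_invCoord hw⟩

theorem image_preimage_invChart {c : ℂ} {S : Set RiemannSphere} (hS : (c : RiemannSphere) ∉ S) :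
    invChart c '' (invChart c ⁻¹' S) = S := by
  rw [image_preimage_eq_inter_range, range_invChart, inter_eq_left]
  exact fun w hw h => hS (h ▸ hw)

theorem isConnected_preimage_invChart {c : ℂ} {S : Set RiemannSphere}
    (hS : (c : RiemannSphere) ∉ S) (h : IsConnected S) : IsConnected (invChart c ⁻¹' S) := by
  refine ⟨?_, ?_⟩
  · rw [← image_nonempty (f := invChart c), image_preimage_invChart hS]
    exact h.nonempty
  · rw [← (isOpenEmbedding_invChart c).isInducing.isPreconnected_image, image_preimage_invChart hS]
    exact h.isPreconnected

/-- The sets of the planar picture of a decomposition of the sphere into a domain and two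
continua. -/
theorem isRing_preimage_invChart {A B C : Set RiemannSphere} (hA : IsOpen A) (hAc : IsConnected A)
    (hB : IsClosed B) (hBc : IsConnected B) (hC : IsClosed C) (hCc : IsConnected C)
    (hABC : Aᶜ = B ∪ C) (hBC : Disjoint B C) {c : ℂ} (hc : (c : RiemannSphere) ∈ C) :
    IsRing (invChart c ⁻¹' A) (invChart c ⁻¹' B) (invChart c ⁻¹' C) := by
  have hcB : (c : RiemannSphere) ∉ B := fun h => Set.disjoint_left.1 hBC h hc
  have hcA : (c : RiemannSphere) ∉ A := fun h => (hABC ▸ Or.inr hc : (c : RiemannSphere) ∈ Aᶜ) h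
  have hθ := continuous_invChart c
  refine ⟨hA.preimage hθ, isConnected_preimage_invChart hcA hAc, ?_,
    isConnected_preimage_invChart hcB hBc, hC.preimage hθ, ?_, ?_, hBC.preimage _⟩
  · refine (isOpenEmbedding_invChart c).isInducing.isCompact_preimage' hB.isCompact ?_
    rw [range_invChart]
    exact fun w hw h => hcB (h ▸ hw)
  · intro Q O hQ hO hQO
    by_contra hne
    obtain ⟨z, hz⟩ := nonempty_iff_ne_empty.2 hne
    have ho := (isOpenEmbedding_invChart c).isOpenMap O hO
    have hQc := (hQ.image hθ).isClosed
    have h1 : C ∩ invChart c '' O = C ∩ invChart c '' Q := by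
      ext w
      constructor
      · rintro ⟨hw, u, hu, rfl⟩
        exact ⟨hw, u, hQO ▸ ⟨hw, hu⟩, rfl⟩
      · rintro ⟨hw, u, hu, rfl⟩
        rw [← hQO] at hu
        exact ⟨hw, u, hu.2, rfl⟩
    rw [← hQO] at hz
    obtain ⟨u, -, hu⟩ := subset_of_relatively_clopen hCc.isPreconnected ho hQc h1
      ⟨invChart c z, hz.1, z, hz.2, rfl⟩ hc
    exact invChart_ne c u hu
  · rw [← preimage_compl, hABC, preimage_union]

theorem holomorphicOn_invChart_comp (c : ℂ) {q : ℂ → ℂ} {U : Set ℂ} (hU : IsOpen U)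
    (hq : DifferentiableOn ℂ q U) : HolomorphicOn (fun z => invChart c (q z)) U := by
  refine ⟨(continuous_invChart c).comp_continuousOn hq.continuousOn, fun z hz => ⟨fun h => ?_,
    fun h => ?_⟩⟩
  · have hqz : DifferentiableAt ℂ q z := hq.differentiableAt (hU.mem_nhds hz)
    have h0 : q z ≠ 0 := by
      intro h0
      apply h
      simp [invChart, h0]
    have h1 : DifferentiableAt ℂ (fun w => c + (q w)⁻¹) z := (hqz.inv h0).const_add c
    refine h1.congr_of_eventuallyEq ?_
    filter_upwards [hqz.continuousAt.eventually_ne h0] with w hw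
    simp [invChart, hw, affineCoord]
  · have hqz : DifferentiableAt ℂ q z := hq.differentiableAt (hU.mem_nhds hz)
    have e : ∀ x : ℂ, inftyCoord (invChart c x) = x / (c * x + 1) := by
      intro x
      by_cases hx : x = 0
      · simp [invChart, hx, inftyCoord]
      · simp only [invChart, hx, if_false, inftyCoord]
        rw [← inv_div]
        congr 1
        field_simp
    have h0 : c * q z + 1 ≠ 0 := by
      intro h0
      have hx : q z ≠ 0 := by
        rintro hx
        simp [hx] at h0
      apply h
      simp only [invChart, hx, if_false]
      congr 1
      field_simp
      simpa using h0
    simp only [e]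
    exact hqz.div ((hqz.const_mul c).add_const 1) h0

theorem differentiableOn_invCoord_comp {c : ℂ} {f : ℂ → RiemannSphere} {U : Set ℂ} (hU : IsOpen U)
    (hf : HolomorphicOn f U) (hc : ∀ z ∈ U, f z ≠ (c : RiemannSphere)) :
    DifferentiableOn ℂ (fun z => invCoord c (f z)) U := by
  intro z hz
  apply DifferentiableAt.differentiableWithinAt
  have hfc : ContinuousAt f z := hf.1.continuousAt (hU.mem_nhds hz)
  obtain ⟨h1, h2⟩ := hf.2 z hz
  by_cases hinf : f z = OnePoint.infty
  · have h0 : f z ≠ ((0 : ℂ) : RiemannSphere) := by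
      rw [hinf]
      exact OnePoint.infty_ne_coe 0
    have h3 := h2 h0
    have e : ∀ w : RiemannSphere, w ≠ ((0 : ℂ) : RiemannSphere) →
        invCoord c w = inftyCoord w / (1 - c * inftyCoord w) := by
      intro w hw
      induction w using OnePoint.rec with
      | infty => simp [inftyCoord]
      | coe w =>
        have hw0 : w ≠ 0 := fun h => hw (by rw [h])
        simp only [invCoord_coe, inftyCoord]
        rw [← inv_div]
        congr 1
        field_simp
    have h4 : 1 - c * inftyCoord (f z) ≠ 0 := by rw [hinf]; simp [inftyCoord]
    refine (h3.div ((h3.const_mul c).const_sub 1) h4).congr_of_eventuallyEq ?_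
    filter_upwards [hfc.eventually_ne h0] with w hw using e _ hw
  · have h3 := h1 hinf
    have e : ∀ w : RiemannSphere, w ≠ OnePoint.infty → invCoord c w = (affineCoord w - c)⁻¹ := by
      intro w hw
      induction w using OnePoint.rec with
      | infty => exact absurd rfl hw
      | coe w => simp [affineCoord]
    have h4 : affineCoord (f z) - c ≠ 0 := by
      intro h4
      have h5 := hc z hz
      generalize f z = w at *
      induction w using OnePoint.rec with
      | infty => exact hinf rfl
      | coe w => exact h5 (by rw [sub_eq_zero.1 h4 |>.symm]; rfl)
    refine ((h3.sub_const c).inv h4).congr_of_eventuallyEq ?_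
    filter_upwards [hfc.eventually_ne hinf] with w hw using e _ hw

theorem isConformalIso_invChart_comp {c : ℂ} {q : ℂ → ℂ} {U : Set ℂ} {A : Set RiemannSphere}
    (hU : IsOpen U) (hc : (c : RiemannSphere) ∉ A) (hq : DifferentiableOn ℂ q U)
    (hb : BijOn q U (invChart c ⁻¹' A)) : IsConformalIso (fun z => invChart c (q z)) U A := by
  refine ⟨holomorphicOn_invChart_comp c hU hq, fun z hz => hb.mapsTo hz,
    fun z hz w hw hzw => hb.injOn hz hw (invChart_injective c hzw), fun w hw => ?_⟩
  have hwc : w ≠ (c : RiemannSphere) := fun h => hc (h ▸ hw)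
  obtain ⟨z, hz, hzw⟩ := hb.surjOn (show invCoord c w ∈ invChart c ⁻¹' A by
    rwa [mem_preimage, invChart_invCoord hwc])
  exact ⟨z, hz, by simp only [hzw, invChart_invCoord hwc]⟩

theorem bijOn_invCoord_comp {c : ℂ} {f : ℂ → RiemannSphere} {U : Set ℂ} {A : Set RiemannSphere}
    (hc : (c : RiemannSphere) ∉ A) (hb : BijOn f U A) :
    BijOn (fun z => invCoord c (f z)) U (invChart c ⁻¹' A) := by
  have hne : ∀ z ∈ U, f z ≠ (c : RiemannSphere) := fun z hz h => hc (h ▸ hb.mapsTo hz)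
  refine ⟨fun z hz => ?_, fun z hz w hw hzw => hb.injOn hz hw ?_, fun w hw => ?_⟩
  · rw [mem_preimage, invChart_invCoord (hne z hz)]
    exact hb.mapsTo hz
  · rw [← invChart_invCoord (hne z hz), ← invChart_invCoord (hne w hw)]
    exact congrArg _ hzw
  · obtain ⟨z, hz, hzw⟩ := hb.surjOn hw
    exact ⟨z, hz, by simp only [hzw, invCoord_invChart]⟩

/-- A planar uniformization computes the modulus. -/
theorem modulus_eq_roundModulus {A : Set RiemannSphere} {c : ℂ} (hc : (c : RiemannSphere) ∉ A)
    {K L : Set ℂ} (h : IsRing (invChart c ⁻¹' A) K L) {r R : ℝ≥0∞} (hrR : r < R) {q : ℂ → ℂ}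
    (hq : DifferentiableOn ℂ q (roundAnnulus r R))
    (hqb : BijOn q (roundAnnulus r R) (invChart c ⁻¹' A)) : modulus A = roundModulus r R := by
  obtain ⟨x, hx⟩ := h.isConnected_inner.nonempty
  have hxA := h.notMem_of_mem_inner hx
  apply le_antisymm
  · refine sSup_le ?_
    -- Any other uniformization, read in the chart, is an essential map into the same ring, so
    -- monotonicity bounds its modulus.
    rintro _ ⟨r', R', -, ⟨f, hf, hfb⟩, rfl⟩
    have hd := differentiableOn_invCoord_comp (isOpen_roundAnnulus r' R') hf
      (fun z hz h => hc (h ▸ hfb.mapsTo hz))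
    have hb := bijOn_invCoord_comp hc hfb
    exact roundModulus_le_of_mapsTo hxA hq hqb hd hb.mapsTo (h.not_hasLogOn_sub hd hb hx)
  · exact le_sSup ⟨r, R, hrR, ⟨_, isConformalIso_invChart_comp (isOpen_roundAnnulus r R) hc hq hqb⟩,
      rfl⟩

/-! ### The chordal metric and Hausdorff limits -/

theorem continuous_toUnitSphere : Continuous toUnitSphere := by
  have hden : ∀ z : ℂ, (1 + ‖z‖ ^ 2) ≠ 0 := fun z => by positivity
  have hcomp : ∀ j, Continuous fun w => toUnitSphere w j := by
    have hinv : Tendsto (fun z : ℂ => 2 / ‖z‖) (Bornology.cobounded ℂ) (𝓝 0) :=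
      tendsto_const_nhds.div_atTop tendsto_norm_cobounded_atTop
    have hinv2 : Tendsto (fun z : ℂ => 2 / ‖z‖ ^ 2) (Bornology.cobounded ℂ) (𝓝 0) :=
      tendsto_const_nhds.div_atTop
        ((tendsto_pow_atTop two_ne_zero).comp tendsto_norm_cobounded_atTop)
    have hpos : ∀ᶠ z : ℂ in Bornology.cobounded ℂ, 0 < ‖z‖ :=
      tendsto_norm_cobounded_atTop.eventually_gt_atTop 0
    have hbd : ∀ t x : ℝ, 0 < x → |t| ≤ x → |2 * t / (1 + x ^ 2)| ≤ 2 / x := by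
      intro t x hx ht
      rw [abs_div, abs_of_pos (by positivity : 0 < 1 + x ^ 2), div_le_div_iff₀ (by positivity) hx,
        abs_mul, abs_two]
      nlinarith
    intro j
    rw [OnePoint.continuous_iff, coclosedCompact_eq_cobounded]
    fin_cases j
    · refine ⟨?_, ?_⟩
      · refine squeeze_zero_norm' ?_ hinv
        filter_upwards [hpos] with z hz using hbd _ _ hz (abs_re_le_norm z)
      · change Continuous fun z : ℂ => 2 * z.re / (1 + ‖z‖ ^ 2)
        exact Continuous.div (by fun_prop) (by fun_prop) hden
    · refine ⟨?_, ?_⟩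
      · refine squeeze_zero_norm' ?_ hinv
        filter_upwards [hpos] with z hz using hbd _ _ hz (abs_im_le_norm z)
      · change Continuous fun z : ℂ => 2 * z.im / (1 + ‖z‖ ^ 2)
        exact Continuous.div (by fun_prop) (by fun_prop) hden
    · refine ⟨?_, ?_⟩
      · change Tendsto (fun z : ℂ => (‖z‖ ^ 2 - 1) / (1 + ‖z‖ ^ 2)) _ (𝓝 1)
        rw [tendsto_iff_norm_sub_tendsto_zero]
        refine squeeze_zero_norm' ?_ hinv2
        filter_upwards [hpos] with z hz
        have e : (‖z‖ ^ 2 - 1) / (1 + ‖z‖ ^ 2) - 1 = -2 / (1 + ‖z‖ ^ 2) := by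
          field_simp [hden z]; ring
        rw [norm_norm, e, norm_div, norm_neg, Real.norm_of_nonneg (by positivity : 0 ≤ 1 + ‖z‖ ^ 2),
          Real.norm_of_nonneg zero_le_two]
        gcongr
        linarith
      · change Continuous fun z : ℂ => (‖z‖ ^ 2 - 1) / (1 + ‖z‖ ^ 2)
        exact Continuous.div (by fun_prop) (by fun_prop) hden
  have h2 : Continuous fun w => WithLp.toLp 2 (fun j => toUnitSphere w j) :=
    (PiLp.continuous_toLp 2 _).comp (continuous_pi hcomp)
  exact h2

theorem toUnitSphere_injective : Function.Injective toUnitSphere := by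
  have hpos : ∀ z : ℂ, 0 < 1 + ‖z‖ ^ 2 := fun z => by positivity
  have h2 : ∀ z : ℂ, toUnitSphere z 2 = 1 - 2 / (1 + ‖z‖ ^ 2) := by
    intro z
    change (‖z‖ ^ 2 - 1) / (1 + ‖z‖ ^ 2) = _
    have := (hpos z).ne'
    field_simp
    ring
  have hinf : ∀ z : ℂ, toUnitSphere z ≠ toUnitSphere OnePoint.infty := by
    intro z h
    have h3 := congrArg (fun v => v 2) h
    simp only [h2] at h3
    have h4 : toUnitSphere OnePoint.infty 2 = 1 := rfl
    rw [h4] at h3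
    have h5 : 0 < 2 / (1 + ‖z‖ ^ 2) := div_pos two_pos (hpos z)
    linarith
  intro v w hvw
  induction v using OnePoint.rec with
  | infty =>
    induction w using OnePoint.rec with
    | infty => rfl
    | coe w => exact absurd hvw.symm (hinf w)
  | coe v =>
    induction w using OnePoint.rec with
    | infty => exact absurd hvw (hinf v)
    | coe w =>
      have h3 := congrArg (fun v => v 2) hvw
      simp only [h2] at h3
      have hn : 1 + ‖v‖ ^ 2 = 1 + ‖w‖ ^ 2 := by
        have h4 : 2 / (1 + ‖v‖ ^ 2) = 2 / (1 + ‖w‖ ^ 2) := by linarith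
        rw [div_eq_div_iff (hpos v).ne' (hpos w).ne'] at h4
        linarith
      have h0 : 2 * v.re / (1 + ‖v‖ ^ 2) = 2 * w.re / (1 + ‖w‖ ^ 2) := congrArg (fun v => v 0) hvw
      have h1 : 2 * v.im / (1 + ‖v‖ ^ 2) = 2 * w.im / (1 + ‖w‖ ^ 2) := congrArg (fun v => v 1) hvw
      rw [hn, div_left_inj' (hpos w).ne'] at h0 h1
      rw [OnePoint.coe_eq_coe]
      apply Complex.ext <;> linarith

theorem isClosedEmbedding_toUnitSphere : IsClosedEmbedding toUnitSphere :=
  continuous_toUnitSphere.isClosedEmbedding toUnitSphere_injective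

section Hausdorff
variable {ι : Type*} {l : Filter ι} {B : ι → Set RiemannSphere} {B' : Set RiemannSphere}

theorem hausdorffEDist_ne_top {S T : Set RiemannSphere} (hS : S.Nonempty) (hT : T.Nonempty) :
    hausdorffEDist (toUnitSphere '' S) (toUnitSphere '' T) ≠ ⊤ := by
  have hb : ∀ S : Set RiemannSphere, Bornology.IsBounded (toUnitSphere '' S) := fun S =>
    (isCompact_range continuous_toUnitSphere).isBounded.subset (image_subset_range _ _)
  exact hausdorffEDist_ne_top_of_nonempty_of_bounded (hS.image _) (hT.image _) (hb S) (hb T)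

/-- Every point of a Hausdorff limit is a limit of points of the sets. -/
theorem exists_tendsto_of_mem (hne : ∀ i, (B i).Nonempty) (hcl : ∀ i, IsClosed (B i))
    (hne' : B'.Nonempty)
    (h : Tendsto (fun i => chordalHausdorffDist (B i) B') l (𝓝 0)) {x : RiemannSphere}
    (hx : x ∈ B') : ∃ p : ι → RiemannSphere, (∀ i, p i ∈ B i) ∧ Tendsto p l (𝓝 x) := by
  have key : ∀ i, ∃ p ∈ B i, dist (toUnitSphere p) (toUnitSphere x) ≤
      chordalHausdorffDist (B i) B' := by
    intro i
    obtain ⟨_, ⟨p, hp, rfl⟩, hpd⟩ := ((hcl i).isCompact.image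
      continuous_toUnitSphere).exists_infDist_eq_dist ((hne i).image _) (toUnitSphere x)
    refine ⟨p, hp, ?_⟩
    rw [dist_comm, ← hpd, chordalHausdorffDist, hausdorffDist_comm]
    exact infDist_le_hausdorffDist_of_mem (mem_image_of_mem _ hx)
      (hausdorffEDist_ne_top hne' (hne i))
  choose p hp hd using key
  refine ⟨p, hp, ?_⟩
  rw [isClosedEmbedding_toUnitSphere.isInducing.tendsto_nhds_iff, tendsto_iff_dist_tendsto_zero]
  exact squeeze_zero (fun _ => dist_nonneg) hd h

/-- A Hausdorff limit contains all limits of points of the sets. -/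
theorem mem_of_tendsto [l.NeBot] (hne' : B'.Nonempty) (hcl : IsClosed B')
    (h : Tendsto (fun i => chordalHausdorffDist (B i) B') l (𝓝 0)) {p : ι → RiemannSphere}
    (hp : ∀ᶠ i in l, p i ∈ B i) {x : RiemannSphere} (hx : Tendsto p l (𝓝 x)) : x ∈ B' := by
  have hcl' : IsClosed (toUnitSphere '' B') := isClosedEmbedding_toUnitSphere.isClosedMap _ hcl
  have h1 : Tendsto (fun i => infDist (toUnitSphere (p i)) (toUnitSphere '' B')) l
      (𝓝 (infDist (toUnitSphere x) (toUnitSphere '' B'))) :=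
    (((continuous_infDist_pt _).comp continuous_toUnitSphere).tendsto x).comp hx
  have h2 : Tendsto (fun i => infDist (toUnitSphere (p i)) (toUnitSphere '' B')) l (𝓝 0) := by
    refine squeeze_zero' (Eventually.of_forall fun _ => infDist_nonneg) ?_ h
    filter_upwards [hp] with i hi
    exact infDist_le_hausdorffDist_of_mem (mem_image_of_mem _ hi)
      (hausdorffEDist_ne_top ⟨_, hi⟩ hne')
  have h3 := tendsto_nhds_unique h1 h2
  rw [← hcl'.mem_iff_infDist_zero (hne'.image _)] at h3
  obtain ⟨y, hy, hyx⟩ := h3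
  rwa [← toUnitSphere_injective hyx]

/-- Otherwise points of `Q ∩ B i` chosen along an ultrafilter converge, by compactness, to a common
point of `Q` and the limit set. -/
theorem eventually_disjoint (hne' : B'.Nonempty) (hcl : IsClosed B')
    (h : Tendsto (fun i => chordalHausdorffDist (B i) B') l (𝓝 0)) {Q : Set RiemannSphere}
    (hQ : IsClosed Q) (hd : Disjoint Q B') : ∀ᶠ i in l, Disjoint Q (B i) := by
  by_contra hcon
  rw [not_eventually] at hcon
  have : (l ⊓ 𝓟 {i | ¬ Disjoint Q (B i)}).NeBot := frequently_iff_neBot.1 hcon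
  set 𝒰 := Ultrafilter.of (l ⊓ 𝓟 {i | ¬ Disjoint Q (B i)}) with h𝒰
  have hle : (𝒰 : Filter ι) ≤ l ⊓ 𝓟 {i | ¬ Disjoint Q (B i)} := Ultrafilter.of_le _
  have hn : ∀ᶠ i in 𝒰, ¬ Disjoint Q (B i) := (hle.trans inf_le_right) (mem_principal_self _)
  have hex : ∀ i, ∃ p, ¬ Disjoint Q (B i) → p ∈ Q ∧ p ∈ B i := by
    intro i
    by_cases hi : Disjoint Q (B i)
    · exact ⟨OnePoint.infty, fun h => absurd hi h⟩
    · obtain ⟨p, h1, h2⟩ := Set.not_disjoint_iff.1 hi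
      exact ⟨p, fun _ => ⟨h1, h2⟩⟩
  choose p hp using hex
  obtain ⟨x, hx, hle2⟩ := hQ.isCompact.ultrafilter_le_nhds (𝒰.map p) (by
    rw [le_principal_iff]
    exact hn.mono fun i hi => (hp i hi).1)
  exact Set.disjoint_left.1 hd hx (mem_of_tendsto hne' hcl (h.mono_left (hle.trans inf_le_left))
    (hn.mono fun i hi => (hp i hi).2) hle2)

/-- If the limit split into two closed parts, disjoint open neighbourhoods `U` and `V` of these
would eventually cover `B i`, and `B i` would meet both. -/
theorem isPreconnected_of_tendsto [l.NeBot] (hne : ∀ i, (B i).Nonempty)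
    (hclB : ∀ i, IsClosed (B i)) (hne' : B'.Nonempty)
    (hcl : IsClosed B') (hc : ∀ i, IsPreconnected (B i))
    (h : Tendsto (fun i => chordalHausdorffDist (B i) B') l (𝓝 0)) : IsPreconnected B' := by
  rw [isPreconnected_iff_subset_of_disjoint_closed]
  intro F G hF hG hsub hdis
  by_contra! hcon
  obtain ⟨hF', hG'⟩ := hcon
  obtain ⟨g, hgB, hgF⟩ := not_subset.1 hF'
  obtain ⟨f, hfB, hfG⟩ := not_subset.1 hG'
  have hFG : Disjoint (B' ∩ F) (B' ∩ G) := by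
    rw [Set.disjoint_left]
    rintro x ⟨hx, hxF⟩ ⟨-, hxG⟩
    exact Set.notMem_empty x (hdis ▸ ⟨hx, hxF, hxG⟩)
  obtain ⟨U, V, hU, hV, hFU, hGV, hUV⟩ := normal_separation
    (hcl.inter hF) (hcl.inter hG) hFG
  have h1 : ∀ᶠ i in l, Disjoint (U ∪ V)ᶜ (B i) := by
    refine eventually_disjoint hne' hcl h (hU.union hV).isClosed_compl ?_
    rw [Set.disjoint_left]
    intro x hx hxB
    rcases hsub hxB with hx' | hx'
    · exact hx (Or.inl (hFU ⟨hxB, hx'⟩))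
    · exact hx (Or.inr (hGV ⟨hxB, hx'⟩))
  have hfU : f ∈ U := hFU ⟨hfB, (hsub hfB).resolve_right hfG⟩
  have hgV : g ∈ V := hGV ⟨hgB, (hsub hgB).resolve_left hgF⟩
  obtain ⟨p, hp, hpf⟩ := exists_tendsto_of_mem hne hclB hne' h hfB
  obtain ⟨q, hq, hqg⟩ := exists_tendsto_of_mem hne hclB hne' h hgB
  obtain ⟨i, hi, hpi, hqi⟩ := (h1.and ((hpf.eventually (hU.mem_nhds hfU)).and
    (hqg.eventually (hV.mem_nhds hgV)))).exists
  have h2 : B i ⊆ U ∪ V := by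
    rw [Set.disjoint_compl_left_iff_subset] at hi
    exact hi
  obtain ⟨x, -, hxU, hxV⟩ := hc i U V hU hV h2 ⟨_, hp i, hpi⟩ ⟨_, hq i, hqi⟩
  exact Set.disjoint_left.1 hUV hxU hxV

end Hausdorff

/-! ### Components of complements -/

instance instLocallyConnectedSpaceRiemannSphere : LocallyConnectedSpace RiemannSphere := by
  rw [locallyConnectedSpace_iff_connected_subsets]
  intro x U hU
  obtain ⟨c, hc⟩ : ∃ c : ℂ, x ≠ (c : RiemannSphere) := by
    induction x using OnePoint.rec with
    | infty => exact ⟨0, OnePoint.infty_ne_coe 0⟩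
    | coe z => exact ⟨z + 1, by rw [Ne, OnePoint.coe_eq_coe]; simp⟩
  have hz := invChart_invCoord hc
  have h1 : invChart c ⁻¹' U ∈ 𝓝 (invCoord c x) :=
    (continuous_invChart c).continuousAt.preimage_mem_nhds (by rwa [hz])
  obtain ⟨ε, hε, hb⟩ := Metric.mem_nhds_iff.1 h1
  refine ⟨invChart c '' ball (invCoord c x) ε, ?_,
    (convex_ball _ _).isPreconnected.image _ (continuous_invChart c).continuousOn,
    image_subset_iff.2 hb⟩
  have h2 := (isOpenEmbedding_invChart c).isOpenMap.image_mem_nhds (ball_mem_nhds (invCoord c x) hε)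
  rwa [hz] at h2

theorem closure_connectedComponentIn_inter_subset {X : Type*} [TopologicalSpace X] {S : Set X} {x : X} (hx : x ∈ S) :
    closure (connectedComponentIn S x) ∩ S ⊆ connectedComponentIn S x := by
  rintro y ⟨hy, hyS⟩
  have h1 : IsPreconnected (insert y (connectedComponentIn S x)) :=
    isPreconnected_connectedComponentIn.subset_closure (subset_insert _ _)
      (insert_subset hy subset_closure)
  exact h1.subset_connectedComponentIn (mem_insert_of_mem _ (mem_connectedComponentIn hx))
    (insert_subset hyS (connectedComponentIn_subset S x)) (mem_insert _ _)

theorem isClosed_connectedComponentIn {X : Type*} [TopologicalSpace X] {S : Set X} (hS : IsClosed S)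
    {x : X} (hx : x ∈ S) : IsClosed (connectedComponentIn S x) :=
  isClosed_of_closure_subset fun _ hy => closure_connectedComponentIn_inter_subset hx
    ⟨hy, hS.closure_subset_iff.2 (connectedComponentIn_subset S x) hy⟩

section Components
variable {X : Type*} [TopologicalSpace X] [LocallyConnectedSpace X]

/-- A component of `Eᶜ` whose closure missed `E` would be closed; by local connectedness it is also
open, so it would be the whole space. -/
theorem closure_connectedComponentIn_compl_inter_nonempty [PreconnectedSpace X] {E : Set X}
    (hE : IsClosed E) (hne : E.Nonempty) {x : X} (hx : x ∈ Eᶜ) :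
    (closure (connectedComponentIn Eᶜ x) ∩ E).Nonempty := by
  by_contra hcon
  have hsub : closure (connectedComponentIn Eᶜ x) ⊆ connectedComponentIn Eᶜ x := fun y hy =>
    closure_connectedComponentIn_inter_subset hx ⟨hy, fun hyE => hcon ⟨y, hy, hyE⟩⟩
  have hcl : IsClopen (connectedComponentIn Eᶜ x) :=
    ⟨isClosed_of_closure_subset hsub, hE.isOpen_compl.connectedComponentIn⟩
  have hu := hcl.eq_univ ⟨x, mem_connectedComponentIn hx⟩
  obtain ⟨e, he⟩ := hne
  exact connectedComponentIn_subset Eᶜ x (hu ▸ mem_univ e) he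

/-- Every component of the complement of a component of `(B ∪ C)ᶜ` contains `B` or `C`. -/
theorem subset_connectedComponentIn_compl_or [PreconnectedSpace X] {B C : Set X} (hB : IsClosed B)
    (hC : IsClosed C) (hBc : IsConnected B) (hCc : IsPreconnected C) {x y : X}
    (hy : y ∈ (connectedComponentIn (B ∪ C)ᶜ x)ᶜ) :
    B ⊆ connectedComponentIn (connectedComponentIn (B ∪ C)ᶜ x)ᶜ y ∨
      C ⊆ connectedComponentIn (connectedComponentIn (B ∪ C)ᶜ x)ᶜ y := by
  set A := connectedComponentIn (B ∪ C)ᶜ x with hA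
  have hBA : B ⊆ Aᶜ := fun b hb hbA => connectedComponentIn_subset _ _ hbA (Or.inl hb)
  have hCA : C ⊆ Aᶜ := fun b hb hbA => connectedComponentIn_subset _ _ hbA (Or.inr hb)
  have key : ∀ e ∈ B ∪ C, e ∈ connectedComponentIn Aᶜ y →
      B ⊆ connectedComponentIn Aᶜ y ∨ C ⊆ connectedComponentIn Aᶜ y := by
    intro e he hey
    rw [connectedComponentIn_eq hey]
    rcases he with he | he
    · exact Or.inl (hBc.isPreconnected.subset_connectedComponentIn he hBA)
    · exact Or.inr (hCc.subset_connectedComponentIn he hCA)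
  by_cases hyE : y ∈ B ∪ C
  · exact key y hyE (mem_connectedComponentIn hy)
  -- The point `y` lies in another component of `(B ∪ C)ᶜ`, which joins it to `B ∪ C` within the
  -- complement of `A`.
  obtain ⟨e, hecl, heE⟩ := closure_connectedComponentIn_compl_inter_nonempty (hB.union hC)
    (hBc.nonempty.mono subset_union_left) (x := y) hyE
  have h1 : IsPreconnected (insert e (connectedComponentIn (B ∪ C)ᶜ y)) :=
    isPreconnected_connectedComponentIn.subset_closure (subset_insert _ _)
      (insert_subset hecl subset_closure)
  refine key e heE (h1.subset_connectedComponentIn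
    (mem_insert_of_mem _ (mem_connectedComponentIn hyE)) (insert_subset ?_ ?_)
    (mem_insert _ _))
  · rcases heE with h | h
    · exact hBA h
    · exact hCA h
  · intro v hv hvA
    apply hy
    have h2 : connectedComponentIn (B ∪ C)ᶜ x = connectedComponentIn (B ∪ C)ᶜ y :=
      (connectedComponentIn_eq hvA).trans (connectedComponentIn_eq hv).symm
    rw [hA, h2]
    exact mem_connectedComponentIn hyE

theorem isConnected_compl_connectedComponentIn_compl [PreconnectedSpace X] {E : Set X}
    (hE : IsClosed E) (hEc : IsConnected E) (x : X) :
    IsConnected (connectedComponentIn Eᶜ x)ᶜ := by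
  obtain ⟨e, he⟩ := hEc.nonempty
  have heA : e ∈ (connectedComponentIn Eᶜ x)ᶜ := fun h => connectedComponentIn_subset _ _ h he
  have h1 : connectedComponentIn (connectedComponentIn Eᶜ x)ᶜ e = (connectedComponentIn Eᶜ x)ᶜ := by
    refine (connectedComponentIn_subset _ _).antisymm fun y hy => ?_
    have h2 := subset_connectedComponentIn_compl_or hE hE hEc hEc.isPreconnected (x := x) (y := y)
      (by rwa [union_self])
    rw [or_self, union_self] at h2
    rw [← connectedComponentIn_eq (h2 he)]
    exact mem_connectedComponentIn hy
  rw [← h1]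
  exact isConnected_connectedComponentIn_iff.2 heA

end Components

/-! ### Separation of two continua -/

section Pair
variable {X : Type*} [TopologicalSpace X]

/-- A closed set with exactly the two components `B` and `C`. -/
theorem two_components {S B C : Set X} (hS : IsClosed S) (h : components S = {B, C}) (hne : B ≠ C) :
    IsClosed B ∧ IsConnected B ∧ IsClosed C ∧ IsConnected C ∧ S = B ∪ C ∧ Disjoint B C := by
  have hB : B ∈ components S := h ▸ mem_insert _ _
  have hC : C ∈ components S := h ▸ mem_insert_of_mem _ rfl
  obtain ⟨b, hb, rfl⟩ := hB
  obtain ⟨c, hc, rfl⟩ := hC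
  refine ⟨isClosed_connectedComponentIn hS hb, isConnected_connectedComponentIn_iff.2 hb,
    isClosed_connectedComponentIn hS hc, isConnected_connectedComponentIn_iff.2 hc, ?_, ?_⟩
  · refine Subset.antisymm (fun x hx => ?_)
      (union_subset (connectedComponentIn_subset _ _) (connectedComponentIn_subset _ _))
    have h1 : connectedComponentIn S x ∈ components S := ⟨x, hx, rfl⟩
    rw [h] at h1
    have h2 := mem_connectedComponentIn hx
    rcases h1 with h1 | h1
    · exact Or.inl (h1 ▸ h2)
    · exact Or.inr ((show connectedComponentIn S x = connectedComponentIn S c from h1) ▸ h2)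
  · rw [Set.disjoint_left]
    intro x hxb hxc
    exact hne ((connectedComponentIn_eq hxb).trans (connectedComponentIn_eq hxc).symm)

theorem components_union {B C : Set X} (hB : IsClosed B) (hBc : IsConnected B) (hC : IsClosed C)
    (hCc : IsConnected C) (hd : Disjoint B C) : components (B ∪ C) = {B, C} := by
  have key : ∀ {B C : Set X}, IsClosed B → IsPreconnected B → IsClosed C → Disjoint B C →
      ∀ x ∈ B, connectedComponentIn (B ∪ C) x = B := by
    intro B C hB hBc hC hd x hx
    refine Subset.antisymm ?_ (hBc.subset_connectedComponentIn hx subset_union_left)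
    refine subset_of_relatively_clopen isPreconnected_connectedComponentIn hC.isOpen_compl hB ?_
      ⟨x, mem_connectedComponentIn (Or.inl hx), Set.disjoint_left.1 hd hx⟩
    ext y
    constructor
    · rintro ⟨hy, hyC⟩
      exact ⟨hy, (connectedComponentIn_subset _ _ hy).resolve_right hyC⟩
    · rintro ⟨hy, hyB⟩
      exact ⟨hy, Set.disjoint_left.1 hd hyB⟩
  have hkC : ∀ x ∈ C, connectedComponentIn (B ∪ C) x = C := by
    intro x hx
    rw [union_comm]
    exact key hC hCc.isPreconnected hB hd.symm x hx
  ext S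
  constructor
  · rintro ⟨x, hx | hx, rfl⟩
    · exact Or.inl (key hB hBc.isPreconnected hC hd x hx)
    · exact Or.inr (hkC x hx)
  · rintro (rfl | h)
    · obtain ⟨x, hx⟩ := hBc.nonempty
      exact ⟨x, Or.inl hx, (key hB hBc.isPreconnected hC hd x hx).symm⟩
    · obtain ⟨x, hx⟩ := hCc.nonempty
      exact ⟨x, Or.inr hx, ((hkC x hx).trans h.symm).symm⟩

/-- In a space where nonvanishing functions have logarithms, the intersection of two connected open
sets which cover the space is connected. -/
theorem isPreconnected_inter_of_union_eq_univ [NormalSpace X]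
    (hlog : ∀ u : X → ℂ, Continuous u → (∀ x, u x ≠ 0) → HasLogOn u univ) {V W : Set X}
    (hV : IsOpen V) (hVc : IsPreconnected V) (hW : IsOpen W) (hWc : IsPreconnected W)
    (hVW : V ∪ W = univ) : IsPreconnected (V ∩ W) := by
  intro P Q hP hQ hPQ hneP hneQ
  by_contra hcon
  have hdisj : ∀ x ∈ V ∩ W, x ∈ P → x ∉ Q := fun x hx hxP hxQ => hcon ⟨x, hx, hxP, hxQ⟩
  have hdVW : Disjoint Wᶜ Vᶜ := by
    rw [Set.disjoint_left]
    intro x hxW hxV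
    rcases (hVW ▸ mem_univ x : x ∈ V ∪ W) with h | h
    · exact hxV h
    · exact hxW h
  obtain ⟨χ, hχ0, hχ1, -⟩ := exists_continuous_zero_one_of_isClosed hW.isClosed_compl
    hV.isClosed_compl hdVW
  classical
  -- Eilenberg's argument. If `P` and `Q` split `V ∩ W`, then `a` is continuous on `V` since `χ = 0`
  -- off `W`, and `b` is continuous on `W` since `χ = 1` off `V`. They differ by an integer, so `exp
  -- (2πia) = exp (2πib)` is one continuous function on `X`. Its global logarithm makes `a - b`
  -- constant on `V ∩ W`, although it equals `1` on the `P` part and `0` on the `Q` part.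
  set a : X → ℝ := fun x => if x ∈ V ∩ W ∩ P then χ x else 0 with ha
  set b : X → ℝ := fun x => if x ∈ V ∩ W ∩ P then χ x - 1 else 0 with hb
  have hPo : IsOpen (V ∩ W ∩ P) := (hV.inter hW).inter hP
  have hQo : IsOpen (V ∩ W ∩ Q) := (hV.inter hW).inter hQ
  have hQP : ∀ x ∈ V ∩ W ∩ Q, x ∉ V ∩ W ∩ P := fun x hx hx' => hdisj x hx.1 hx'.2 hx.2
  have hcov : ∀ x ∈ V ∩ W, x ∈ V ∩ W ∩ P ∨ x ∈ V ∩ W ∩ Q := fun x hx =>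
    (hPQ hx).imp (fun h => ⟨hx, h⟩) (fun h => ⟨hx, h⟩)
  have hca : ∀ x ∈ V, ContinuousAt a x := by
    intro x hxV
    by_cases hxW : x ∈ W
    · rcases hcov x ⟨hxV, hxW⟩ with h | h
      · refine χ.continuous.continuousAt.congr ?_
        filter_upwards [hPo.mem_nhds h] with y hy
        simp only [ha, if_pos hy]
      · refine (continuousAt_const (y := (0 : ℝ))).congr ?_
        filter_upwards [hQo.mem_nhds h] with y hy
        simp only [ha, if_neg (hQP y hy)]
    · have h0 : χ x = 0 := hχ0 hxW
      have hax : a x = 0 := by simp only [ha]; rw [if_neg fun h => hxW h.1.2]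
      rw [ContinuousAt, hax]
      refine squeeze_zero_norm (a := fun y => ‖χ y‖) (fun y => ?_) ?_
      · simp only [ha]
        split_ifs
        · exact le_rfl
        · simp
      · have := (χ.continuous.norm).tendsto x
        simpa [h0] using this
  have hcb : ∀ x ∈ W, ContinuousAt b x := by
    intro x hxW
    by_cases hxV : x ∈ V
    · rcases hcov x ⟨hxV, hxW⟩ with h | h
      · have hc : ContinuousAt (fun y => χ y - 1) x := by fun_prop
        refine hc.congr ?_
        filter_upwards [hPo.mem_nhds h] with y hy
        simp only [hb, if_pos hy]
      · refine (continuousAt_const (y := (0 : ℝ))).congr ?_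
        filter_upwards [hQo.mem_nhds h] with y hy
        simp only [hb, if_neg (hQP y hy)]
    · have h0 : χ x = 1 := hχ1 hxV
      have hax : b x = 0 := by simp only [hb]; rw [if_neg fun h => hxV h.1.1]
      rw [ContinuousAt, hax]
      refine squeeze_zero_norm (a := fun y => ‖χ y - 1‖) (fun y => ?_) ?_
      · simp only [hb]
        split_ifs
        · exact le_rfl
        · simp
      · have := ((χ.continuous.sub (continuous_const (y := (1 : ℝ)))).norm).tendsto x
        simpa [h0] using this
  have hab : ∀ x, exp (a x * (2 * Real.pi * I)) = exp (b x * (2 * Real.pi * I)) := by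
    intro x
    simp only [ha, hb]
    split_ifs
    · rw [exp_eq_exp_iff_exists_int]
      exact ⟨1, by push_cast; ring⟩
    · rfl
  have hu : Continuous fun x => exp (a x * (2 * Real.pi * I)) := by
    rw [continuous_iff_continuousAt]
    intro x
    rcases (hVW ▸ mem_univ x : x ∈ V ∪ W) with h | h
    · have := hca x h
      fun_prop
    · simp only [hab]
      have := hcb x h
      fun_prop
  obtain ⟨L, hL, hLe⟩ := hlog _ hu fun x => exp_ne_zero _
  obtain ⟨k, hk⟩ := exists_eq_add_of_exp_eq hVc (L := L) (M := fun x => a x * (2 * Real.pi * I))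
    (hL.mono (subset_univ _)) (fun x hx => by
      have := hca x hx
      exact ContinuousAt.continuousWithinAt (by fun_prop)) (fun x _ => hLe x (mem_univ x))
  obtain ⟨j, hj⟩ := exists_eq_add_of_exp_eq hWc (L := L) (M := fun x => b x * (2 * Real.pi * I))
    (hL.mono (subset_univ _)) (fun x hx => by
      have := hcb x hx
      exact ContinuousAt.continuousWithinAt (by fun_prop))
    (fun x _ => (hLe x (mem_univ x)).trans (hab x))
  obtain ⟨p, hp, hpP⟩ := hneP
  obtain ⟨q, hq, hqQ⟩ := hneQ
  have h2pi : (2 * Real.pi * I : ℂ) ≠ 0 := by simp [Real.pi_ne_zero]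
  have hkj : ∀ x ∈ V ∩ W, (a x : ℂ) + k = b x + j := by
    intro x hx
    have := (hk x hx.1).symm.trans (hj x hx.2)
    exact mul_right_cancel₀ h2pi (by linear_combination this)
  have h1 := hkj p hp
  have h2 := hkj q hq
  simp only [ha, hb] at h1 h2
  rw [if_pos ⟨hp, hpP⟩, if_pos ⟨hp, hpP⟩] at h1
  rw [if_neg (hQP q ⟨hq, hqQ⟩), if_neg (hQP q ⟨hq, hqQ⟩)] at h2
  push_cast at h1 h2
  have h3 : (1 : ℂ) = 0 := by linear_combination h1 - h2
  exact one_ne_zero h3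

end Pair

/-- The plane carries a logarithm `N`. Near infinity `u / u ∞` takes values in the slit plane, and
on the connected exterior of a disc `N` differs from the principal branch by a constant; so `N` has
a limit at infinity. -/
theorem hasLogOn_univ_riemannSphere (u : RiemannSphere → ℂ) (hu : Continuous u)
    (h0 : ∀ x, u x ≠ 0) : HasLogOn u univ := by
  obtain ⟨huinf, huc⟩ := (OnePoint.continuous_iff u).1 hu
  rw [coclosedCompact_eq_cobounded] at huinf
  obtain ⟨N, hN, hNe⟩ := HasLogOn.of_convex (u := fun z : ℂ => u z) convex_univ isOpen_univ
    huc.continuousOn (fun z _ => h0 z)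
  have hdiv : Tendsto (fun z : ℂ => u z / u OnePoint.infty) (Bornology.cobounded ℂ) (𝓝 1) := by
    have := huinf.div_const (u OnePoint.infty)
    rwa [div_self (h0 _)] at this
  have hev : ∀ᶠ z : ℂ in Bornology.cobounded ℂ, ‖u z / u OnePoint.infty - 1‖ < 1 := by
    have := (hdiv.sub_const 1).norm
    simp only [sub_self, norm_zero] at this
    exact this.eventually (gt_mem_nhds one_pos)
  obtain ⟨ρ, -, hρ⟩ := (Filter.HasBasis.eventually_iff
    (hasBasis_cobounded_norm (E := ℂ))).1 hev
  set S : Set ℂ := roundAnnulus (ENNReal.ofReal |ρ|) ⊤ with hS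
  have hSm : ∀ z : ℂ, z ∈ S ↔ |ρ| < ‖z‖ := by
    intro z
    rw [hS, roundAnnulus, mem_ofPred_eq, ← ofReal_norm,
      ENNReal.ofReal_lt_ofReal_iff_of_nonneg (abs_nonneg ρ)]
    simp
  have hSs : ∀ z ∈ S, u z / u OnePoint.infty ∈ slitPlane := by
    intro z hz
    refine ball_one_subset_slitPlane ?_
    rw [mem_ball, dist_eq_norm]
    exact hρ ((le_abs_self ρ).trans ((hSm z).1 hz).le)
  have hM : ContinuousOn (fun z : ℂ => log (u z / u OnePoint.infty) + log (u OnePoint.infty)) S :=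
    ((huc.div_const _).continuousOn.clog hSs).add continuousOn_const
  obtain ⟨k, hk⟩ := exists_eq_add_of_exp_eq
    (isConnected_roundAnnulus ENNReal.ofReal_lt_top).isPreconnected (hN.mono (subset_univ _)) hM
    (fun z hz => by
      rw [hNe z (mem_univ z), exp_add, exp_log (h0 _), exp_log (slitPlane_ne_zero (hSs z hz)),
        div_mul_cancel₀ _ (h0 _)])
  refine ⟨fun x => x.elim (log (u OnePoint.infty) + k * (2 * Real.pi * I)) N, ?_, ?_⟩
  · rw [continuousOn_univ, OnePoint.continuous_iff, coclosedCompact_eq_cobounded]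
    refine ⟨?_, by simpa [continuousOn_univ] using hN⟩
    have h1 : Tendsto (fun z : ℂ => log (u z / u OnePoint.infty) + log (u OnePoint.infty) +
        k * (2 * Real.pi * I)) (Bornology.cobounded ℂ)
        (𝓝 (log 1 + log (u OnePoint.infty) + k * (2 * Real.pi * I))) :=
      ((hdiv.clog one_mem_slitPlane).add_const _).add_const _
    rw [log_one, zero_add] at h1
    refine h1.congr' ?_
    filter_upwards [tendsto_norm_cobounded_atTop.eventually_gt_atTop |ρ|] with z hz
    exact (hk z ((hSm z).2 hz)).symm
  · intro x _
    induction x using OnePoint.rec with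
    | infty => simp [exp_add, exp_int_mul_two_pi_mul_I, exp_log (h0 _)]
    | coe z => exact hNe z (mem_univ z)

/-- The two complementary components of a doubly connected component of the complement of two
continua contain one of the continua each. -/
theorem exists_compl_eq_union_of_isDoublyConnected {B C A : Set RiemannSphere} (hB : IsClosed B)
    (hC : IsClosed C) (hBc : IsConnected B) (hCc : IsConnected C) (hA : A ∈ components (B ∪ C)ᶜ)
    (hAd : IsDoublyConnected A) : ∃ B₁ C₁, IsClosed B₁ ∧ IsConnected B₁ ∧ IsClosed C₁ ∧
      IsConnected C₁ ∧ Aᶜ = B₁ ∪ C₁ ∧ Disjoint B₁ C₁ ∧ B ⊆ B₁ ∧ C ⊆ C₁ := by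
  obtain ⟨x, -, rfl⟩ := hA
  set A := connectedComponentIn (B ∪ C)ᶜ x with hA
  obtain ⟨hAo, -, hcard⟩ := hAd
  obtain ⟨b, hb⟩ := hBc.nonempty
  obtain ⟨c, hc⟩ := hCc.nonempty
  have hBA : B ⊆ Aᶜ := fun b hb hbA => connectedComponentIn_subset _ _ hbA (Or.inl hb)
  have hCA : C ⊆ Aᶜ := fun b hb hbA => connectedComponentIn_subset _ _ hbA (Or.inr hb)
  -- Each complementary component contains `B` or `C`. Since there are exactly two, they are the
  -- components of `b` and `c`, and these differ.
  have hsub : components Aᶜ ⊆ {connectedComponentIn Aᶜ b, connectedComponentIn Aᶜ c} := by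
    rintro _ ⟨y, hy, rfl⟩
    rcases subset_connectedComponentIn_compl_or hB hC hBc hCc.isPreconnected hy with h | h
    · exact Or.inl (connectedComponentIn_eq (h hb))
    · exact Or.inr (connectedComponentIn_eq (h hc))
  have hne : connectedComponentIn Aᶜ b ≠ connectedComponentIn Aᶜ c := by
    intro heq
    rw [heq, pair_eq_singleton] at hsub
    have h1 := ncard_le_ncard hsub
    rw [ncard_singleton, hcard] at h1
    omega
  have heq : components Aᶜ = {connectedComponentIn Aᶜ b, connectedComponentIn Aᶜ c} := by
    refine hsub.antisymm ?_
    rintro _ (rfl | h)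
    · exact ⟨b, hBA hb, rfl⟩
    · exact ⟨c, hCA hc, h⟩
  obtain ⟨h1, h2, h3, h4, h5, h6⟩ := two_components hAo.isClosed_compl heq hne
  exact ⟨_, _, h1, h2, h3, h4, h5, h6, hBc.isPreconnected.subset_connectedComponentIn hb hBA,
    hCc.isPreconnected.subset_connectedComponentIn hc hCA⟩

/-- Two disjoint continua are separated by a doubly connected component of their complement. -/
theorem exists_isDoublyConnected_of_disjoint {B C : Set RiemannSphere} (hB : IsClosed B)
    (hC : IsClosed C) (hBc : IsConnected B) (hCc : IsConnected C) (hd : Disjoint B C) :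
    ∃ A ∈ components (B ∪ C)ᶜ, IsDoublyConnected A := by
  obtain ⟨b, hb⟩ := hBc.nonempty
  obtain ⟨c, hc⟩ := hCc.nonempty
  have hCB : C ⊆ Bᶜ := fun x hx hxB => Set.disjoint_left.1 hd hxB hx
  have hBC : B ⊆ Cᶜ := fun x hx hxC => Set.disjoint_left.1 hd hx hxC
  -- The separating domain is `V ∩ W`. The complements of `V` and `W` are `B` and `C` with their
  -- holes filled; they are connected and disjoint, so `V ∪ W` is the sphere and unicoherence makes
  -- `V ∩ W` connected.
  set V := connectedComponentIn Bᶜ c with hV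
  set W := connectedComponentIn Cᶜ b with hW
  have hVo : IsOpen V := hB.isOpen_compl.connectedComponentIn
  have hWo : IsOpen W := hC.isOpen_compl.connectedComponentIn
  have hVc : IsConnected Vᶜ := isConnected_compl_connectedComponentIn_compl hB hBc c
  have hWc : IsConnected Wᶜ := isConnected_compl_connectedComponentIn_compl hC hCc b
  have hBV : B ⊆ Vᶜ := fun x hx hxV => connectedComponentIn_subset _ _ hxV hx
  have hCW : C ⊆ Wᶜ := fun x hx hxV => connectedComponentIn_subset _ _ hxV hx
  have hCV : C ⊆ V := hCc.isPreconnected.subset_connectedComponentIn hc hCB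
  have hVW : Vᶜ ⊆ W := hVc.isPreconnected.subset_connectedComponentIn (hBV hb)
    fun x hx hxC => hx (hCV hxC)
  have hun : V ∪ W = univ := by
    rw [eq_univ_iff_forall]
    intro x
    by_cases hx : x ∈ V
    · exact Or.inl hx
    · exact Or.inr (hVW hx)
  have hdis : Disjoint Vᶜ Wᶜ := by
    rw [Set.disjoint_left]
    exact fun x hx hxW => hxW (hVW hx)
  have hpre : IsPreconnected (V ∩ W) := isPreconnected_inter_of_union_eq_univ
    hasLogOn_univ_riemannSphere hVo isPreconnected_connectedComponentIn hWo
    isPreconnected_connectedComponentIn hun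
  obtain ⟨x, -, hxV, hxW⟩ : (univ ∩ (V ∩ W)).Nonempty :=
    isPreconnected_univ (α := RiemannSphere) V W hVo hWo hun.ge
      ⟨c, mem_univ _, mem_connectedComponentIn (hCB hc)⟩ ⟨b, mem_univ _, mem_connectedComponentIn (hBC hb)⟩
  have hcompl : (V ∩ W)ᶜ = Vᶜ ∪ Wᶜ := compl_inter _ _
  have hsubE : V ∩ W ⊆ (B ∪ C)ᶜ := by
    rintro y ⟨hyV, hyW⟩ (h | h)
    · exact hBV h hyV
    · exact hCW h hyW
  refine ⟨V ∩ W, ⟨x, hsubE ⟨hxV, hxW⟩, ?_⟩, hVo.inter hWo, ⟨⟨x, hxV, hxW⟩, hpre⟩, ?_⟩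
  · refine Subset.antisymm (hpre.subset_connectedComponentIn ⟨hxV, hxW⟩ hsubE) (subset_inter ?_ ?_)
    · rw [hV, connectedComponentIn_eq hxV]
      exact connectedComponentIn_mono _ (compl_subset_compl.2 subset_union_left)
    · rw [hW, connectedComponentIn_eq hxW]
      exact connectedComponentIn_mono _ (compl_subset_compl.2 subset_union_right)
  · rw [hcompl, components_union hVo.isClosed_compl hVc hWo.isClosed_compl hWc hdis, ncard_pair]
    intro heq
    exact Set.disjoint_left.1 hdis (hBV hb) (heq ▸ hBV hb)

/-- A component of `(B ∪ C)ᶜ` which separates `B` from `C` is adherent to `B`. -/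
theorem closure_inter_nonempty_of_separates {B C B₁ C₁ A : Set RiemannSphere}
    (hA : A ∈ components (B ∪ C)ᶜ) (hne : B.Nonempty) (hB₁ : IsClosed B₁) (hC₁ : IsClosed C₁)
    (hcompl : Aᶜ = B₁ ∪ C₁) (hd : Disjoint B₁ C₁) (hB : B ⊆ B₁) (hC : C ⊆ C₁) :
    (closure A ∩ B).Nonempty := by
  by_contra hcon
  obtain ⟨x, hx, rfl⟩ := hA
  set A := connectedComponentIn (B ∪ C)ᶜ x with hA
  have hcl : closure A ⊆ A ∪ C := by
    intro y hy
    by_cases hyE : y ∈ B ∪ C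
    · rcases hyE with h | h
      · exact absurd ⟨y, hy, h⟩ hcon
      · exact Or.inr h
    · exact Or.inl (closure_connectedComponentIn_inter_subset hx ⟨hy, hyE⟩)
  have hopen : A ∪ C₁ = B₁ᶜ := by
    ext y
    constructor
    · rintro (h | h) hyB
      · exact (hcompl ▸ Or.inl hyB : y ∈ Aᶜ) h
      · exact Set.disjoint_left.1 hd hyB h
    · intro hyB
      by_cases hyA : y ∈ A
      · exact Or.inl hyA
      · have : y ∈ B₁ ∪ C₁ := hcompl ▸ hyA
        exact Or.inr (this.resolve_left hyB)
  -- If `A` did not adhere to `B`, its closure would add only points of `C`, so `A ∪ C₁`, the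
  -- complement of `B₁`, would be closed as well as open.
  have hclopen : IsClopen (A ∪ C₁) := by
    refine ⟨isClosed_of_closure_subset ?_, hopen ▸ hB₁.isOpen_compl⟩
    rw [closure_union, hC₁.closure_eq]
    exact union_subset (hcl.trans (union_subset_union_right _ hC)) subset_union_right
  have hu := hclopen.eq_univ ⟨x, Or.inl (mem_connectedComponentIn hx)⟩
  obtain ⟨b, hb⟩ := hne
  have : b ∈ A ∪ C₁ := hu ▸ mem_univ b
  rw [hopen] at this
  exact this (hB hb)

theorem eventually_ne_of_tendsto {ι Y : Type*} [TopologicalSpace Y] [T2Space Y] {l : Filter ι}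
    {f g : ι → Y} {a b : Y} (hf : Tendsto f l (𝓝 a)) (hg : Tendsto g l (𝓝 b)) (hab : a ≠ b) :
    ∀ᶠ i in l, f i ≠ g i :=
  (hf.prodMk_nhds hg).eventually (isClosed_diagonal.isOpen_compl.mem_nhds hab)

theorem invCoord_eq_div {c : ℂ} (c' : ℂ) {w : RiemannSphere} (hw : w ≠ (c : RiemannSphere)) :
    invCoord c' w = invCoord c w / (1 + (c - c') * invCoord c w) := by
  induction w using OnePoint.rec with
  | infty => simp
  | coe w =>
    have h : w - c ≠ 0 := fun h => hw (by rw [sub_eq_zero.1 h])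
    simp only [invCoord_coe]
    rw [← inv_div]
    congr 1
    field_simp
    ring

theorem tendsto_invCoord {ι : Type*} {l : Filter ι} {c : ι → ℂ} {c₀ : ℂ} (hc : Tendsto c l (𝓝 c₀))
    {p : ι → RiemannSphere} {p₀ : RiemannSphere} (hp : Tendsto p l (𝓝 p₀))
    (hne : p₀ ≠ (c₀ : RiemannSphere)) :
    Tendsto (fun i => invCoord (c i) (p i)) l (𝓝 (invCoord c₀ p₀)) := by
  have h1 : Tendsto (fun i => invCoord c₀ (p i)) l (𝓝 (invCoord c₀ p₀)) :=
    (continuousAt_invCoord hne).tendsto.comp hp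
  have h2 : Tendsto (fun i => invCoord c₀ (p i) / (1 + (c₀ - c i) * invCoord c₀ (p i))) l
      (𝓝 (invCoord c₀ p₀ / (1 + (c₀ - c₀) * invCoord c₀ p₀))) :=
    h1.div (((hc.const_sub c₀).mul h1).const_add 1) (by simp)
  rw [sub_self, zero_mul, add_zero, div_one] at h2
  refine h2.congr' ?_
  filter_upwards [hp.eventually_ne hne] with i hi using (invCoord_eq_div (c i) hi).symm

/-! ### Convergent sequences of annuli -/

/-- Doubly connected domains `A i` whose complementary components `B i`, `C i` converge to continua
`B'`, `C'`. -/
structure IsConvergent (A B C : ℕ → Set RiemannSphere) (B' C' : Set RiemannSphere) : Prop where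
  isOpen : ∀ i, IsOpen (A i)
  isConnected : ∀ i, IsConnected (A i)
  isClosed_left : ∀ i, IsClosed (B i)
  isConnected_left : ∀ i, IsConnected (B i)
  isClosed_right : ∀ i, IsClosed (C i)
  isConnected_right : ∀ i, IsConnected (C i)
  compl_eq : ∀ i, (A i)ᶜ = B i ∪ C i
  disjoint : ∀ i, Disjoint (B i) (C i)
  isClosed_left_lim : IsClosed B'
  isClosed_right_lim : IsClosed C'
  nontrivial_left : B'.Nontrivial
  nontrivial_right : C'.Nontrivial
  tendsto_left : Tendsto (fun i => chordalHausdorffDist (B i) B') atTop (𝓝 0)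
  tendsto_right : Tendsto (fun i => chordalHausdorffDist (C i) C') atTop (𝓝 0)

namespace IsConvergent
variable {A B C : ℕ → Set RiemannSphere} {B' C' : Set RiemannSphere}

theorem isConnected_left_lim (h : IsConvergent A B C B' C') : IsConnected B' :=
  ⟨h.nontrivial_left.nonempty, isPreconnected_of_tendsto (fun i => (h.isConnected_left i).nonempty)
    h.isClosed_left h.nontrivial_left.nonempty h.isClosed_left_lim
    (fun i => (h.isConnected_left i).isPreconnected) h.tendsto_left⟩

theorem isConnected_right_lim (h : IsConvergent A B C B' C') : IsConnected C' :=
  ⟨h.nontrivial_right.nonempty, isPreconnected_of_tendsto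
    (fun i => (h.isConnected_right i).nonempty)
    h.isClosed_right h.nontrivial_right.nonempty h.isClosed_right_lim
    (fun i => (h.isConnected_right i).isPreconnected) h.tendsto_right⟩

/-- Infinitude leaves room to choose poles and test points off any given finite set. -/
theorem infinite_left (h : IsConvergent A B C B' C') : B'.Infinite :=
  h.isConnected_left_lim.isPreconnected.infinite_of_nontrivial h.nontrivial_left

theorem infinite_right (h : IsConvergent A B C B' C') : C'.Infinite :=
  h.isConnected_right_lim.isPreconnected.infinite_of_nontrivial h.nontrivial_right

/-- Poles `c i ∈ C i` converging to a given finite point of `C'`. -/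
theorem exists_poles (h : IsConvergent A B C B' C') {c₀ : ℂ} (hc₀ : (c₀ : RiemannSphere) ∈ C') :
    ∃ c : ℕ → ℂ, (∀ᶠ i in atTop, (c i : RiemannSphere) ∈ C i) ∧ Tendsto c atTop (𝓝 c₀) := by
  obtain ⟨p, hp, hpt⟩ := exists_tendsto_of_mem (fun i => (h.isConnected_right i).nonempty)
    h.isClosed_right h.nontrivial_right.nonempty h.tendsto_right hc₀
  refine ⟨fun i => affineCoord (p i), ?_, ?_⟩
  · filter_upwards [hpt.eventually_ne (OnePoint.coe_ne_infty c₀)] with i hi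
    obtain ⟨z, hz⟩ := OnePoint.ne_infty_iff_exists.1 hi
    have h1 := hp i
    rw [← hz] at h1 ⊢
    exact h1
  · have h1 : ContinuousAt affineCoord (c₀ : RiemannSphere) := by
      rw [OnePoint.continuousAt_coe]
      exact continuousAt_id
    exact h1.tendsto.comp hpt

theorem exists_tendsto_planar {S : ℕ → Set RiemannSphere} {S' : Set RiemannSphere}
    (hne : ∀ i, (S i).Nonempty) (hcl : ∀ i, IsClosed (S i)) (hne' : S'.Nonempty)
    (h : Tendsto (fun i => chordalHausdorffDist (S i) S') atTop (𝓝 0)) {c : ℕ → ℂ} {c₀ : ℂ}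
    (hc : Tendsto c atTop (𝓝 c₀)) {x : ℂ} (hx : invChart c₀ x ∈ S') :
    ∃ ξ : ℕ → ℂ, (∀ᶠ i in atTop, ξ i ∈ invChart (c i) ⁻¹' S i) ∧ Tendsto ξ atTop (𝓝 x) := by
  obtain ⟨p, hp, hpt⟩ := exists_tendsto_of_mem hne hcl hne' h hx
  have hn := invChart_ne c₀ x
  refine ⟨fun i => invCoord (c i) (p i), ?_, ?_⟩
  · have hcc : Tendsto (fun i => (c i : RiemannSphere)) atTop (𝓝 (c₀ : RiemannSphere)) :=
      (OnePoint.continuous_coe.tendsto c₀).comp hc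
    filter_upwards [eventually_ne_of_tendsto hpt hcc hn] with i hi
    rw [mem_preimage, invChart_invCoord hi]
    exact hp i
  · have := tendsto_invCoord hc hpt hn
    rwa [invCoord_invChart] at this

theorem isRing (h : IsConvergent A B C B' C') {c : ℂ} {i : ℕ} (hc : (c : RiemannSphere) ∈ C i) :
    IsRing (invChart c ⁻¹' A i) (invChart c ⁻¹' B i) (invChart c ⁻¹' C i) :=
  isRing_preimage_invChart (h.isOpen i) (h.isConnected i) (h.isClosed_left i)
    (h.isConnected_left i) (h.isClosed_right i) (h.isConnected_right i) (h.compl_eq i)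
    (h.disjoint i) hc

/-- Two distinct points of the limit are approximated by two distinct points of `B i`, so the inner
continuum is eventually nondegenerate and the ring can be uniformized. -/
theorem eventually_uniformization (h : IsConvergent A B C B' C') {c : ℕ → ℂ} {c₀ : ℂ}
    (hcC : ∀ᶠ i in atTop, (c i : RiemannSphere) ∈ C i) (hc : Tendsto c atTop (𝓝 c₀)) {x x' : ℂ}
    (hx : invChart c₀ x ∈ B') (hx' : invChart c₀ x' ∈ B') (hne : x ≠ x') :
    ∀ᶠ i in atTop, ∃ r R : ℝ≥0∞, ∃ q : ℂ → ℂ, DifferentiableOn ℂ q (roundAnnulus r R) ∧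
      BijOn q (roundAnnulus r R) (invChart (c i) ⁻¹' A i) ∧ modulus (A i) = roundModulus r R := by
  have hnB := fun i => (h.isConnected_left i).nonempty
  obtain ⟨ξ, hξ, hξt⟩ := exists_tendsto_planar hnB h.isClosed_left h.nontrivial_left.nonempty
    h.tendsto_left hc hx
  obtain ⟨ξ', hξ', hξt'⟩ := exists_tendsto_planar hnB h.isClosed_left h.nontrivial_left.nonempty
    h.tendsto_left hc hx'
  filter_upwards [hcC, hξ, hξ', eventually_ne_of_tendsto hξt hξt' hne] with i h1 h2 h3 h4
  obtain ⟨r, R, hrR, q, hq, hqb⟩ := (h.isRing h1).exists_uniformization ⟨_, h2, _, h3, h4⟩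
  have hcA : (c i : RiemannSphere) ∉ A i := fun hcA =>
    (h.compl_eq i ▸ Or.inr h1 : (c i : RiemannSphere) ∈ (A i)ᶜ) hcA
  exact ⟨r, R, q, hq, hqb, modulus_eq_roundModulus hcA (h.isRing h1) hrR hq hqb⟩

/-- If the moduli stay above `m`, the standard annulus of modulus `m` maps into the complement of
`B' ∪ C'` and separates `B'` from `C'`. -/
theorem exists_limit_map (h : IsConvergent A B C B' C') {c₀ : ℂ} (hc₀ : (c₀ : RiemannSphere) ∈ C')
    {x x' y : ℂ} (hx : invChart c₀ x ∈ B') (hx' : invChart c₀ x' ∈ B') (hne : x ≠ x')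
    (hy : invChart c₀ y ∈ C') {𝒰 : Ultrafilter ℕ} (h𝒰 : (𝒰 : Filter ℕ) ≤ atTop) {m : ℝ≥0∞}
    (hm0 : 0 < m) (hm : ∀ᶠ i in 𝒰, m < modulus (A i)) :
    ∃ f : ℂ → ℂ, DifferentiableOn ℂ f (roundAnnulus 1 (outerRadius m)) ∧
      (∀ x, invChart c₀ x ∈ B' → (∀ z ∈ roundAnnulus 1 (outerRadius m), f z - x ≠ 0) ∧
        ¬ HasLogOn (fun z => f z - x) (roundAnnulus 1 (outerRadius m))) ∧
      ∀ y, invChart c₀ y ∈ C' → (∀ z ∈ roundAnnulus 1 (outerRadius m), f z - y ≠ 0) ∧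
        HasLogOn (fun z => f z - y) (roundAnnulus 1 (outerRadius m)) := by
  have hmt : m ≠ ⊤ := hm.exists.choose_spec.ne_top
  have hρ := one_lt_outerRadius hm0 hmt
  obtain ⟨c, hcC, hc⟩ := h.exists_poles hc₀
  have hunif := h.eventually_uniformization hcC hc hx hx' hne
  have hp : ∀ᶠ i in 𝒰, ∃ p : ℂ → ℂ, DifferentiableOn ℂ p (roundAnnulus 1 (outerRadius m)) ∧
      InjOn p (roundAnnulus 1 (outerRadius m)) ∧
      MapsTo p (roundAnnulus 1 (outerRadius m)) (invChart (c i) ⁻¹' A i) ∧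
      (∀ x ∈ invChart (c i) ⁻¹' B i,
        ¬ HasLogOn (fun z => p z - x) (roundAnnulus 1 (outerRadius m))) ∧
      ∀ y ∈ invChart (c i) ⁻¹' C i,
        HasLogOn (fun z => p z - y) (roundAnnulus 1 (outerRadius m)) := by
    filter_upwards [h𝒰 hcC, h𝒰 hunif, hm] with i h1 h2 h3
    obtain ⟨r, R, q, hq, hqb, hmod⟩ := h2
    rw [hmod] at h3
    exact (h.isRing h1).exists_standard_annulus hq hqb hm0 h3
  obtain ⟨p, hp⟩ := hp.choice
  have hd := hp.mono fun i hi => hi.1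
  have hB : ∀ x, invChart c₀ x ∈ B' → ∃ ξ : ℕ → ℂ, Tendsto ξ 𝒰 (𝓝 x) ∧
      (∀ᶠ i in 𝒰, ∀ z ∈ roundAnnulus 1 (outerRadius m), p i z - ξ i ≠ 0) ∧
      ∀ᶠ i in 𝒰, ¬ HasLogOn (fun z => p i z - ξ i) (roundAnnulus 1 (outerRadius m)) := by
    intro x hx
    obtain ⟨ξ, hξ, hξt⟩ := exists_tendsto_planar (fun i => (h.isConnected_left i).nonempty)
      h.isClosed_left h.nontrivial_left.nonempty h.tendsto_left hc hx
    refine ⟨ξ, hξt.mono_left h𝒰, ?_, ?_⟩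
    · filter_upwards [h𝒰 hcC, hp, h𝒰 hξ] with i h1 h2 h3
      exact sub_ne_zero_of_mapsTo h2.2.2.1 ((h.isRing h1).notMem_of_mem_inner h3)
    · filter_upwards [hp, h𝒰 hξ] with i h2 h3 using h2.2.2.2.1 _ h3
  have hC : ∀ y, invChart c₀ y ∈ C' → ∃ ξ : ℕ → ℂ, Tendsto ξ 𝒰 (𝓝 y) ∧
      (∀ᶠ i in 𝒰, ∀ z ∈ roundAnnulus 1 (outerRadius m), p i z - ξ i ≠ 0) ∧
      ∀ᶠ i in 𝒰, HasLogOn (fun z => p i z - ξ i) (roundAnnulus 1 (outerRadius m)) := by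
    intro y hy
    obtain ⟨ξ, hξ, hξt⟩ := exists_tendsto_planar (fun i => (h.isConnected_right i).nonempty)
      h.isClosed_right h.nontrivial_right.nonempty h.tendsto_right hc hy
    refine ⟨ξ, hξt.mono_left h𝒰, ?_, ?_⟩
    · filter_upwards [h𝒰 hcC, hp, h𝒰 hξ] with i h1 h2 h3
      exact sub_ne_zero_of_mapsTo h2.2.2.1 ((h.isRing h1).notMem_of_mem_outer h3)
    · filter_upwards [hp, h𝒰 hξ] with i h2 h3 using h2.2.2.2.2 _ h3
  -- Two points of `B'` and one of `C'` suffice to obtain a nonconstant limit; every other point is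
  -- then tested against that limit.
  obtain ⟨ξ, hξt, hξ0, hξl⟩ := hB x hx
  obtain ⟨ξ', hξt', hξ0', hξl'⟩ := hB x' hx'
  obtain ⟨η, hηt, -, hηl⟩ := hC y hy
  obtain ⟨f, hf, hfd, hfc⟩ := exists_limit_of_separating hρ hd (hp.mono fun i hi => hi.2.1)
    hξt hξt' hηt hne hξ0 hξ0' hξl hξl' hηl
  refine ⟨f, hfd, fun x hx => ?_, fun y hy => ?_⟩
  · obtain ⟨ξ, hξt, hξ0, hξl⟩ := hB x hx
    obtain ⟨h1, h2⟩ := limit_sub_ne_zero_and_hasLogOn hρ hf hfd hfc hd hξt hξ0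
    obtain ⟨i, h3, h4⟩ := (h2.and hξl).exists
    exact ⟨h1, fun h5 => h4 (h3.2 h5)⟩
  · obtain ⟨ξ, hξt, hξ0, hξl⟩ := hC y hy
    obtain ⟨h1, h2⟩ := limit_sub_ne_zero_and_hasLogOn hρ hf hfd hfc hd hξt hξ0
    obtain ⟨i, h3, h4⟩ := (h2.and hξl).exists
    exact ⟨h1, h3.1 h4⟩

theorem exists_pole_notMem {S : Set RiemannSphere} (hS : S.Infinite) (p : RiemannSphere) :
    ∃ c : ℂ, (c : RiemannSphere) ∈ S ∧ (c : RiemannSphere) ≠ p := by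
  obtain ⟨w, hw, hw'⟩ := (hS.sdiff (toFinite {p, OnePoint.infty})).nonempty
  rw [mem_insert_iff, mem_singleton_iff, not_or] at hw'
  obtain ⟨c, rfl⟩ := OnePoint.ne_infty_iff_exists.1 hw'.2
  exact ⟨c, hw, hw'.1⟩

theorem exists_planar_pair {S : Set RiemannSphere} (hS : S.Infinite) (c : ℂ) :
    ∃ x x' : ℂ, invChart c x ∈ S ∧ invChart c x' ∈ S ∧ x ≠ x' := by
  obtain ⟨w, hw, hwc⟩ := (hS.sdiff (toFinite {(c : RiemannSphere)})).nonempty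
  obtain ⟨w', hw', hwc'⟩ := (hS.sdiff (toFinite {(c : RiemannSphere), w})).nonempty
  rw [mem_insert_iff, mem_singleton_iff, not_or] at hwc'
  rw [mem_singleton_iff] at hwc
  refine ⟨invCoord c w, invCoord c w', by rwa [invChart_invCoord hwc],
    by rwa [invChart_invCoord hwc'.1], fun heq => hwc'.2 ?_⟩
  rw [← invChart_invCoord hwc, heq, invChart_invCoord hwc'.1]

theorem exists_ultrafilter_of_not_eventually_lt {u : ℕ → ℝ≥0∞} {M : ℝ≥0∞}
    (hM : ¬ ∀ᶠ i in atTop, u i < M) :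
    ∃ 𝒰 : Ultrafilter ℕ, (𝒰 : Filter ℕ) ≤ atTop ∧ ∀ᶠ i in 𝒰, M ≤ u i := by
  rw [not_eventually] at hM
  have : (atTop ⊓ 𝓟 {i | ¬ u i < M}).NeBot := frequently_iff_neBot.1 hM
  refine ⟨Ultrafilter.of (atTop ⊓ 𝓟 {i | ¬ u i < M}), (Ultrafilter.of_le _).trans inf_le_left, ?_⟩
  have : ∀ᶠ i in atTop ⊓ 𝓟 {i | ¬ u i < M}, M ≤ u i := by
    rw [eventually_inf_principal]
    exact Eventually.of_forall fun i hi => not_lt.1 hi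
  exact (Ultrafilter.of_le _) this

/-- If the moduli did not tend to `0`, a limit map `f` would exist for some `m > 0`. At a common
point `p` of `B'` and `C'`, read in the chart, `f - p` would both have and lack a logarithm. -/
theorem tendsto_modulus_zero (h : IsConvergent A B C B' C') (hBC : ¬ Disjoint B' C') :
    Tendsto (fun i => modulus (A i)) atTop (𝓝 0) := by
  obtain ⟨p, hpB, hpC⟩ := Set.not_disjoint_iff.1 hBC
  obtain ⟨c₀, hc₀, hcp⟩ := exists_pole_notMem h.infinite_right p
  obtain ⟨x, x', hx, hx', hne⟩ := exists_planar_pair h.infinite_left c₀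
  have hp := invChart_invCoord hcp.symm
  rw [ENNReal.tendsto_nhds_zero]
  intro M hM
  by_contra hcon
  obtain ⟨𝒰, h𝒰, hM𝒰⟩ := exists_ultrafilter_of_not_eventually_lt (u := fun i => modulus (A i))
    (M := M) fun h => hcon (h.mono fun i hi => hi.le)
  obtain ⟨m, hm0, hm⟩ := exists_between hM
  obtain ⟨f, -, h1, h2⟩ := h.exists_limit_map hc₀ hx hx' hne (y := invCoord c₀ p) (by rwa [hp]) h𝒰
    hm0 (hM𝒰.mono fun i hi => hm.trans_le hi)
  exact (h1 (invCoord c₀ p) (by rwa [hp])).2 (h2 (invCoord c₀ p) (by rwa [hp])).2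

end IsConvergent
-- Semicontinuity of the modulus
namespace IsConvergent
variable {A B C : ℕ → Set RiemannSphere} {B' C' : Set RiemannSphere}

/-- An essential map of an annulus into the complement of `B' ∪ C'` lands in the component which
separates `B'` from `C'`. -/
theorem mapsTo_of_separates {A' : Set RiemannSphere} (hA' : A' ∈ components (B' ∪ C')ᶜ)
    {x y : RiemannSphere} (hxB : x ∈ B') (hyC : y ∈ C') (hxA : x ∈ closure A')
    (hyA : y ∈ closure A') {c : ℂ} (hc : (c : RiemannSphere) ∈ C')
    (hcx : x ≠ (c : RiemannSphere)) (hcy : y ≠ (c : RiemannSphere)) {r R : ℝ≥0∞} (hrR : r < R)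
    {f : ℂ → ℂ} (hf : DifferentiableOn ℂ f (roundAnnulus r R))
    (hfB : ∀ x, invChart c x ∈ B' → (∀ z ∈ roundAnnulus r R, f z - x ≠ 0) ∧
        ¬ HasLogOn (fun z => f z - x) (roundAnnulus r R))
    (hfC : ∀ y, invChart c y ∈ C' → (∀ z ∈ roundAnnulus r R, f z - y ≠ 0) ∧
        HasLogOn (fun z => f z - y) (roundAnnulus r R)) :
    MapsTo f (roundAnnulus r R) (invChart c ⁻¹' A') := by
  obtain ⟨w, hw, hwA⟩ := hA'
  have hθ := continuous_invChart c
  have hsub : (fun z => invChart c (f z)) '' roundAnnulus r R ⊆ (B' ∪ C')ᶜ := by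
    rintro _ ⟨z, hz, rfl⟩ (h | h)
    · exact (hfB (f z) h).1 z hz (sub_self _)
    · exact (hfC (f z) h).1 z hz (sub_self _)
  have hpre : IsPreconnected ((fun z => invChart c (f z)) '' roundAnnulus r R) :=
    (isConnected_roundAnnulus hrR).isPreconnected.image _ (hθ.comp_continuousOn hf.continuousOn)
  by_cases hmeet : ∃ z ∈ roundAnnulus r R, invChart c (f z) ∈ A'
  · obtain ⟨z, hz, hzA⟩ := hmeet
    intro z' hz'
    rw [mem_preimage, hwA]
    rw [hwA] at hzA
    rw [connectedComponentIn_eq hzA]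
    exact hpre.subset_connectedComponentIn ⟨z, hz, rfl⟩ hsub ⟨z', hz', rfl⟩
  exfalso
  push Not at hmeet
  have hx := invChart_invCoord hcx
  have hy := invChart_invCoord hcy
  set ξ := invCoord c x with hξ
  set η := invCoord c y with hη
  have hcl : ∀ u, invChart c u ∈ closure A' → u ∈ closure (invChart c ⁻¹' A') := by
    intro u hu
    rwa [← (isOpenEmbedding_invChart c).isOpenMap.preimage_closure_eq_closure_preimage hθ]
  have hcA : (c : RiemannSphere) ∉ A' := by
    rw [hwA]
    exact fun h => connectedComponentIn_subset _ _ h (Or.inr hc)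
  have hA'c : IsConnected A' := by
    rw [hwA]
    exact isConnected_connectedComponentIn_iff.2 hw
  -- If the image missed `A'`, this connected set would join `ξ` to `η` off the image of a circle,
  -- so `(f - ξ) / (f - η)` would have a logarithm there. As `f - η` has one, so would `f - ξ`.
  have hT : IsPreconnected (insert ξ (insert η (invChart c ⁻¹' A'))) :=
    (isConnected_preimage_invChart hcA hA'c).isPreconnected.subset_closure
      ((subset_insert _ _).trans (subset_insert _ _))
      (insert_subset (hcl ξ (by rwa [hx])) (insert_subset (hcl η (by rwa [hy])) subset_closure))
  obtain ⟨h1, h2⟩ := hfB ξ (by rwa [hx])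
  obtain ⟨h3, h4⟩ := hfC η (by rwa [hy])
  obtain ⟨s, hs, hs1, hs2⟩ := exists_circle hrR
  have hss := sphere_subset_roundAnnulus hs1 hs2
  have hcont : ContinuousOn f (sphere 0 s) := hf.continuousOn.mono hss
  have hd : Disjoint (f '' sphere 0 s) (insert ξ (insert η (invChart c ⁻¹' A'))) := by
    rw [Set.disjoint_left]
    rintro _ ⟨z, hz, rfl⟩ (h | h | h)
    · exact h1 z (hss hz) (sub_eq_zero.2 h)
    · exact h3 z (hss hz) (sub_eq_zero.2 h)
    · exact hmeet z (hss hz) h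
  have hq := (HasLogOn.sub_div_sub ((isCompact_sphere 0 s).image_of_continuousOn hcont) hT hd
    (mem_insert ξ _) (mem_insert_of_mem _ (mem_insert η _))).comp hcont (mapsTo_image _ _)
  apply h2
  exact HasLogOn.of_sphere hs hs1 hs2 (hf.sub_const ξ) h1
    ((hq.div_iff fun z hz => h3 z (hss hz)).2 (h4.mono hss))

/-- Changing the pole from `c₀` to `c i` replaces `F` by `F / (1 + (c₀ - c i) F)`, which tends to
`F` uniformly where `F` is bounded. This permits a pole in `C i` that varies with `i`. -/
theorem tendstoUniformlyOn_invCoord {c : ℕ → ℂ} {c₀ : ℂ} (hc : Tendsto c atTop (𝓝 c₀)) {ξ : ℕ → ℂ}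
    {x : ℂ} (hξ : Tendsto ξ atTop (𝓝 x)) {F : ℂ → ℂ} {S : Set ℂ} (hS : IsCompact S)
    (hF : ContinuousOn F S) :
    TendstoUniformlyOn (fun i z => invCoord (c i) (invChart c₀ (F z)) - ξ i) (fun z => F z - x)
      atTop S := by
  obtain ⟨M, hM⟩ := (hS.image_of_continuousOn hF).isBounded.exists_norm_le
  have hM' : ∀ z ∈ S, ‖F z‖ ≤ |M| := fun z hz => (hM _ ⟨z, hz, rfl⟩).trans (le_abs_self M)
  have hε : Tendsto (fun i => ‖c₀ - c i‖) atTop (𝓝 0) := by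
    simpa using (hc.const_sub c₀).norm
  have h1 : Tendsto (fun i => ‖c₀ - c i‖ * |M|) atTop (𝓝 0) := by simpa using hε.mul_const |M|
  have h2 : Tendsto (fun i => 2 * (‖c₀ - c i‖ * |M|) * |M| + ‖ξ i - x‖) atTop (𝓝 0) := by
    have h3 := ((h1.const_mul 2).mul_const |M|).add ((hξ.sub_const x).norm)
    simpa using h3
  rw [Metric.tendstoUniformlyOn_iff]
  intro δ hδ
  filter_upwards [h1.eventually (gt_mem_nhds (by norm_num : (0 : ℝ) < 1 / 2)),
    h2.eventually (gt_mem_nhds hδ)] with i hi1 hi2 z hz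
  set ε := c₀ - c i with hεdef
  have h3 : ‖ε * F z‖ ≤ ‖ε‖ * |M| := by
    rw [norm_mul]
    gcongr
    exact hM' z hz
  have h4 : 1 / 2 ≤ ‖1 + ε * F z‖ := by
    have := norm_sub_le (1 + ε * F z) (ε * F z)
    rw [add_sub_cancel_right, norm_one] at this
    linarith
  have h5 : 1 + ε * F z ≠ 0 := by
    intro h
    rw [h, norm_zero] at h4
    norm_num at h4
  rw [invCoord_eq_div (c i) (invChart_ne c₀ (F z)), invCoord_invChart, dist_comm, dist_eq_norm,
    ← hεdef]
  have e : F z / (1 + ε * F z) = F z - ε * F z * F z / (1 + ε * F z) := by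
    rw [eq_sub_iff_add_eq, ← add_div, div_eq_iff h5]
    ring
  have e' : F z / (1 + ε * F z) - ξ i - (F z - x) =
      -(ε * F z * F z / (1 + ε * F z)) - (ξ i - x) := by
    rw [e]
    ring
  rw [e']
  refine (norm_sub_le _ _).trans_lt (lt_of_le_of_lt ?_ hi2)
  gcongr
  rw [norm_neg, norm_div, norm_mul, div_le_iff₀ (by linarith)]
  have h6 : ‖ε * F z‖ * ‖F z‖ ≤ (‖ε‖ * |M|) * |M| := by
    gcongr
    exact hM' z hz
  have h7 : 0 ≤ ‖ε‖ * |M| * |M| := by positivity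
  nlinarith

/-- The modulus of the limit domain is at most the lower limit of the moduli. -/
theorem eventually_lt_modulus (h : IsConvergent A B C B' C') {A' B₁ C₁ : Set RiemannSphere}
    (hA'o : IsOpen A') (hA'c : IsConnected A') (hB₁ : IsClosed B₁) (hB₁c : IsConnected B₁)
    (hC₁ : IsClosed C₁) (hC₁c : IsConnected C₁) (hcompl : A'ᶜ = B₁ ∪ C₁) (hd : Disjoint B₁ C₁)
    (hB : B' ⊆ B₁) (hC : C' ⊆ C₁) {m : ℝ≥0∞} (hm : m < modulus A') :
    ∀ᶠ i in atTop, m < modulus (A i) := by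
  obtain ⟨c₀, hc₀, -⟩ := exists_pole_notMem h.infinite_right OnePoint.infty
  obtain ⟨x, x', hx, hx', hne⟩ := exists_planar_pair h.infinite_left c₀
  have hring := isRing_preimage_invChart hA'o hA'c hB₁ hB₁c hC₁ hC₁c hcompl hd (hC hc₀)
  have hcA : (c₀ : RiemannSphere) ∉ A' := fun hcA =>
    (hcompl ▸ Or.inr (hC hc₀) : (c₀ : RiemannSphere) ∈ A'ᶜ) hcA
  obtain ⟨r, R, hrR, F, hF, hFb⟩ := hring.exists_uniformization ⟨x, hB hx, x', hB hx', hne⟩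
  rw [modulus_eq_roundModulus hcA hring hrR hF hFb] at hm
  obtain ⟨a, b, ha, hab, hra, hbR, hme, hlt⟩ := exists_lt_roundModulus hm
  have hb := ha.trans hab
  set Q : Set ℂ := {z | a ≤ ‖z‖ ∧ ‖z‖ ≤ b} with hQ
  have hQc : IsCompact Q := by
    refine (isCompact_closedBall (0 : ℂ) b).of_isClosed_subset ?_ fun z hz => ?_
    · exact (isClosed_le continuous_const continuous_norm).inter
        (isClosed_le continuous_norm continuous_const)
    · rw [mem_closedBall_zero_iff]
      exact hz.2
  have hQA : Q ⊆ roundAnnulus r R := by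
    intro z hz
    rw [roundAnnulus, mem_ofPred_eq, ← ofReal_norm]
    exact ⟨hra.trans_le (ENNReal.ofReal_le_ofReal hz.1),
      (ENNReal.ofReal_le_ofReal hz.2).trans_lt hbR⟩
  have hAQ : roundAnnulus (ENNReal.ofReal a) (ENNReal.ofReal b) ⊆ Q := by
    intro z hz
    rw [mem_roundAnnulus_ofReal ha.le] at hz
    exact ⟨hz.1.le, hz.2.le⟩
  have hFQ : IsClosed ((fun z => invChart c₀ (F z)) '' Q) :=
    (hQc.image_of_continuousOn ((continuous_invChart c₀).comp_continuousOn
      (hF.continuousOn.mono hQA))).isClosed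
  have hFA : (fun z => invChart c₀ (F z)) '' Q ⊆ A' := by
    rintro _ ⟨z, hz, rfl⟩
    exact hFb.mapsTo (hQA hz)
  have hdB := eventually_disjoint h.nontrivial_left.nonempty h.isClosed_left_lim h.tendsto_left hFQ
    (Set.disjoint_left.2 fun w hw hwB => (hcompl ▸ Or.inl (hB hwB) : w ∈ A'ᶜ) (hFA hw))
  have hdC := eventually_disjoint h.nontrivial_right.nonempty h.isClosed_right_lim h.tendsto_right
    hFQ (Set.disjoint_left.2 fun w hw hwC => (hcompl ▸ Or.inr (hC hwC) : w ∈ A'ᶜ) (hFA hw))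
  obtain ⟨s, hs1, hs2⟩ := exists_between hab
  have hs0 : 0 < s := ha.trans hs1
  have has : ENNReal.ofReal a < ENNReal.ofReal s :=
    (ENNReal.ofReal_lt_ofReal_iff_of_nonneg ha.le).2 hs1
  have hsb : ENNReal.ofReal s < ENNReal.ofReal b :=
    (ENNReal.ofReal_lt_ofReal_iff_of_nonneg hs0.le).2 hs2
  have hss := sphere_subset_roundAnnulus has hsb
  obtain ⟨c, hcC, hc⟩ := h.exists_poles hc₀
  obtain ⟨ξ, hξ, hξt⟩ := exists_tendsto_planar (fun i => (h.isConnected_left i).nonempty)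
    h.isClosed_left h.nontrivial_left.nonempty h.tendsto_left hc hx
  have hlF : ¬ HasLogOn (fun z => F z - x) (sphere 0 s) :=
    hring.not_hasLogOn_sub_sphere hF hFb (hB hx) hs0 (hra.trans has) (hsb.trans hbR)
  have hFc : ContinuousOn F (sphere 0 s) := hF.continuousOn.mono (hss.trans (hAQ.trans hQA))
  have hne0 := sub_ne_zero_of_mapsTo hFb.mapsTo (hring.notMem_of_mem_inner (hB hx))
  have hGd : ∀ i, (c i : RiemannSphere) ∈ C i → Disjoint ((fun z => invChart c₀ (F z)) '' Q) (C i) →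
      DifferentiableOn ℂ (fun z => invCoord (c i) (invChart c₀ (F z)))
        (roundAnnulus (ENNReal.ofReal a) (ENNReal.ofReal b)) := by
    intro i hi hdi
    refine differentiableOn_invCoord_comp (isOpen_roundAnnulus _ _)
      (holomorphicOn_invChart_comp c₀ (isOpen_roundAnnulus _ _) (hF.mono (hAQ.trans hQA)))
      fun z hz heq => ?_
    exact Set.disjoint_left.1 hdi ⟨z, hAQ hz, rfl⟩
      (show invChart c₀ (F z) ∈ C i by rw [heq]; exact hi)
  -- The winding about the approximating point `ξ i` of `B i` agrees with that of `F` about `x`, so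
  -- the image of the subannulus is essential in `A i`.
  have hiff := eventually_hasLogOn_iff (isCompact_sphere 0 s)
    (tendstoUniformlyOn_invCoord hc hξt (isCompact_sphere 0 s) hFc) (by
      filter_upwards [hcC, hdC] with i h1 h2
      exact ((hGd i h1 h2).sub_const (ξ i)).continuousOn.mono hss)
    (hFc.sub continuousOn_const) (fun z hz => hne0 z (hQA (hAQ (hss hz))))
  filter_upwards [hcC, hdB, hdC, hξ, hiff, h.eventually_uniformization hcC hc hx hx' hne]
    with i h1 h2 h3 h4 h5 h6
  obtain ⟨r', R', q, hq, hqb, hmod⟩ := h6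
  have hmaps : MapsTo (fun z => invCoord (c i) (invChart c₀ (F z)))
      (roundAnnulus (ENNReal.ofReal a) (ENNReal.ofReal b)) (invChart (c i) ⁻¹' A i) := by
    intro z hz
    have hzQ : invChart c₀ (F z) ∈ (fun z => invChart c₀ (F z)) '' Q := ⟨z, hAQ hz, rfl⟩
    have hnB := Set.disjoint_left.1 h2 hzQ
    have hnC := Set.disjoint_left.1 h3 hzQ
    rw [mem_preimage, invChart_invCoord fun heq => hnC (by rw [heq]; exact h1)]
    by_contra hnA
    have : invChart c₀ (F z) ∈ B i ∪ C i := h.compl_eq i ▸ hnA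
    exact this.elim hnB hnC
  have hle := roundModulus_le_of_mapsTo ((h.isRing h1).notMem_of_mem_inner h4) hq hqb (hGd i h1 h3)
    hmaps fun hl => hlF (h5.1 (hl.mono hss))
  rw [hmod]
  refine lt_of_lt_of_le ?_ hle
  have hpi := Real.pi_pos
  rw [roundModulus_ofReal ha hab, hme,
    ENNReal.ofReal_lt_ofReal_iff_of_nonneg ENNReal.toReal_nonneg, lt_div_iff₀ (by positivity)]
  linarith

/-- The upper limit of the moduli is at most the modulus of the limit domain. -/
theorem eventually_modulus_lt (h : IsConvergent A B C B' C') {A' B₁ C₁ : Set RiemannSphere}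
    (hA' : A' ∈ components (B' ∪ C')ᶜ)
    (hA'o : IsOpen A') (hA'c : IsConnected A') (hB₁ : IsClosed B₁) (hB₁c : IsConnected B₁)
    (hC₁ : IsClosed C₁) (hC₁c : IsConnected C₁) (hcompl : A'ᶜ = B₁ ∪ C₁) (hd : Disjoint B₁ C₁)
    (hB : B' ⊆ B₁) (hC : C' ⊆ C₁) {M : ℝ≥0∞} (hM : modulus A' < M) :
    ∀ᶠ i in atTop, modulus (A i) < M := by
  obtain ⟨x, hxA, hxB⟩ := closure_inter_nonempty_of_separates hA' h.nontrivial_left.nonempty hB₁ hC₁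
    hcompl hd hB hC
  obtain ⟨y, hyA, hyC⟩ := closure_inter_nonempty_of_separates (B := C') (C := B')
    (by rwa [union_comm]) h.nontrivial_right.nonempty hC₁ hB₁ (by rwa [union_comm]) hd.symm hC hB
  -- The pole must lie in `C'` yet differ from the adherent point `y`, so that both `x` and `y` are
  -- finite in the chart.
  obtain ⟨c₀, hc₀, hcy⟩ := exists_pole_notMem h.infinite_right y
  have hcx : x ≠ (c₀ : RiemannSphere) := fun heq =>
    Set.disjoint_left.1 hd (hB hxB) (hC (heq ▸ hc₀))
  obtain ⟨ξ, ξ', hξ, hξ', hne⟩ := exists_planar_pair h.infinite_left c₀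
  have hy := invChart_invCoord hcy.symm
  by_contra hcon
  obtain ⟨𝒰, h𝒰, hM𝒰⟩ := exists_ultrafilter_of_not_eventually_lt hcon
  -- Taking `m` strictly below `M` makes it finite and less than the moduli along the ultrafilter;
  -- taking it above `modulus A'` yields the contradiction.
  obtain ⟨m, hmA, hmM⟩ := exists_between hM
  have hm0 : 0 < m := (zero_le).trans_lt hmA
  obtain ⟨f, hf, hfB, hfC⟩ := h.exists_limit_map hc₀ hξ hξ' hne (y := invCoord c₀ y) (by rwa [hy])
    h𝒰 hm0 (hM𝒰.mono fun i hi => hmM.trans_le hi)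
  have hρ := one_lt_outerRadius hm0 hmM.ne_top
  have hmaps := mapsTo_of_separates hA' hxB hyC hxA hyA hc₀ hcx hcy.symm hρ hf hfB hfC
  have hring := isRing_preimage_invChart hA'o hA'c hB₁ hB₁c hC₁ hC₁c hcompl hd (hC hc₀)
  have hcA : (c₀ : RiemannSphere) ∉ A' := fun hcA =>
    (hcompl ▸ Or.inr (hC hc₀) : (c₀ : RiemannSphere) ∈ A'ᶜ) hcA
  obtain ⟨r, R, hrR, F, hF, hFb⟩ := hring.exists_uniformization ⟨ξ, hB hξ, ξ', hB hξ', hne⟩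
  have hle := roundModulus_le_of_mapsTo (hring.notMem_of_mem_inner (hB hξ)) hF hFb hf hmaps
    (hfB ξ hξ).2
  rw [roundModulus_one_outerRadius hm0 hmM.ne_top, ← modulus_eq_roundModulus hcA hring hrR hF hFb]
    at hle
  exact hmA.not_ge hle

end IsConvergent

theorem isConvergent_of_isDoublyConnected {A B C : ℕ → Set RiemannSphere} {B' C' : Set RiemannSphere}
    (hA : ∀ i, IsDoublyConnected (A i)) (hBC : ∀ i, components (A i)ᶜ = {B i, C i})
    (hB'closed : IsClosed B') (hC'closed : IsClosed C')
    (hB' : B'.Nontrivial) (hC' : C'.Nontrivial)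
    (hB : Tendsto (fun i => chordalHausdorffDist (B i) B') atTop (𝓝 0))
    (hC : Tendsto (fun i => chordalHausdorffDist (C i) C') atTop (𝓝 0)) :
    IsConvergent A B C B' C' := by
  have hne : ∀ i, B i ≠ C i := by
    intro i heq
    have h1 := (hA i).2.2
    rw [hBC i, heq, pair_eq_singleton, ncard_singleton] at h1
    omega
  have h := fun i => two_components (hA i).1.isClosed_compl (hBC i) (hne i)
  exact
    { isOpen := fun i => (hA i).1
      isConnected := fun i => (hA i).2.1
      isClosed_left := fun i => (h i).1
      isConnected_left := fun i => (h i).2.1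
      isClosed_right := fun i => (h i).2.2.1
      isConnected_right := fun i => (h i).2.2.2.1
      compl_eq := fun i => (h i).2.2.2.2.1
      disjoint := fun i => (h i).2.2.2.2.2
      isClosed_left_lim := hB'closed
      isClosed_right_lim := hC'closed
      nontrivial_left := hB'
      nontrivial_right := hC'
      tendsto_left := hB
      tendsto_right := hC }

end AnnulusModulus

/-! ### The convergence theorem -/

theorem mainTheorem6 (A B C : ℕ → Set RiemannSphere) (B' C' : Set RiemannSphere)
    (hA : ∀ i, RiemannSphere.IsDoublyConnected (A i))
    (hBC : ∀ i, RiemannSphere.components (A i)ᶜ = {B i, C i})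
    (hB'closed : IsClosed B') (hC'closed : IsClosed C')
    (hB' : B'.Nontrivial) (hC' : C'.Nontrivial)
    (hB : Tendsto (fun i => RiemannSphere.chordalHausdorffDist (B i) B') atTop (𝓝 0))
    (hC : Tendsto (fun i => RiemannSphere.chordalHausdorffDist (C i) C') atTop (𝓝 0)) :
    (∀ A' ∈ RiemannSphere.components (B' ∪ C')ᶜ, RiemannSphere.IsDoublyConnected A' →
      Tendsto (fun i => RiemannSphere.modulus (A i)) atTop (𝓝 (RiemannSphere.modulus A'))) ∧
    ((¬ ∃ A' ∈ RiemannSphere.components (B' ∪ C')ᶜ, RiemannSphere.IsDoublyConnected A') →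
      Tendsto (fun i => RiemannSphere.modulus (A i)) atTop (𝓝 0)) := by
  have h := AnnulusModulus.isConvergent_of_isDoublyConnected hA hBC hB'closed hC'closed hB' hC' hB hC
  -- In the second alternative `B'` and `C'` must meet, since disjoint continua are separated by a
  -- doubly connected component.
  refine ⟨fun A' hA' hd => ?_, fun hno => h.tendsto_modulus_zero fun hdis => hno ?_⟩
  · obtain ⟨B₁, C₁, hB₁, hB₁c, hC₁, hC₁c, hcompl, hdis, hBB, hCC⟩ :=
      AnnulusModulus.exists_compl_eq_union_of_isDoublyConnected hB'closed hC'closed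
        h.isConnected_left_lim h.isConnected_right_lim hA' hd
    rw [tendsto_order]
    exact ⟨fun m hm => h.eventually_lt_modulus hd.1 hd.2.1 hB₁ hB₁c hC₁ hC₁c hcompl hdis hBB hCC hm,
      fun M hM => h.eventually_modulus_lt hA' hd.1 hd.2.1 hB₁ hB₁c hC₁ hC₁c hcompl hdis hBB hCC hM⟩
  · exact AnnulusModulus.exists_isDoublyConnected_of_disjoint hB'closed hC'closed
      h.isConnected_left_lim h.isConnected_right_lim hdis
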